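/- Modules are right modules, and complexes are written cohomologically. Let $A$ and $B$ be $\mathbb{C}$-algebras with idempotents $e_A\in A$ and $e_B\in B$, put $A_{\mathrm{con}}=A/Ae_AA$ and $B_{\mathrm{con}}=B/Be_BB$, and write $i^*=-\otimes_A A_{\mathrm{con}}$ (respectively $i^*=-\otimes_B B_{\mathrm{con}}$) for extension of scalars. Fix integers $n\ge 1$ and $t\ge 0$. Suppose that $S_1,\dots,S_t$ are pairwise non-isomorphic finite dimensional simple $A$-modules with $S_je_A=0$ (so that $S_j\cong i^*S_j$ is a simple $A_{\mathrm{con}}$-module), and that each $S_j$ has a projective resolution by a complex of finitely generated projective $A$-modules \[ \mathcal{Q}_A^j\colon\quad 0\to Q^j_{n-1}\to Q^j_{n-2}\to\cdots\to Q^j_1\to Q^j_0\to 0 \] with $Q^j_0$ in degree $0$, such that $\mathrm{H}^{-k}(i^*\mathcal{Q}_A^j)\cong i^*S_j$ if $k\in\{0,n-1\}$, and $\mathrm{H}^{-k}(i^*\mathcal{Q}_A^j)=0$ otherwise. Suppose also that $B$, $e_B$ admit pairwise non-isomorphic finite dimensional simple $B$-modules $S_1',\dots,S_t'$ with $S_j'e_B=0$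 and complexes $\mathcal{Q}_B^1,\dots,\mathcal{Q}_B^t$ with the same properties, for the same $n$. If $A_{\mathrm{con}}\cong B_{\mathrm{con}}$ as $\mathbb{C}$-algebras, and each of them has precisely $t$ simple modules up to isomorphism, then there is an $A_\infty$-quasi-isomorphism between the DG-categories with objects $\{1,\dots,t\}$ \[ (i,j)\mapsto \mathcal{H}om_A(\mathcal{Q}_A^i,\mathcal{Q}_A^j)\qquad\text{and}\qquad (i,j)\mapsto \mathcal{H}om_B(\mathcal{Q}_B^i,\mathcal{Q}_B^j), \] that is, a $\mathbb{C}$-linear $A_\infty$-functor from the first to the second which is a bijection on objects (not necessarily the identity of $\{1,\dots,t\}$) and whose linear component is a quasi-isomorphism on every morphism complex. -/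

import Mathlib

universe u u' v w

open CategoryTheory

namespace DGRec

/-! ### Words: composable strings -/

/-- Composable strings `x = x₀ → x₁ → ⋯ → x_d = y` of elements of a family `G`. The letters are
listed in the order `a₁, a₂, …, a_d` with `a₁` starting at `x`. -/
inductive Word {O : Type u} (G : O → O → Type v) : O → O → Type (max u v)
  | nil (x : O) : Word G x x
  | cons {x y z : O} (a : G x y) (w : Word G y z) : Word G x z

namespace Word

variable {O : Type u} {G : O → O → Type v}

/-- The one-letter word. -/
def single {x y : O} (a : G x y) : Word G x y := cons a (nil y)

/-- Concatenation of words. -/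
def append {x y z : O} : Word G x y → Word G y z → Word G x z
  | nil _, v => v
  | cons a w, v => cons a (append w v)

/-- The number of letters. -/
def length {x y : O} : Word G x y → ℕ
  | nil _ => 0
  | cons _ w => length w + 1

/-- All ways of writing a word as `v · t` with `v` nonempty. -/
def prefixes {x y : O} : Word G x y → List (Σ z : O, Word G x z × Word G z y)
  | nil _ => []
  | cons a w => ⟨_, single a, w⟩ :: (prefixes w).map (fun c => ⟨c.1, cons a c.2.1, c.2.2⟩)

/-- A factorization `u · v · t` of a word from `x` to `y`. -/
structure Cut (G : O → O → Type v) (x y : O) where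
  {s t : O}
  left : Word G x s
  mid : Word G s t
  right : Word G t y

/-- All ways of writing a word as `u · v · t` with `v` nonempty. -/
def cuts {x y : O} : Word G x y → List (Cut G x y)
  | nil _ => []
  | cons a w =>
      (prefixes (cons a w)).map (fun c => ⟨nil _, c.2.1, c.2.2⟩) ++
        (cuts w).map (fun c => ⟨cons a c.left, c.mid, c.right⟩)

/-- Adding a letter in front of a word `v₁ · ⋯ · v_r` of nonempty words: either as a new block,
or at the beginning of the first block. -/
def pushFront {x y z : O} (a : G x y) : Word (Word G) y z → List (Word (Word G) x z)
  | nil _ => [single (single a)]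
  | cons v c => [cons (single a) (cons v c), cons (cons a v) c]

/-- All ways of writing a word as a concatenation `v₁ · ⋯ · v_r` of nonempty words. -/
def blocks {x y : O} : Word G x y → List (Word (Word G) x y)
  | nil x => [nil x]
  | cons a w => (blocks w).flatMap (pushFront a)

theorem length_append {x y z : O} (w : Word G x y) (v : Word G y z) :
    (w.append v).length = w.length + v.length := by
  induction w with
  | nil => simp [append, length]
  | cons a w ih => simp [append, length, ih]; omega

theorem length_of_mem_prefixes {x y : O} (w : Word G x y) :
    ∀ c ∈ w.prefixes, c.2.1.length + c.2.2.length = w.length := by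
  induction w with
  | nil => simp [prefixes]
  | cons a w ih =>
    intro c hc
    simp only [prefixes, List.mem_cons, List.mem_map] at hc
    rcases hc with rfl | ⟨c, hc, rfl⟩
    · simp [single, length]; omega
    · have := ih c hc
      simp [length]; omega

theorem length_of_mem_cuts {x y : O} (w : Word G x y) :
    ∀ c ∈ w.cuts, c.left.length + c.mid.length + c.right.length = w.length := by
  induction w with
  | nil => simp [cuts]
  | cons a w ih =>
    intro c hc
    simp only [cuts, List.mem_append, List.mem_map] at hc
    rcases hc with ⟨c, hc, rfl⟩ | ⟨c, hc, rfl⟩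
    · have := length_of_mem_prefixes _ c hc
      simp only [length] at this ⊢; omega
    · have := ih c hc
      simp [length]; omega

end Word

/-! ### Graded words and reduced degrees -/

/-- Homogeneous morphisms of arbitrary degree. -/
abbrev Letter {O : Type u} (H : O → O → ℤ → Type v) (x y : O) : Type v := Σ p : ℤ, H x y p

/-- A homogeneous morphism of degree `p`, viewed as a letter. -/
abbrev letter {O : Type u} {H : O → O → ℤ → Type v} {x y : O} (p : ℤ) (a : H x y p) :
    Letter H x y := ⟨p, a⟩

/-- The reduced degree `|a₁| + ⋯ + |a_d| - d` of a word `a₁, …, a_d`. -/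
def rdeg {O : Type u} {H : O → O → ℤ → Type v} {x y : O} : Word (Letter H) x y → ℤ
  | Word.nil _ => 0
  | Word.cons a w => (a.1 - 1) + rdeg w

/-! ### `A_∞`-categories -/

/-- A (not necessarily unital) `A_∞`-category over `k`. The operation
`m_d(a_d, …, a_1)`, of degree `2 - d`, is the value of `m` at the word `a₁, …, a_d`; its component
of degree `n` is `m w n`, which vanishes unless `n = |a₁| + ⋯ + |a_d| + 2 - d`. The sign
convention is
`∑ (-1)^(|a₁| + ⋯ + |a_i| - i) m(a_d, …, m(a_{i+j}, …, a_{i+1}), a_i, …, a_1) = 0`. -/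
structure AInfCat (k : Type w) [CommRing k] where
  Ob : Type u
  Hom : Ob → Ob → ℤ → Type v
  [addCommGroup : ∀ x y n, AddCommGroup (Hom x y n)]
  [module : ∀ x y n, Module k (Hom x y n)]
  m : ∀ {x y : Ob}, Word (Letter Hom) x y → ∀ n : ℤ, Hom x y n
  m_nil : ∀ (x : Ob) (n : ℤ), m (Word.nil x) n = 0
  m_shape : ∀ {x y : Ob} (w : Word (Letter Hom) x y) (n : ℤ), rdeg w + 2 ≠ n → m w n = 0
  m_add : ∀ {x y z t : Ob} (l : Word (Letter Hom) x y) (p : ℤ) (a b : Hom y z p)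
    (r : Word (Letter Hom) z t) (n : ℤ),
    m (l.append (.cons (letter p (a + b)) r)) n =
      m (l.append (.cons (letter p a) r)) n + m (l.append (.cons (letter p b) r)) n
  m_smul : ∀ {x y z t : Ob} (l : Word (Letter Hom) x y) (p : ℤ) (c : k) (a : Hom y z p)
    (r : Word (Letter Hom) z t) (n : ℤ),
    m (l.append (.cons (letter p (c • a)) r)) n = c • m (l.append (.cons (letter p a) r)) n
  rel : ∀ {x y : Ob} (w : Word (Letter Hom) x y) (n : ℤ),
    (w.cuts.map (fun c => (rdeg c.left).negOnePow •
      m (c.left.append (.cons (letter (rdeg c.mid + 2) (m c.mid (rdeg c.mid + 2))) c.right)) n)).sum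
      = 0

attribute [instance] AInfCat.addCommGroup AInfCat.module

namespace AInfCat

variable {k : Type w} [CommRing k] (𝒜 : AInfCat.{u, v} k)

/-- The operation `m₁`, from degree `p` to degree `q` (zero unless `q = p + 1`). -/
def m₁ (x y : 𝒜.Ob) (p q : ℤ) : 𝒜.Hom x y p →ₗ[k] 𝒜.Hom x y q where
  toFun a := 𝒜.m (.single (letter p a)) q
  map_add' a b := 𝒜.m_add (.nil x) p a b (.nil y) q
  map_smul' c a := 𝒜.m_smul (.nil x) p c a (.nil y) q

/-- The cohomology `H^n(Hom(x, y))` with respect to `m₁`. -/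
abbrev H (x y : 𝒜.Ob) (n : ℤ) : Type v :=
  LinearMap.ker (𝒜.m₁ x y n (n + 1)) ⧸
    (LinearMap.range (𝒜.m₁ x y (n - 1) n)).submoduleOf (LinearMap.ker (𝒜.m₁ x y n (n + 1)))

end AInfCat

/-! ### `A_∞`-functors -/

/-- The word `F(v₁), …, F(v_r)` obtained from `v₁ · ⋯ · v_r` by applying a family `F` of
operations, the value of `F` at `v` being taken in degree `rdeg v + 1`. -/
def mapBlocks {O : Type u} {H : O → O → ℤ → Type v} {O' : Type u} {H' : O' → O' → ℤ → Type v}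
    (f : O → O') (F : ∀ {x y : O}, Word (Letter H) x y → ∀ n : ℤ, H' (f x) (f y) n) {x y : O} :
    Word (Word (Letter H)) x y → Word (Letter H') (f x) (f y)
  | .nil x => .nil (f x)
  | .cons v c => .cons (letter (rdeg v + 1) (F v (rdeg v + 1))) (mapBlocks f F c)

/-- An `A_∞`-functor. The component `F_d(a_d, …, a_1)`, of degree `1 - d`, is the value of `F` at
the word `a₁, …, a_d`. The relations are
`∑ m(F(a_d, …), …, F(…, a_1)) =
  ∑ (-1)^(|a₁| + ⋯ + |a_i| - i) F(a_d, …, m(a_{i+j}, …, a_{i+1}), a_i, …, a_1)`. -/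
structure AInfFunctor {k : Type w} [CommRing k] (𝒜 ℬ : AInfCat.{u, v} k) where
  obj : 𝒜.Ob → ℬ.Ob
  F : ∀ {x y : 𝒜.Ob}, Word (Letter 𝒜.Hom) x y → ∀ n : ℤ, ℬ.Hom (obj x) (obj y) n
  F_nil : ∀ (x : 𝒜.Ob) (n : ℤ), F (Word.nil x) n = 0
  F_shape : ∀ {x y : 𝒜.Ob} (w : Word (Letter 𝒜.Hom) x y) (n : ℤ), rdeg w + 1 ≠ n → F w n = 0
  F_add : ∀ {x y z t : 𝒜.Ob} (l : Word (Letter 𝒜.Hom) x y) (p : ℤ) (a b : 𝒜.Hom y z p)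
    (r : Word (Letter 𝒜.Hom) z t) (n : ℤ),
    F (l.append (.cons (letter p (a + b)) r)) n =
      F (l.append (.cons (letter p a) r)) n + F (l.append (.cons (letter p b) r)) n
  F_smul : ∀ {x y z t : 𝒜.Ob} (l : Word (Letter 𝒜.Hom) x y) (p : ℤ) (c : k) (a : 𝒜.Hom y z p)
    (r : Word (Letter 𝒜.Hom) z t) (n : ℤ),
    F (l.append (.cons (letter p (c • a)) r)) n = c • F (l.append (.cons (letter p a) r)) n
  rel : ∀ {x y : 𝒜.Ob} (w : Word (Letter 𝒜.Hom) x y) (n : ℤ),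
    (w.blocks.map (fun c => ℬ.m (mapBlocks obj F c) n)).sum =
      (w.cuts.map (fun c => (rdeg c.left).negOnePow •
        F (c.left.append
          (.cons (letter (rdeg c.mid + 2) (𝒜.m c.mid (rdeg c.mid + 2))) c.right)) n)).sum

namespace AInfFunctor

variable {k : Type w} [CommRing k] {𝒜 ℬ : AInfCat.{u, v} k} (Φ : AInfFunctor 𝒜 ℬ)

/-- The linear component of an `A_∞`-functor. -/
def F₁ (x y : 𝒜.Ob) (n : ℤ) : 𝒜.Hom x y n →ₗ[k] ℬ.Hom (Φ.obj x) (Φ.obj y) n where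
  toFun a := Φ.F (.single (letter n a)) n
  map_add' a b := Φ.F_add (.nil x) n a b (.nil y) n
  map_smul' c a := Φ.F_smul (.nil x) n c a (.nil y) n

/-- The linear component commutes with `m₁`. -/
theorem F₁_m₁ (x y : 𝒜.Ob) (p q : ℤ) (h : p + 1 = q) (a : 𝒜.Hom x y p) :
    ℬ.m₁ _ _ p q (Φ.F₁ x y p a) = Φ.F₁ x y q (𝒜.m₁ x y p q a) := by
  have e₁ : ∀ n n' : ℤ, n = n' →
      letter n (Φ.F (.single (letter p a)) n) = letter n' (Φ.F (.single (letter p a)) n') := by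
    rintro n _ rfl
    rfl
  have e₂ : ∀ n n' : ℤ, n = n' →
      letter n (𝒜.m (.single (letter p a)) n) = letter n' (𝒜.m (.single (letter p a)) n') := by
    rintro n _ rfl
    rfl
  have h₁ := Φ.rel (.single (letter p a)) q
  simp only [Word.single, Word.blocks, Word.cuts, Word.prefixes, Word.pushFront, mapBlocks,
    Word.append, List.flatMap_cons, List.flatMap_nil, List.map_cons, List.map_nil, List.append_nil,
    List.sum_cons, List.sum_nil, add_zero, rdeg, Int.negOnePow_zero, one_smul] at h₁
  have e₁' := e₁ (p - 1 + 0 + 1) p (by omega)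
  have e₂' := e₂ (p - 1 + 0 + 2) q (by omega)
  simp only [Word.single] at e₁' e₂'
  rw [e₁', e₂'] at h₁
  exact h₁

/-- The map induced by the linear component on cohomology. -/
def mapH (x y : 𝒜.Ob) (n : ℤ) : 𝒜.H x y n →ₗ[k] ℬ.H (Φ.obj x) (Φ.obj y) n :=
  Submodule.mapQ _ _
    ((Φ.F₁ x y n).restrict (p := LinearMap.ker (𝒜.m₁ x y n (n + 1)))
      (q := LinearMap.ker (ℬ.m₁ (Φ.obj x) (Φ.obj y) n (n + 1)))
      (by
        intro a ha
        rw [LinearMap.mem_ker] at ha ⊢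
        rw [Φ.F₁_m₁ x y n (n + 1) rfl, ha, map_zero]))
    (by
      rintro ⟨a, ha⟩ ⟨b, hb⟩
      exact ⟨Φ.F₁ x y (n - 1) b, by
        rw [Φ.F₁_m₁ x y (n - 1) n (by omega), hb]; rfl⟩)

/-- An `A_∞`-functor is a quasi-isomorphism if it is bijective on objects and its linear
component induces isomorphisms on the cohomology of all morphism complexes. -/
def IsQuasiIso : Prop :=
  Function.Bijective Φ.obj ∧ ∀ (x y : 𝒜.Ob) (n : ℤ), Function.Bijective (Φ.mapH x y n)

end AInfFunctor

/-! ### DG-categories -/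

/-- A DG-category over `k`. The differential from degree `p` to degree `q` is zero unless
`q = p + 1`, and `comp h f g` is the composite `g ∘ f` of `f : x → y` and `g : y → z`. -/
structure DGCat (k : Type w) [CommRing k] where
  Ob : Type u
  Hom : Ob → Ob → ℤ → Type v
  [addCommGroup : ∀ x y n, AddCommGroup (Hom x y n)]
  [module : ∀ x y n, Module k (Hom x y n)]
  d : ∀ (x y : Ob) (p q : ℤ), Hom x y p →ₗ[k] Hom x y q
  d_shape : ∀ (x y : Ob) (p q : ℤ), p + 1 ≠ q → d x y p q = 0
  d_d : ∀ (x y : Ob) (p q r : ℤ) (f : Hom x y p), d x y q r (d x y p q f) = 0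
  one : ∀ x : Ob, Hom x x 0
  comp : ∀ {x y z : Ob} {p q n : ℤ}, p + q = n → (Hom x y p →ₗ[k] Hom y z q →ₗ[k] Hom x z n)
  one_comp : ∀ {x y : Ob} {p : ℤ} (f : Hom x y p), comp (zero_add p) (one x) f = f
  comp_one : ∀ {x y : Ob} {p : ℤ} (f : Hom x y p), comp (add_zero p) f (one y) = f
  assoc : ∀ {x y z t : Ob} {p q r pq qr n : ℤ} (hpq : p + q = pq) (hqr : q + r = qr)
    (h : pq + r = n) (h' : p + qr = n) (f : Hom x y p) (g : Hom y z q) (e : Hom z t r),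
    comp h (comp hpq f g) e = comp h' f (comp hqr g e)
  leibniz : ∀ {x y z : Ob} {p q n p' q' n' : ℤ} (h : p + q = n) (_ : p + 1 = p') (_ : q + 1 = q')
    (_ : n + 1 = n') (h₁ : p + q' = n') (h₂ : p' + q = n') (f : Hom x y p) (g : Hom y z q),
    d x z n n' (comp h f g) =
      comp h₁ f (d y z q q' g) + q.negOnePow • comp h₂ (d x y p p' f) g

attribute [instance] DGCat.addCommGroup DGCat.module

namespace DGCat

variable {k : Type w} [CommRing k] (𝒞 : DGCat.{u, v} k)

/-- The `A_∞`-operations of a DG-category: `m₁(a) = (-1)^|a| d a`,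
`m₂(b, a) = (-1)^|a| b ∘ a`, and `m_d = 0` for `d ≥ 3`. -/
def op {x y : 𝒞.Ob} : Word (Letter 𝒞.Hom) x y → ∀ n : ℤ, 𝒞.Hom x y n
  | .nil _, _ => 0
  | .cons a (.nil _), n => a.1.negOnePow • 𝒞.d _ _ a.1 n a.2
  | .cons a (.cons b (.nil _)), n =>
      if h : a.1 + b.1 = n then a.1.negOnePow • 𝒞.comp h a.2 b.2 else 0
  | .cons _ (.cons _ (.cons _ _)), _ => 0

theorem op_of_length {x y : 𝒞.Ob} (w : Word (Letter 𝒞.Hom) x y) (hw : 3 ≤ w.length) (n : ℤ) :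
    𝒞.op w n = 0 := by
  match w with
  | .nil _ => rfl
  | .cons a (.nil _) => simp [Word.length] at hw
  | .cons a (.cons b (.nil _)) => simp [Word.length] at hw
  | .cons _ (.cons _ (.cons _ _)) => rfl

theorem op_shape {x y : 𝒞.Ob} (w : Word (Letter 𝒞.Hom) x y) (n : ℤ) (h : rdeg w + 2 ≠ n) :
    𝒞.op w n = 0 := by
  match w with
  | .nil _ => rfl
  | .cons a (.nil _) =>
    simp only [rdeg] at h
    simp only [op]
    rw [𝒞.d_shape _ _ _ _ (by omega)]
    simp
  | .cons a (.cons b (.nil _)) =>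
    simp only [rdeg] at h
    simp only [op]
    rw [dif_neg (by omega)]
  | .cons _ (.cons _ (.cons _ _)) => rfl

theorem op_add {x y z t : 𝒞.Ob} (l : Word (Letter 𝒞.Hom) x y) (p : ℤ) (a b : 𝒞.Hom y z p)
    (r : Word (Letter 𝒞.Hom) z t) (n : ℤ) :
    𝒞.op (l.append (.cons (letter p (a + b)) r)) n =
      𝒞.op (l.append (.cons (letter p a) r)) n + 𝒞.op (l.append (.cons (letter p b) r)) n := by
  cases l with
  | nil =>
    cases r with
    | nil => simp [op, Word.append]
    | cons c r =>
      cases r with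
      | nil =>
        simp only [op, Word.append]
        split_ifs <;> simp
      | cons c' r => simp [op, Word.append]
  | cons c l =>
    cases l with
    | nil =>
      cases r with
      | nil =>
        simp only [op, Word.append]
        split_ifs <;> simp
      | cons c' r => simp [op, Word.append]
    | cons c' l => cases l <;> simp [op, Word.append]

theorem op_smul {x y z t : 𝒞.Ob} (l : Word (Letter 𝒞.Hom) x y) (p : ℤ) (e : k) (a : 𝒞.Hom y z p)
    (r : Word (Letter 𝒞.Hom) z t) (n : ℤ) :
    𝒞.op (l.append (.cons (letter p (e • a)) r)) n =
      e • 𝒞.op (l.append (.cons (letter p a) r)) n := by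
  cases l with
  | nil =>
    cases r with
    | nil =>
      simp only [op, Word.append, map_smul]
      exact smul_comm _ _ _
    | cons c r =>
      cases r with
      | nil =>
        simp only [op, Word.append]
        split_ifs
        · simp only [map_smul, LinearMap.smul_apply]
          exact smul_comm _ _ _
        · simp
      | cons c' r => simp [op, Word.append]
  | cons c l =>
    cases l with
    | nil =>
      cases r with
      | nil =>
        simp only [op, Word.append]
        split_ifs
        · simp only [map_smul]
          exact smul_comm _ _ _
        · simp
      | cons c' r => simp [op, Word.append]
    | cons c' l => cases l <;> simp [op, Word.append]

theorem op_zero_letter {x y z t : 𝒞.Ob} (l : Word (Letter 𝒞.Hom) x y) (p : ℤ)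
    (r : Word (Letter 𝒞.Hom) z t) (n : ℤ) :
    𝒞.op (l.append (.cons (letter p (0 : 𝒞.Hom y z p)) r)) n = 0 := by
  have h := 𝒞.op_smul l p 0 0 r n
  rwa [zero_smul, zero_smul] at h

/-- The letter given by the value of the operations at a word. -/
theorem letter_op {x y : 𝒞.Ob} (w : Word (Letter 𝒞.Hom) x y) (n n' : ℤ) (h : n = n') :
    letter n (𝒞.op w n) = letter n' (𝒞.op w n') := by
  subst h
  rfl

theorem op_single {x y : 𝒞.Ob} (p : ℤ) (f : 𝒞.Hom x y p) (n : ℤ) :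
    𝒞.op (.cons (letter p f) (.nil y)) n = p.negOnePow • 𝒞.d x y p n f := rfl

theorem op_pair {x y z : 𝒞.Ob} {p q n : ℤ} (h : p + q = n) (f : 𝒞.Hom x y p) (g : 𝒞.Hom y z q) :
    𝒞.op (.cons (letter p f) (.cons (letter q g) (.nil z))) n =
      p.negOnePow • 𝒞.comp h f g := by
  simp [op, h]

theorem op_three {x y z t s : 𝒞.Ob} (a : Letter 𝒞.Hom x y) (b : Letter 𝒞.Hom y z)
    (c : Letter 𝒞.Hom z t) (w : Word (Letter 𝒞.Hom) t s) (n : ℤ) :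
    𝒞.op (.cons a (.cons b (.cons c w))) n = 0 := rfl

theorem op_letter_zero {x y : 𝒞.Ob} (p n : ℤ) :
    𝒞.op (.cons (letter p (0 : 𝒞.Hom x y p)) (.nil y)) n = 0 :=
  𝒞.op_zero_letter (.nil x) p (.nil y) n

theorem op_rel {x y : 𝒞.Ob} (w : Word (Letter 𝒞.Hom) x y) (n : ℤ) :
    (w.cuts.map (fun c => (rdeg c.left).negOnePow •
      𝒞.op (c.left.append
        (.cons (letter (rdeg c.mid + 2) (𝒞.op c.mid (rdeg c.mid + 2))) c.right)) n)).sum = 0 := by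
  by_cases hw : 4 ≤ w.length
  · apply List.sum_eq_zero
    intro b hb
    obtain ⟨c, hc, rfl⟩ := List.mem_map.1 hb
    have hlen := Word.length_of_mem_cuts w c hc
    by_cases hm : 3 ≤ c.mid.length
    · rw [𝒞.op_of_length c.mid hm, op_zero_letter, smul_zero]
    · rw [𝒞.op_of_length _ (by simp only [Word.length_append, Word.length]; omega), smul_zero]
  · cases w with
    | nil => rfl
    | cons a w =>
      obtain ⟨p, f⟩ := a
      cases w with
      | nil =>
        simp only [Word.single, Word.cuts, Word.prefixes,
          Word.append, List.map_cons, List.map_nil, List.append_nil,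
          List.sum_cons, List.sum_nil, add_zero, rdeg, Int.negOnePow_zero, one_smul]
        simp [op_single, 𝒞.d_d]
      | cons a w =>
        obtain ⟨q, g⟩ := a
        cases w with
        | nil =>
          simp only [Word.single, Word.cuts, Word.prefixes,
            Word.append, List.map_cons, List.map_nil, List.append_nil, List.cons_append,
            List.nil_append,
            List.sum_cons, List.sum_nil, rdeg, Int.negOnePow_zero, one_smul]
          by_cases hn : p + q + 1 = n
          · rw [𝒞.letter_op _ (p - 1 + 0 + 2) (p + 1) (by omega),
              𝒞.letter_op _ (q - 1 + 0 + 2) (q + 1) (by omega),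
              𝒞.letter_op _ (p - 1 + (q - 1 + 0) + 2) (p + q) (by omega)]
            simp only [op_single]
            rw [op_pair 𝒞 (n := n) (by omega), op_pair 𝒞 (n := n) (by omega),
              op_pair 𝒞 (n := p + q) rfl]
            have hp' : (p + 1).negOnePow = - p.negOnePow := by simp [Int.negOnePow_succ]
            have hp'' : (p - 1 + 0).negOnePow = - p.negOnePow := by
              simp [Int.negOnePow_sub]
            have hpq : (p + q).negOnePow = p.negOnePow * q.negOnePow := Int.negOnePow_add p q
            rw [hp', hp'', hpq]
            rcases Int.units_eq_one_or p.negOnePow with hp | hp <;>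
            rcases Int.units_eq_one_or q.negOnePow with hq | hq <;>
            simp only [hp, hq, Units.neg_smul, one_smul, map_neg, LinearMap.neg_apply, neg_neg,
              mul_one, mul_neg] <;>
            rw [𝒞.leibniz (p' := p + 1) (q' := q + 1) rfl rfl rfl hn
              (by omega) (by omega), hq] <;>
            simp only [Units.neg_smul, one_smul] <;> abel
          · rw [𝒞.op_shape _ n (by simp only [rdeg]; omega),
              𝒞.op_shape _ n (by simp only [rdeg]; omega),
              𝒞.op_shape _ n (by simp only [rdeg]; omega)]
            simp
        | cons a w =>
          obtain ⟨r, e⟩ := a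
          cases w with
          | nil =>
            simp only [Word.single, Word.cuts, Word.prefixes,
              Word.append, List.map_cons, List.map_nil, List.append_nil, List.cons_append,
              List.nil_append,
              List.sum_cons, List.sum_nil, rdeg, Int.negOnePow_zero, one_smul]
            rw [𝒞.letter_op _ (p - 1 + (q - 1 + 0) + 2) (p + q) (by omega),
              𝒞.letter_op _ (q - 1 + (r - 1 + 0) + 2) (q + r) (by omega)]
            simp only [op_three, op_letter_zero, smul_zero, zero_add, add_zero]
            by_cases hn : p + q + r = n
            · rw [op_pair 𝒞 (n := n) hn, op_pair 𝒞 (n := n) (by omega), op_pair 𝒞 (n := p + q) rfl,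
                op_pair 𝒞 (n := q + r) rfl]
              have hp'' : (p - 1).negOnePow = - p.negOnePow := by
                simp [Int.negOnePow_sub]
              have hpq : (p + q).negOnePow = p.negOnePow * q.negOnePow := Int.negOnePow_add p q
              rw [hp'', hpq]
              have ha := 𝒞.assoc rfl rfl hn (by omega) f g e
              rcases Int.units_eq_one_or p.negOnePow with hp | hp <;>
              rcases Int.units_eq_one_or q.negOnePow with hq | hq <;>
              simp only [hp, hq, Units.neg_smul, one_smul, map_neg, LinearMap.neg_apply, neg_neg,
                mul_one, mul_neg] <;>
              rw [ha] <;> abel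
            · rw [𝒞.op_shape _ n (by simp only [rdeg]; omega),
                𝒞.op_shape _ n (by simp only [rdeg]; omega)]
              simp
          | cons a w => simp only [Word.length] at hw; omega

/-- A DG-category, viewed as an `A_∞`-category. -/
def toAInf : AInfCat.{u, v} k where
  Ob := 𝒞.Ob
  Hom := 𝒞.Hom
  m := 𝒞.op
  m_nil _ _ := rfl
  m_shape := 𝒞.op_shape
  m_add := 𝒞.op_add
  m_smul := 𝒞.op_smul
  rel := 𝒞.op_rel

end DGCat

/-! ### The DG-category of a family of complexes -/

open CochainComplex HomComplex in
/-- The DG-category `(i, j) ↦ Hom_R(Q^i, Q^j)` of a family of cochain complexes of modules over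
a `k`-algebra `R`, with its usual composition and identities. -/
def homDGCat {k : Type w} [Field k] {R : Type u} [Ring R] [Algebra k R]
    {ι : Type u'} (Q : ι → CochainComplex (ModuleCat.{v} R) ℤ) : DGCat.{u', v} k where
  Ob := ι
  Hom i j n := Cochain (Q i) (Q j) n
  d i j p q := δ_hom k (Q i) (Q j) p q
  d_shape i j p q h := by
    ext1 f
    exact δ_shape p q h f
  d_d i j p q r f := δ_δ p q r f
  one i := Cochain.ofHom (𝟙 (Q i))
  comp h := LinearMap.mk₂ k (fun f g => Cochain.comp f g h)
    (fun f f' g => Cochain.add_comp f f' g h) (fun c f g => Cochain.smul_comp c f g h)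
    (fun f g g' => Cochain.comp_add f g g' h) (fun c f g => Cochain.comp_smul f c g h)
  one_comp f := Cochain.id_comp f
  comp_one f := Cochain.comp_id f
  assoc hpq hqr h h' f g e := Cochain.comp_assoc f g e hpq hqr (by omega)
  leibniz h hp hq hn h₁ h₂ f g := δ_comp f g h _ _ _ hn hp hq

/-! ### Idempotents, quotients and extension of scalars -/

section ExtensionOfScalars

open MulOpposite

variable {A : Type u} [Ring A]

/-- The right submodule `M·I` of a right module `M`. -/
def mulIdeal (I : TwoSidedIdeal A) (M : Type v) [AddCommGroup M] [Module Aᵐᵒᵖ M] :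
    Submodule Aᵐᵒᵖ M :=
  Submodule.span Aᵐᵒᵖ {m | ∃ a ∈ I, ∃ x : M, m = op a • x}

/-- The extension of scalars `M ⊗_A A/I` of a right module `M`, in its form `M/M·I`. -/
def Ext (I : TwoSidedIdeal A) (M : Type v) [AddCommGroup M] [Module Aᵐᵒᵖ M] : Type v :=
  M ⧸ mulIdeal I M

namespace Ext

variable (I : TwoSidedIdeal A) (M : Type v) [AddCommGroup M] [Module Aᵐᵒᵖ M]

instance : AddCommGroup (Ext I M) := inferInstanceAs (AddCommGroup (M ⧸ mulIdeal I M))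

instance : Module Aᵐᵒᵖ (Ext I M) := inferInstanceAs (Module Aᵐᵒᵖ (M ⧸ mulIdeal I M))

/-- The projection `M → M/M·I`. -/
def mk : M →ₗ[Aᵐᵒᵖ] Ext I M := (mulIdeal I M).mkQ

variable {I M} in
theorem op_smul_eq_zero {a : A} (ha : a ∈ I) (x : Ext I M) : op a • x = 0 := by
  obtain ⟨x, rfl⟩ := (mulIdeal I M).mkQ_surjective x
  exact (Submodule.Quotient.mk_eq_zero _).2 (Submodule.subset_span ⟨a, ha, x, rfl⟩)

/-- The right action of `A/I` on `M/M·I`, given by `x · [a] = x · a`. -/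
instance : SMul I.ringCon.Quotientᵐᵒᵖ (Ext I M) where
  smul q x := Quotient.liftOn (s := I.ringCon.toSetoid) (unop q) (fun a => op a • x) (by
    intro a b hab
    have h : a - b ∈ I := (I.rel_iff a b).1 hab
    have := op_smul_eq_zero h x
    rwa [MulOpposite.op_sub, sub_smul, sub_eq_zero] at this)

instance : Module I.ringCon.Quotientᵐᵒᵖ (Ext I M) :=
  Function.Surjective.moduleLeft (RingHom.op I.ringCon.mk') (by
    intro q
    obtain ⟨a, ha⟩ := I.ringCon.mk'_surjective (unop q)
    exact ⟨op a, unop_injective ha⟩) (fun _ _ => rfl)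

end Ext

/-- Extension of scalars `i^* : mod A → mod A/I` for right modules. -/
def extendScalars (I : TwoSidedIdeal A) :
    ModuleCat.{v} Aᵐᵒᵖ ⥤ ModuleCat.{v} I.ringCon.Quotientᵐᵒᵖ where
  obj M := ModuleCat.of _ (Ext I M)
  map f := ModuleCat.ofHom
    { toFun := (mulIdeal I _).mapQ (mulIdeal I _) f.hom (by
        rw [mulIdeal, Submodule.span_le]
        rintro _ ⟨a, ha, x, rfl⟩
        exact Submodule.subset_span ⟨a, ha, f.hom x, map_smul _ _ _⟩)
      map_add' := map_add _
      map_smul' := by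
        intro q x
        obtain ⟨a, ha⟩ := I.ringCon.mk'_surjective (unop q)
        obtain rfl : op (I.ringCon.mk' a) = q := unop_injective ha
        exact map_smul (Submodule.mapQ _ _ _ _) (op a) x }
  map_id M := by
    ext x
    obtain ⟨x, rfl⟩ := (mulIdeal I M).mkQ_surjective x
    rfl
  map_comp f g := by
    ext x
    obtain ⟨x, rfl⟩ := (mulIdeal I _).mkQ_surjective x
    rfl

instance (I : TwoSidedIdeal A) : (extendScalars.{u, v} I).Additive where
  map_add {M N f g} := by
    ext x
    obtain ⟨x, rfl⟩ := (mulIdeal I M).mkQ_surjective x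
    rfl

/-- The map `M/M·I → N` induced by an `A`-linear map from `M` to an `A/I`-module `N`. -/
noncomputable def Ext.lift {I : TwoSidedIdeal A} {M : ModuleCat.{v} Aᵐᵒᵖ}
    {N : ModuleCat.{v} I.ringCon.Quotientᵐᵒᵖ}
    (g : M ⟶ (ModuleCat.restrictScalars.{v} (RingHom.op I.ringCon.mk')).obj N) :
    Ext I M →ₗ[Aᵐᵒᵖ] (ModuleCat.restrictScalars.{v} (RingHom.op I.ringCon.mk')).obj N :=
  (mulIdeal I M).liftQ g.hom (by
    rw [mulIdeal, Submodule.span_le]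
    rintro _ ⟨a, ha, x, rfl⟩
    have h0 : I.ringCon.mk' a = 0 := (I.ringCon.eq).2 ha
    have h1 : g.hom (op a • x) = op (I.ringCon.mk' a) • (show N from g.hom x) :=
      map_smul g.hom (op a) x
    rw [SetLike.mem_coe, LinearMap.mem_ker, h1, h0, op_zero, zero_smul]
    rfl)

/-- The functor `i^*` is left adjoint to restriction of scalars `i_*` along `A → A/I`. -/
noncomputable def extendRestrictAdj (I : TwoSidedIdeal A) :
    extendScalars.{u, v} I ⊣ ModuleCat.restrictScalars.{v} (RingHom.op I.ringCon.mk') :=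
  Adjunction.mkOfHomEquiv
    { homEquiv := fun M N =>
        { toFun := fun f => ModuleCat.ofHom
            (Y := (ModuleCat.restrictScalars.{v} (RingHom.op I.ringCon.mk')).obj N)
            { toFun := fun x => f.hom (Ext.mk I M x)
              map_add' := fun x y => f.hom.map_add (Ext.mk I M x) (Ext.mk I M y)
              map_smul' := fun a x =>
                f.hom.map_smul ((RingHom.op I.ringCon.mk') a) (Ext.mk I M x) }
          invFun := fun g => ModuleCat.ofHom (X := Ext I M)
            { toFun := Ext.lift g
              map_add' := (Ext.lift g).map_add
              map_smul' := by
                intro q x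
                obtain ⟨a, ha⟩ := I.ringCon.mk'_surjective (unop q)
                obtain rfl : op (I.ringCon.mk' a) = q := unop_injective ha
                exact (Ext.lift g).map_smul (op a) x }
          left_inv := fun f => by
            ext x
            obtain ⟨x, rfl⟩ := (mulIdeal I M).mkQ_surjective x
            rfl
          right_inv := fun g => by
            ext x
            rfl }
      homEquiv_naturality_left_symm := fun {M M' N} f g => by
        ext x
        obtain ⟨x, rfl⟩ := (mulIdeal I M).mkQ_surjective x
        rfl
      homEquiv_naturality_right := fun f g => by
        ext x
        rfl }

/-- The ideal `AeA`. -/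
def idemIdeal (e : A) : TwoSidedIdeal A := TwoSidedIdeal.span {e}

/-- The algebra `A_con = A/AeA`. -/
abbrev Con (e : A) : Type u := (idemIdeal e).ringCon.Quotient

end ExtensionOfScalars

/-! ### The setup -/

/-- The ring `R` has, up to isomorphism, precisely `t` simple right modules. -/
def HasExactlySimples (R : Type u) [Ring R] (t : ℕ) : Prop :=
  ∃ T : Fin t → ModuleCat.{u} Rᵐᵒᵖ,
    (∀ j, IsSimpleModule Rᵐᵒᵖ (T j)) ∧ (∀ i j, Nonempty (T i ≅ T j) → i = j) ∧
      ∀ M : ModuleCat.{u} Rᵐᵒᵖ, IsSimpleModule Rᵐᵒᵖ M → ∃ j, Nonempty (M ≅ T j)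

/-- Finite dimensional simple right modules `S_1, …, S_t` of a `ℂ`-algebra `A` with idempotent `e`,
pairwise non-isomorphic and annihilated by `e` (so that they are the `A_con`-modules `i^* S_j`),
with `A`-projective resolutions `Q^j`, each of them a complex
`0 → Q_{n-1} → ⋯ → Q_0 → 0` of finitely generated projectives with `Q_0` in degree `0`, such that
`i^* Q^j` has cohomology `i^* S_j` in degrees `0` and `-(n-1)`, and no other cohomology. -/
structure PeriodicSetup {A : Type u} [Ring A] [Algebra ℂ A] (e : A) (n : ℕ) {t : ℕ}
    (S : Fin t → ModuleCat.{u} Aᵐᵒᵖ) (Q : Fin t → CochainComplex (ModuleCat.{u} Aᵐᵒᵖ) ℤ) :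
    Prop where
  idem : IsIdempotentElem e
  simple : ∀ j, IsSimpleModule Aᵐᵒᵖ (S j)
  finiteDimensional : ∀ j,
    Module.Finite ℂ ((ModuleCat.restrictScalars (algebraMap ℂ Aᵐᵒᵖ)).obj (S j))
  distinct : ∀ i j, Nonempty (S i ≅ S j) → i = j
  annihilated : ∀ j (s : S j), MulOpposite.op e • s = 0
  finite : ∀ j i, Module.Finite Aᵐᵒᵖ ((Q j).X i)
  projective : ∀ j i, Module.Projective Aᵐᵒᵖ ((Q j).X i)
  bounded : ∀ j (i : ℤ), ¬ (1 - (n : ℤ) ≤ i ∧ i ≤ 0) → Limits.IsZero ((Q j).X i)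
  resolution : ∀ j, ∃ ε : Q j ⟶ (HomologicalComplex.single _ (ComplexShape.up ℤ) 0).obj (S j),
    QuasiIso ε
  cohomology : ∀ j (i : ℤ), i = 0 ∨ i = 1 - (n : ℤ) →
    Nonempty ((((extendScalars (idemIdeal e)).mapHomologicalComplex _).obj (Q j)).homology i ≅
      (extendScalars (idemIdeal e)).obj (S j))
  acyclic : ∀ j (i : ℤ), ¬ (i = 0 ∨ i = 1 - (n : ℤ)) →
    Limits.IsZero ((((extendScalars (idemIdeal e)).mapHomologicalComplex _).obj (Q j)).homology i)

end DGRec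

/-! Write `Λ` for the common quotient algebra and `F` for extension of scalars to `Λ`. Each `S_j` is
killed by the ideal, so `Hom_A(P, S_j) = Hom_Λ(FP, FS_j)` for every `P`. Since `Q^j` resolves `S_j`,
the cohomology of `Hom_A(Q^i, Q^j)` is that of `Hom_A(Q^i, S_j)`. It vanishes in negative degrees,
and in degree `0` it is spanned by the identities, by Schur's lemma over `ℂ`. Over `Λ` the complex
`FQ^j` has extra cohomology in degree `1 - n`. But `FQ^i` starts in degree `1 - n`, so a cochain of
degree `m ≥ 1` only reaches degrees of `FQ^j` above `1 - n`, where `FQ^j` still behaves like a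
resolution of `FS_j`. Hence `F` induces isomorphisms on `H^m` of morphism complexes for `m ≥ 1`
(`mapDGFunctor_isQis`).

Matching the simple `Λ`-modules gives a bijection `r` for which `FQ_A^j` and `FQ_B^{r(j)}` are
homotopy equivalent. A comparison map `α` over the simple module always exists. On the lowest
cohomology it is a map between isomorphic simple modules, so it is invertible or zero. If it is zero
and `β` is a comparison map backwards, then `βα - 1` is homotopic to a map concentrated in the
lowest degree which is `-1` on the lowest cohomology. Composing that map with an isomorphism of the
lowest cohomologies and adding the result to `α` gives a quasi-isomorphism
(`IsPeriodic.exists_hom_of_comp_eq_zero`), hence a homotopy equivalence of bounded above complexes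
of projectives.

The two DG-categories therefore agree with a third one only in degrees `≥ 1`. Glue them: a morphism
is a pair together with a homotopy between its images. Both projections are isomorphisms on
cohomology in degrees `≥ 2`; in degree `1` they are surjective with the same kernel. Keep only
multiples of identities in degree `0`, a complement of that kernel in degree `1`, and everything
above. The result is a DG-category quasi-isomorphic to both sides (`trunc_isQis`).

It remains to invert one leg of this roof. A second gluing replaces the leg by a surjective
quasi-isomorphism. Over a field it has a section that is a chain map and a contraction of its
kernel, and the section extends recursively to an `A_∞`-functor: at each word length the obstruction
lies in the kernel and is closed up to lower terms (`TotalAlg.lift_rel`). These steps are assembled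
in `exists_aInfFunctor_of_roof`. -/

namespace DGRec

/-! ### The bar differential on functions of words -/

/-- A differential, a product and a sign on the letters of a family `G`. -/
structure LetterOps {O : Type u} (G : O → O → Type v) where
  D : ∀ {x y : O}, G x y → G x y
  M : ∀ {x y z : O}, G x y → G y z → G x z
  ε : ∀ {x y : O}, G x y → ℤˣ
  ε_D : ∀ {x y : O} (a : G x y), ε (D a) = -ε a
  ε_M : ∀ {x y z : O} (a : G x y) (b : G y z), ε (M a b) = -(ε a * ε b)

namespace LetterOps

open Word

variable {O : Type u} {G : O → O → Type v} (Ω : LetterOps G)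
variable {N : Type w} [AddCommGroup N]

/-- The contribution of the differential to the bar differential. -/
def barD : ∀ {x y : O}, (Word G x y → N) → Word G x y → N
  | _, _, _, .nil _ => 0
  | _, _, φ, .cons a w => φ (.cons (Ω.D a) w) + Ω.ε a • barD (fun v => φ (.cons a v)) w

/-- The value of `φ` after multiplying `a` with the first letter. -/
def merge {x z y : O} (a : G x z) (φ : Word G x y → N) : Word G z y → N
  | .nil _ => 0
  | .cons c w => φ (.cons (Ω.M a c) w)

/-- The contribution of the product to the bar differential. -/
def barM : ∀ {x y : O}, (Word G x y → N) → Word G x y → N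
  | _, _, _, .nil _ => 0
  | _, _, φ, .cons a w => Ω.merge a φ w + Ω.ε a • barM (fun v => φ (.cons a v)) w

/-- The identities satisfied by the values of a multilinear function on words. -/
structure Compatible {x y : O} (φ : Word G x y → N) : Prop where
  DD : ∀ {s t : O} (l : Word G x s) (a : G s t) (r : Word G t y),
    φ (l.append (.cons (Ω.D (Ω.D a)) r)) = 0
  DM : ∀ {s t q : O} (l : Word G x s) (a : G s t) (b : G t q) (r : Word G q y),
    φ (l.append (.cons (Ω.D (Ω.M a b)) r)) + φ (l.append (.cons (Ω.M (Ω.D a) b) r)) +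
      Ω.ε a • φ (l.append (.cons (Ω.M a (Ω.D b)) r)) = 0
  MM : ∀ {s t q p : O} (l : Word G x s) (a : G s t) (b : G t q) (c : G q p) (r : Word G p y),
    φ (l.append (.cons (Ω.M (Ω.M a b) c) r)) +
      Ω.ε a • φ (l.append (.cons (Ω.M a (Ω.M b c)) r)) = 0

variable {Ω}

theorem Compatible.tail {x z y : O} {φ : Word G x y → N} (h : Ω.Compatible φ) (a : G x z) :
    Ω.Compatible (fun v : Word G z y => φ (.cons a v)) where
  DD l := h.DD (.cons a l)
  DM l := h.DM (.cons a l)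
  MM l := h.MM (.cons a l)

variable (Ω)

theorem barD_add {x y : O} (φ ψ : Word G x y → N) (w : Word G x y) :
    Ω.barD (fun v => φ v + ψ v) w = Ω.barD φ w + Ω.barD ψ w := by
  induction w with
  | nil => simp [barD]
  | cons a w ih => simp only [barD, ih, smul_add]; abel

@[simp]
theorem merge_nil {x y : O} (a : G x y) (φ : Word G x y → N) : Ω.merge a φ (.nil y) = 0 := rfl

theorem merge_add {x z y : O} (a : G x z) (φ ψ : Word G x y → N) (w : Word G z y) :
    Ω.merge a (fun v => φ v + ψ v) w = Ω.merge a φ w + Ω.merge a ψ w := by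
  cases w <;> simp [merge]

theorem barM_add {x y : O} (φ ψ : Word G x y → N) (w : Word G x y) :
    Ω.barM (fun v => φ v + ψ v) w = Ω.barM φ w + Ω.barM ψ w := by
  induction w with
  | nil => simp [barM]
  | cons a w ih => simp only [barM, ih, smul_add, merge_add]; abel

theorem map_units {N' : Type*} [AddCommGroup N'] (f : N →+ N') (e : ℤˣ) (x : N) :
    f (e • x) = e • f x := by
  rw [Units.smul_def, Units.smul_def, map_zsmul]

theorem barD_map {N' : Type*} [AddCommGroup N'] (f : N →+ N') {x y : O} (φ : Word G x y → N)
    (w : Word G x y) : Ω.barD (fun v => f (φ v)) w = f (Ω.barD φ w) := by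
  induction w with
  | nil => simp [barD]
  | cons a w ih => simp only [barD, ih, map_add, map_units]

theorem merge_map {N' : Type*} [AddCommGroup N'] (f : N →+ N') {x z y : O} (a : G x z)
    (φ : Word G x y → N) (w : Word G z y) :
    Ω.merge a (fun v => f (φ v)) w = f (Ω.merge a φ w) := by
  cases w <;> simp [merge]

theorem barM_map {N' : Type*} [AddCommGroup N'] (f : N →+ N') {x y : O} (φ : Word G x y → N)
    (w : Word G x y) : Ω.barM (fun v => f (φ v)) w = f (Ω.barM φ w) := by
  induction w with
  | nil => simp [barM]
  | cons a w ih => simp only [barM, ih, map_add, map_units, merge_map]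

/-- Multiplication by a sign. -/
def signHom (e : ℤˣ) : N →+ N := DistribSMul.toAddMonoidHom N e

theorem barD_sign {x y : O} (e : ℤˣ) (φ : Word G x y → N) (w : Word G x y) :
    Ω.barD (fun v => e • φ v) w = e • Ω.barD φ w :=
  Ω.barD_map (signHom e) φ w

theorem barM_sign {x y : O} (e : ℤˣ) (φ : Word G x y → N) (w : Word G x y) :
    Ω.barM (fun v => e • φ v) w = e • Ω.barM φ w :=
  Ω.barM_map (signHom e) φ w

theorem sign_sign (e : ℤˣ) (x : N) : e • e • x = x := by
  rw [smul_smul, Int.units_mul_self, one_smul]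

theorem merge_barD {x z y : O} (φ : Word G x y → N) (h : Ω.Compatible φ) (a : G x z)
    (w : Word G z y) :
    Ω.merge (Ω.D a) φ w + Ω.ε a • Ω.barD (Ω.merge a φ) w + Ω.merge a (Ω.barD φ) w = 0 := by
  cases w with
  | nil => simp [merge, barD]
  | cons c w =>
    have h0 := h.DM (.nil _) a c w
    simp only [Word.append] at h0
    simp only [merge, barD, Ω.ε_M, smul_add, smul_smul, Units.neg_smul]
    rw [← h0]
    abel

/-- When the differential hits the first letter and the product acts further right, the two orders
cancel because `D` flips the sign of a letter. Products involving the first letter are covered by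
`merge_barD`. -/
theorem barD_barM {x y : O} (φ : Word G x y → N) (h : Ω.Compatible φ) (w : Word G x y) :
    Ω.barD (Ω.barM φ) w + Ω.barM (Ω.barD φ) w = 0 := by
  induction w with
  | nil => simp [barD, barM]
  | cons a w ih =>
    have e : (fun v => Ω.barD φ (.cons a v)) =
      fun v => φ (.cons (Ω.D a) v) + Ω.ε a • Ω.barD (fun v => φ (.cons a v)) v := rfl
    have e' : (fun v => Ω.barM φ (.cons a v)) =
      fun v => Ω.merge a φ v + Ω.ε a • Ω.barM (fun v => φ (.cons a v)) v := rfl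
    have h1 := Ω.merge_barD φ h a w
    have h2 := ih _ (h.tail a)
    rw [barD, e', barD_add, barD_sign, show Ω.barM (Ω.barD φ) (.cons a w) =
      Ω.merge a (Ω.barD φ) w + Ω.ε a • Ω.barM (fun v => Ω.barD φ (.cons a v)) w from rfl, e,
      barM_add, barM_sign]
    simp only [barM, Ω.ε_D, smul_add, sign_sign, Units.neg_smul]
    linear_combination (norm := abel) h1 + h2

theorem merge_barM {x z y : O} (φ : Word G x y → N) (h : Ω.Compatible φ) (a : G x z)
    (w : Word G z y) :
    Ω.merge a (Ω.barM φ) w + Ω.ε a • Ω.barM (Ω.merge a φ) w = 0 := by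
  cases w with
  | nil => simp [merge, barM]
  | cons c w =>
    have h0 : Ω.merge (Ω.M a c) φ w + Ω.ε a • Ω.merge c (Ω.merge a φ) w = 0 := by
      cases w with
      | nil => simp [merge]
      | cons e w => exact h.MM (.nil _) a c e w
    have e : (fun v => Ω.merge a φ (.cons c v)) = fun v => φ (.cons (Ω.M a c) v) := rfl
    rw [merge, barM, barM, e]
    simp only [Ω.ε_M, smul_add, smul_smul, Units.neg_smul]
    rw [← h0]
    abel

/-- Products at disjoint places cancel by sign and overlapping ones by associativity; `merge_barM`
accounts for both at the first letter. -/
theorem barM_barM {x y : O} (φ : Word G x y → N) (h : Ω.Compatible φ) (w : Word G x y) :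
    Ω.barM (Ω.barM φ) w = 0 := by
  induction w with
  | nil => rfl
  | cons a w ih =>
    have e' : (fun v => Ω.barM φ (.cons a v)) =
      fun v => Ω.merge a φ v + Ω.ε a • Ω.barM (fun v => φ (.cons a v)) v := rfl
    rw [barM, e', barM_add, barM_sign, ih _ (h.tail a), smul_zero, add_zero,
      Ω.merge_barM φ h]

theorem barD_congr {x y : O} (φ ψ : Word G x y → N) (w : Word G x y)
    (h : ∀ v, v.length = w.length → φ v = ψ v) : Ω.barD φ w = Ω.barD ψ w := by
  induction w with
  | nil => rfl
  | cons a w ih =>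
    rw [barD, barD, h (.cons (Ω.D a) w) rfl, ih _ _ (fun v hv => h _ (by simp [Word.length, hv]))]

/-- The product shortens a word, so only values on strictly shorter words enter. This is what
permits recursion on length. -/
theorem barM_congr {x y : O} (φ ψ : Word G x y → N) (w : Word G x y)
    (h : ∀ v, v.length < w.length → φ v = ψ v) : Ω.barM φ w = Ω.barM ψ w := by
  induction w with
  | nil => rfl
  | cons a w ih =>
    rw [barM, barM, ih _ _ (fun v hv => h _ (by simpa [Word.length] using hv))]
    congr 1
    cases w with
    | nil => rfl
    | cons c w => exact h _ (by simp [Word.length])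

/-- The product of the signs of the letters. -/
def sign : ∀ {x y : O}, Word G x y → ℤˣ
  | _, _, .nil _ => 1
  | _, _, .cons a w => Ω.ε a * sign w

end LetterOps

/-! ### Products of functions on words -/

/-- A family of abelian groups with a differential, a product and a parity involution,
satisfying the relations of a DG-category in the sign convention of `A_∞`-categories. -/
structure TotalAlg {O : Type u} (T : O → O → Type w) [∀ x y, AddCommGroup (T x y)] where
  m₁ : ∀ {x y : O}, T x y →+ T x y
  m₂ : ∀ {x y z : O}, T x y →+ T y z →+ T x z
  τ : ∀ {x y : O}, T x y →+ T x y
  leibniz : ∀ {x y z : O} (a : T x y) (b : T y z),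
    m₁ (m₂ a b) + m₂ (m₁ a) b + m₂ (τ a) (m₁ b) = 0
  assoc : ∀ {x y z t : O} (a : T x y) (b : T y z) (c : T z t),
    m₂ (m₂ a b) c + m₂ (τ a) (m₂ b c) = 0

namespace TotalAlg

open Word LetterOps

variable {O : Type u} {G : O → O → Type v} (Ω : LetterOps G)
variable {T : O → O → Type w} [∀ x y, AddCommGroup (T x y)] (𝒯 : TotalAlg T)

/-- The product of `φ` and `ψ` summed over the factorizations of a word. -/
def star (ψ : ∀ x y : O, Word G x y → T x y) {x₀ : O} : ∀ {x y : O},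
    (∀ z, Word G x z → T x₀ z) → Word G x y → T x₀ y
  | _, _, _, .nil _ => 0
  | _, _, φ, .cons a w =>
      𝒯.m₂ (φ _ (.single a)) (ψ _ _ w) + star ψ (fun z v => φ z (.cons a v)) w

theorem star_eq_sum (ψ : ∀ x y : O, Word G x y → T x y) {x₀ x y : O}
    (φ : ∀ z, Word G x z → T x₀ z) (w : Word G x y) :
    𝒯.star ψ φ w = (w.prefixes.map (fun c => 𝒯.m₂ (φ _ c.2.1) (ψ _ _ c.2.2))).sum := by
  induction w with
  | nil => rfl
  | cons a w ih =>
    simp only [star, prefixes, List.map_cons, List.sum_cons, ih, List.map_map]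
    rfl

variable (ψ : ∀ x y : O, Word G x y → T x y) {x₀ : O}

theorem star_add_left {x y : O} (φ φ' : ∀ z, Word G x z → T x₀ z) (w : Word G x y) :
    𝒯.star ψ (fun z v => φ z v + φ' z v) w = 𝒯.star ψ φ w + 𝒯.star ψ φ' w := by
  induction w with
  | nil => simp [star]
  | cons a w ih => simp only [star, ih, map_add, AddMonoidHom.add_apply]; abel

theorem star_sign_left {x y : O} (e : ℤˣ) (φ : ∀ z, Word G x z → T x₀ z) (w : Word G x y) :
    𝒯.star ψ (fun z v => e • φ z v) w = e • 𝒯.star ψ φ w := by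
  induction w with
  | nil => simp [star]
  | cons a w ih =>
    simp only [star, ih, smul_add, map_units]
    rfl

theorem star_add_right (ψ' : ∀ x y : O, Word G x y → T x y) {x y : O}
    (φ : ∀ z, Word G x z → T x₀ z) (w : Word G x y) :
    𝒯.star (fun x y v => ψ x y v + ψ' x y v) φ w = 𝒯.star ψ φ w + 𝒯.star ψ' φ w := by
  induction w with
  | nil => simp [star]
  | cons a w ih => simp only [star, ih, map_add]; abel

theorem star_neg_right {x y : O} (φ : ∀ z, Word G x z → T x₀ z) (w : Word G x y) :
    𝒯.star (fun x y v => - ψ x y v) φ w = - 𝒯.star ψ φ w := by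
  induction w with
  | nil => simp [star]
  | cons a w ih => simp only [star, ih, map_neg]; abel

theorem star_neg_left {x y : O} (φ : ∀ z, Word G x z → T x₀ z) (w : Word G x y) :
    𝒯.star ψ (fun z v => - φ z v) w = - 𝒯.star ψ φ w := by
  induction w with
  | nil => simp [star]
  | cons a w ih => simp only [star, ih, map_neg, AddMonoidHom.neg_apply]; abel

/-- The factorization with the whole word on the left has an empty right factor, where `ψ` vanishes.
-/
theorem star_congr_left (hψ : ∀ x, ψ x x (.nil x) = 0) {x y : O} (φ φ' : ∀ z, Word G x z → T x₀ z)
    (w : Word G x y) (h : ∀ z (v : Word G x z), v.length < w.length → φ z v = φ' z v) :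
    𝒯.star ψ φ w = 𝒯.star ψ φ' w := by
  induction w with
  | nil => rfl
  | cons a w ih =>
    rw [star, star, ih _ _ (fun z v hv => h _ _ (by simpa [Word.length] using hv))]
    congr 1
    cases w with
    | nil => simp [hψ]
    | cons c w => rw [h _ (.single a) (by simp [Word.length, Word.single])]

theorem star_congr_right (ψ' : ∀ x y : O, Word G x y → T x y) {x y : O}
    (φ : ∀ z, Word G x z → T x₀ z)
    (w : Word G x y) (h : ∀ (x y : O) (v : Word G x y), v.length < w.length → ψ x y v = ψ' x y v) :
    𝒯.star ψ φ w = 𝒯.star ψ' φ w := by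
  induction w with
  | nil => rfl
  | cons a w ih =>
    rw [star, star, ih _ (fun _ _ v hv => h _ _ _ (by simp [Word.length]; omega)),
      h _ _ w (by simp [Word.length])]

/-- A signed derivation rule: moving past the left factor costs the product of the signs of its
letters. -/
theorem barD_star {x y : O} (φ : ∀ z, Word G x z → T x₀ z) (w : Word G x y) :
    Ω.barD (𝒯.star ψ φ) w = 𝒯.star ψ (fun _ => Ω.barD (φ _)) w +
      𝒯.star (fun _ _ => Ω.barD (ψ _ _)) (fun z v => Ω.sign v • φ z v) w := by
  induction w with
  | nil => simp [barD, star]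
  | @cons x z y a w ih =>
    have e : (fun v : Word G z y => 𝒯.star ψ φ (.cons a v)) = fun v =>
      𝒯.m₂ (φ _ (.single a)) (ψ _ _ v) + 𝒯.star ψ (fun z v => φ z (.cons a v)) v := rfl
    rw [barD, e, barD_add, ih, barD_map]
    simp only [star, LetterOps.sign, barD, Word.single, star_add_left, star_sign_left, mul_smul,
      smul_zero, add_zero, smul_add, one_smul]
    rw [show 𝒯.m₂ (Ω.ε a • φ _ (.cons a (.nil _))) (Ω.barD (ψ _ _) w) =
      Ω.ε a • 𝒯.m₂ (φ _ (.cons a (.nil _))) (Ω.barD (ψ _ _) w) from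
        map_units (𝒯.m₂.flip (Ω.barD (ψ _ _) w)) _ _]
    abel

theorem barM_star {x y : O} (φ : ∀ z, Word G x z → T x₀ z) (w : Word G x y) :
    Ω.barM (𝒯.star ψ φ) w = 𝒯.star ψ (fun _ => Ω.barM (φ _)) w +
      𝒯.star (fun _ _ => Ω.barM (ψ _ _)) (fun z v => Ω.sign v • φ z v) w := by
  induction w with
  | nil => simp [barM, star]
  | @cons x z y a w ih =>
    have e : (fun v : Word G z y => 𝒯.star ψ φ (.cons a v)) = fun v =>
      𝒯.m₂ (φ _ (.single a)) (ψ _ _ v) + 𝒯.star ψ (fun z v => φ z (.cons a v)) v := rfl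
    have e' : Ω.merge a (𝒯.star ψ φ) w = 𝒯.star ψ (fun _ => Ω.merge a (φ _)) w := by
      cases w with
      | nil => rfl
      | cons c w => rfl
    rw [barM, e, barM_add, ih, barM_map, e']
    simp only [star, LetterOps.sign, barM, merge_nil, Word.single, star_add_left, star_sign_left,
      mul_smul, smul_zero, add_zero, zero_add, smul_add, one_smul, map_zero,
      AddMonoidHom.zero_apply]
    rw [show 𝒯.m₂ (Ω.ε a • φ _ (.cons a (.nil _))) (Ω.barM (ψ _ _) w) =
      Ω.ε a • 𝒯.m₂ (φ _ (.cons a (.nil _))) (Ω.barM (ψ _ _) w) from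
        map_units (𝒯.m₂.flip (Ω.barM (ψ _ _) w)) _ _]
    abel

theorem m₁_star {x y : O} (φ : ∀ z, Word G x z → T x₀ z) (w : Word G x y) :
    𝒯.m₁ (𝒯.star ψ φ w) + 𝒯.star ψ (fun z v => 𝒯.m₁ (φ z v)) w +
      𝒯.star (fun x y v => 𝒯.m₁ (ψ x y v)) (fun z v => 𝒯.τ (φ z v)) w = 0 := by
  induction w with
  | nil => simp [star]
  | cons a w ih =>
    simp only [star, map_add]
    have h := 𝒯.leibniz (φ _ (.single a)) (ψ _ _ w)
    linear_combination (norm := abel) h + ih (fun z v => φ z (.cons a v))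

theorem star_m₂ {x y x₁ : O} (t : T x₀ x₁) (φ : ∀ z, Word G x z → T x₁ z) (w : Word G x y) :
    𝒯.star ψ (fun z v => 𝒯.m₂ t (φ z v)) w + 𝒯.m₂ (𝒯.τ t) (𝒯.star ψ φ w) = 0 := by
  induction w with
  | nil => simp [star]
  | cons a w ih =>
    simp only [star, map_add]
    have h := 𝒯.assoc t (φ _ (.single a)) (ψ _ _ w)
    linear_combination (norm := abel) h + ih (fun z v => φ z (.cons a v))

/-- Both sides run over factorizations into three words and are compared by `assoc`. Terms with an
empty middle word disappear because `ψ` vanishes there. -/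
theorem star_star (hψ : ∀ x, ψ x x (.nil x) = 0) (χ : ∀ x y : O, Word G x y → T x y)
    {x y : O} (φ : ∀ z, Word G x z → T x₀ z) (w : Word G x y) :
    𝒯.star χ (fun _ => 𝒯.star ψ φ) w +
      𝒯.star (fun _ _ => 𝒯.star χ (fun _ => ψ _ _)) (fun z v => 𝒯.τ (φ z v)) w = 0 := by
  induction w with
  | nil => simp [star]
  | cons a w ih =>
    have e : 𝒯.star ψ φ (.single a) = 0 := by simp [Word.single, star, hψ]
    have h := 𝒯.star_m₂ χ (φ _ (.single a)) (fun _ => ψ _ _) w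
    rw [star, star, e]
    simp only [star, star_add_left, map_zero, AddMonoidHom.zero_apply]
    linear_combination (norm := abel) h + ih (fun z v => φ z (.cons a v))

end TotalAlg
end DGRec

namespace DGRec

/-! ### Lifting along a contraction -/

namespace TotalAlg

open Word LetterOps

variable {O : Type u} {G : O → O → Type v} (Ω : LetterOps G)
variable {T T' : O → O → Type w} [∀ x y, AddCommGroup (T x y)] [∀ x y, AddCommGroup (T' x y)]
variable (𝒯 : TotalAlg T) (𝒯' : TotalAlg T')

theorem star_eq_zero_of_nil (ψ : ∀ x y : O, Word G x y → T x y) {x₀ x y : O}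
    (φ : ∀ z, Word G x z → T x₀ z) (h : ∀ z (v : Word G x z), 1 ≤ v.length → φ z v = 0)
    (w : Word G x y) : 𝒯.star ψ φ w = 0 := by
  induction w with
  | nil => rfl
  | cons a w ih =>
    rw [star, h _ (.single a) (by simp [Word.single, Word.length]),
      ih _ (fun z v hv => h _ _ (by simp [Word.length]))]
    simp

theorem _root_.DGRec.LetterOps.barM_eq_zero_of_nil {N : Type*} [AddCommGroup N] {x y : O}
    (φ : Word G x y → N) (h : ∀ v : Word G x y, 1 ≤ v.length → φ v = 0) (w : Word G x y) :
    Ω.barM φ w = 0 := by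
  induction w with
  | nil => rfl
  | cons a w ih =>
    rw [barM, ih _ (fun v hv => h _ (by simp [Word.length])), smul_zero, add_zero]
    cases w with
    | nil => rfl
    | cons c w => exact h _ (by simp [Word.length])

variable (s : ∀ {x y : O}, G x y → T x y) (h : ∀ {x y : O}, T x y →+ T x y)

/-- The recursive construction of a lift, up to a given length of words. -/
def liftAux : ℕ → ∀ x y : O, Word G x y → T x y
  | 0, _, _, _ => 0
  | _ + 1, _, _, .nil _ => 0
  | _ + 1, _, _, .cons a (.nil _) => s a
  | n + 1, x, y, .cons a (.cons b w) =>
      - h (𝒯.star (liftAux n) (liftAux n x) (.cons a (.cons b w)) -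
        Ω.barM (liftAux n x y) (.cons a (.cons b w)))

theorem liftAux_nil (n : ℕ) (x : O) : liftAux Ω 𝒯 s h n x x (.nil x) = 0 := by
  cases n <;> rfl

/-- The natural number is only fuel: any value reaching the length of the word gives the same
result. -/
theorem liftAux_eq (n : ℕ) : ∀ (m : ℕ) (x y : O) (w : Word G x y), w.length ≤ n → w.length ≤ m →
    liftAux Ω 𝒯 s h n x y w = liftAux Ω 𝒯 s h m x y w := by
  induction n with
  | zero =>
    intro m x y w hn hm
    cases w with
    | nil => rw [liftAux_nil, liftAux_nil]
    | cons a w => simp [Word.length] at hn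
  | succ n ih =>
    intro m x y w hn hm
    cases w with
    | nil => rw [liftAux_nil, liftAux_nil]
    | cons a w =>
      cases m with
      | zero => simp [Word.length] at hm
      | succ m =>
        cases w with
        | nil => rfl
        | cons b w =>
          have e : ∀ (x y : O) (v : Word G x y), v.length < (Word.cons a (.cons b w)).length →
              liftAux Ω 𝒯 s h n x y v = liftAux Ω 𝒯 s h m x y v :=
            fun x y v hv => ih m x y v (by omega) (by omega)
          rw [liftAux, liftAux, 𝒯.star_congr_left _ (liftAux_nil Ω 𝒯 s h n) _ _ _ (fun z => e _ z),
            𝒯.star_congr_right _ _ _ _ e, Ω.barM_congr _ _ _ (e _ _)]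

/-- The components of the lift. -/
def lift (x y : O) (w : Word G x y) : T x y := liftAux Ω 𝒯 s h w.length x y w

theorem lift_nil (x : O) : lift Ω 𝒯 s h x x (.nil x) = 0 := rfl

theorem lift_single {x y : O} (a : G x y) : lift Ω 𝒯 s h x y (.cons a (.nil y)) = s a := rfl

theorem lift_cons_cons {x y z t : O} (a : G x y) (b : G y z) (w : Word G z t) :
    lift Ω 𝒯 s h x t (.cons a (.cons b w)) =
      - h (𝒯.star (lift Ω 𝒯 s h) (lift Ω 𝒯 s h x) (.cons a (.cons b w)) -
        Ω.barM (lift Ω 𝒯 s h x t) (.cons a (.cons b w))) := by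
  have e : ∀ (x y : O) (v : Word G x y), v.length < (Word.cons a (.cons b w)).length →
      liftAux Ω 𝒯 s h (Word.cons b w).length x y v = lift Ω 𝒯 s h x y v :=
    fun x y v hv => liftAux_eq Ω 𝒯 s h _ _ x y v (by simp only [Word.length] at *; omega) le_rfl
  rw [← 𝒯.star_congr_left _ (lift_nil Ω 𝒯 s h) _ _ _ (fun z => e _ z),
    ← 𝒯.star_congr_right _ _ _ _ e, ← Ω.barM_congr _ _ _ (e _ _)]
  rfl

theorem lift_of_two_le {x y : O} (w : Word G x y) (hw : 2 ≤ w.length) :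
    lift Ω 𝒯 s h x y w =
      - h (𝒯.star (lift Ω 𝒯 s h) (lift Ω 𝒯 s h x) w - Ω.barM (lift Ω 𝒯 s h x y) w) := by
  match w with
  | .nil _ => simp [Word.length] at hw
  | .cons _ (.nil _) => simp [Word.length] at hw
  | .cons a (.cons b w) => exact lift_cons_cons Ω 𝒯 s h a b w

variable (p : ∀ {x y : O}, T x y →+ T' x y)

theorem map_star {x₀ x y : O} (hp : ∀ {x y z : O} (a : T x y) (b : T y z),
      p (𝒯.m₂ a b) = 𝒯'.m₂ (p a) (p b)) (ψ : ∀ x y : O, Word G x y → T x y)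
    (φ : ∀ z, Word G x z → T x₀ z) (w : Word G x y) :
    p (𝒯.star ψ φ w) = 𝒯'.star (fun x y v => p (ψ x y v)) (fun z v => p (φ z v)) w := by
  induction w with
  | nil => simp [star]
  | cons a w ih => simp only [star, map_add, ih, hp]

/-- Components on words of length at least two lie in the image of `h` and are killed by `p`. Only
one-letter components survive, and `hps` says that these respect products after applying `p`. -/
theorem map_obstruction
    (hp : ∀ {x y z : O} (a : T x y) (b : T y z), p (𝒯.m₂ a b) = 𝒯'.m₂ (p a) (p b))
    (hps : ∀ {x y z : O} (a : G x y) (b : G y z), 𝒯'.m₂ (p (s a)) (p (s b)) = p (s (Ω.M a b)))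
    (hph : ∀ {x y : O} (t : T x y), p (h t) = 0)
    {x y z t : O} (a : G x y) (b : G y z) (w : Word G z t) :
    p (𝒯.star (lift Ω 𝒯 s h) (lift Ω 𝒯 s h x) (.cons a (.cons b w)) -
        Ω.barM (lift Ω 𝒯 s h x t) (.cons a (.cons b w))) = 0 := by
  have h0 : ∀ {x y : O} (v : Word G x y), 2 ≤ v.length → p (lift Ω 𝒯 s h x y v) = 0 := by
    intro x y v hv
    rw [lift_of_two_le _ _ _ _ v hv, map_neg, hph, neg_zero]
  rw [map_sub, map_star 𝒯 𝒯' p hp, ← barM_map, star, barM,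
    star_eq_zero_of_nil _ _ _ (fun z v hv => h0 _ (by simp [Word.length]; omega)),
    Ω.barM_eq_zero_of_nil _ (fun v hv => h0 _ (by simp [Word.length]; omega))]
  cases w with
  | nil =>
    simp only [Word.single, lift_single, merge, hps]
    simp
  | cons c w =>
    simp only [merge]
    rw [h0 (.cons b (.cons c w)) (by simp [Word.length]),
      h0 (.cons (Ω.M a b) (.cons c w)) (by simp [Word.length])]
    simp

/-- The lift satisfies the relations of an `A_∞`-functor. -/
theorem lift_rel
    (hs : ∀ {x y : O} (a : G x y), 𝒯.m₁ (s a) = s (Ω.D a))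
    (hp : ∀ {x y z : O} (a : T x y) (b : T y z), p (𝒯.m₂ a b) = 𝒯'.m₂ (p a) (p b))
    (hps : ∀ {x y z : O} (a : G x y) (b : G y z), 𝒯'.m₂ (p (s a)) (p (s b)) = p (s (Ω.M a b)))
    (hph : ∀ {x y : O} (t : T x y), p (h t) = 0)
    (hh : ∀ {x y : O} (t : T x y), p t = 0 → 𝒯.m₁ (h t) + h (𝒯.m₁ t) = t)
    (hτ : ∀ {x y : O} (w : Word G x y),
      𝒯.τ (lift Ω 𝒯 s h x y w) = Ω.sign w • lift Ω 𝒯 s h x y w)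
    (hc : ∀ x y : O, Ω.Compatible (lift Ω 𝒯 s h x y)) {x y : O} (w : Word G x y) :
    𝒯.m₁ (lift Ω 𝒯 s h x y w) + 𝒯.star (lift Ω 𝒯 s h) (lift Ω 𝒯 s h x) w =
      Ω.barD (lift Ω 𝒯 s h x y) w + Ω.barM (lift Ω 𝒯 s h x y) w := by
  induction hn : w.length using Nat.strong_induction_on generalizing x y w with
  | _ n IH =>
  subst hn
  set F := lift Ω 𝒯 s h with hF
  match w, IH with
  | .nil _, _ => simp [hF, lift_nil, star, barD, barM]
  | .cons a (.nil _), _ =>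
    have e1 : F _ _ (.cons (Ω.D a) (.nil _)) = s (Ω.D a) := rfl
    simp only [star, barD, barM, merge_nil, e1, ← hs]
    simp [hF, lift_nil, lift_single]
  | .cons (x := x) (z := y) a (.cons b w), IH =>
    set W : Word G x y := .cons a (.cons b w) with hW
    have IH' : ∀ (x y : O) (v : Word G x y), v.length < W.length →
        𝒯.m₁ (F x y v) = - 𝒯.star F (F x) v + (Ω.barD (F x y) v + Ω.barM (F x y) v) := by
      intro x y v hv
      rw [← IH _ hv v rfl]
      abel
    -- The relation to prove is `m₁ F + B = barD F`, and for words of this length the recursion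
    -- reads `F = -h B`.
    let B : Word G x y → T x y := fun v => 𝒯.star F (F x) v + (- Ω.barM (F x y) v)
    have hFB : ∀ v : Word G x y, v.length = W.length → F x y v = (-h) (B v) := by
      intro v hv
      rw [hF, lift_of_two_le _ _ _ _ v (by rw [hv]; simp [hW, Word.length]), ← hF, sub_eq_add_neg]
      rfl
    have hpB : p (B W) = 0 := by
      have := map_obstruction Ω 𝒯 𝒯' s h p hp hps hph a b w
      rwa [sub_eq_add_neg] at this
    have hτ' : (fun z (v : Word G x z) => 𝒯.τ (F x z v)) = fun z v => Ω.sign v • F x z v := by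
      funext z v
      exact hτ v
    have hn : ∀ x, F x x (.nil x) = 0 := lift_nil Ω 𝒯 s h
    have h1 := 𝒯.m₁_star F (F x) W
    rw [hτ', 𝒯.star_congr_left F hn _ _ W (fun z v hv => IH' x z v hv),
      𝒯.star_congr_right _ _ _ W IH', star_add_left, star_add_left, star_add_right, star_add_right,
      star_neg_left, star_neg_right] at h1
    have h2 := 𝒯.star_star F hn F (F x) W
    rw [hτ'] at h2
    have h3 := 𝒯.barD_star Ω F (F x) W
    have h4 := 𝒯.barM_star Ω F (F x) W
    have h5 : 𝒯.m₁ (Ω.barM (F x y) W) = - Ω.barM (𝒯.star F (F x)) W +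
        (Ω.barM (Ω.barD (F x y)) W + Ω.barM (Ω.barM (F x y)) W) := by
      rw [← barM_map, Ω.barM_congr _ _ W (fun v hv => IH' x y v hv), barM_add, barM_add]
      congr 1
      exact Ω.barM_map (-AddMonoidHom.id _) (𝒯.star F (F x)) W
    rw [Ω.barM_barM _ (hc x y)] at h5
    have h6 := Ω.barD_barM (F x y) (hc x y) W
    have h7 : Ω.barD B W = Ω.barD (𝒯.star F (F x)) W - Ω.barD (Ω.barM (F x y)) W := by
      rw [barD_add, sub_eq_add_neg]
      congr 1
      exact Ω.barD_map (-AddMonoidHom.id _) (Ω.barM (F x y)) W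
    -- Closedness of the obstruction up to the bar differential. It combines the relation on shorter
    -- words with the derivation rules, associativity of the product and the anticommutation of
    -- `barD` and `barM`.
    have h8 : 𝒯.m₁ (B W) = - Ω.barD B W := by
      rw [map_add, map_neg, h5, h7]
      linear_combination (norm := abel) h1 + h2 + h3 + h4 - h6
    -- With `h8` the contraction gives `m₁ (h B) - h (barD B) = B`, which is the relation, because
    -- `barD F = -h (barD B)`.
    have h9 := hh (B W) hpB
    rw [h8, map_neg] at h9
    rw [hFB W rfl, Ω.barD_congr _ _ W hFB, barD_map, AddMonoidHom.neg_apply, AddMonoidHom.neg_apply,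
      map_neg]
    have h10 : B W = 𝒯.star F (F x) W + (- Ω.barM (F x y) W) := rfl
    linear_combination (norm := abel) - h9 - h10

end TotalAlg
end DGRec

namespace DGRec

/-! ### Sums over blocks and cuts -/

namespace Word

variable {O : Type u} {G : O → O → Type v}

/-- The target will be a DG-category, which has operations of at most two inputs, so only
subdivisions into one or two blocks matter. The last prefix leaves an empty right factor, and the
second hypothesis removes that spurious term. -/
theorem sum_blocks {N : Type*} [AddCommMonoid N] {x y : O} (w : Word G x y) :
    ∀ {x₀ : O} (a : G x₀ x) (g : Word (Word G) x₀ y → N)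
    (_ : ∀ {s t q : O} (u : Word G x₀ s) (v : Word G s t) (v' : Word G t q)
      (c : Word (Word G) q y), g (.cons u (.cons v (.cons v' c))) = 0)
    (_ : ∀ u : Word G x₀ y, g (.cons u (.single (.nil y))) = 0),
    ((blocks (.cons a w)).map g).sum = g (.single (.cons a w)) +
      ((prefixes (.cons a w)).map (fun c => g (.cons c.2.1 (.single c.2.2)))).sum := by
  induction w with
  | nil y =>
    intro x₀ a g h3 h0
    have := h0 (single a)
    simp only [single] at this
    simp [blocks, prefixes, pushFront, single, this]
  | @cons x z y b w ih =>
    intro x₀ a g h3 h0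
    rw [blocks, List.map_flatMap, List.flatMap, List.sum_flatten, List.map_map]
    change (List.map (fun c => ((pushFront a c).map g).sum) _).sum = _
    rw [ih b (fun c => ((pushFront a c).map g).sum)]
    · rw [prefixes]
      simp only [pushFront, List.map_cons, List.map_nil, List.sum_cons, List.sum_nil, add_zero,
        List.map_map, single, h3, zero_add]
      rw [← add_assoc, add_comm (g (.cons (.cons a (.nil _)) _)), add_assoc, add_assoc]
      congr 1
      rw [prefixes, prefixes]
      simp only [List.map_cons, List.map_map, List.sum_cons, single]
      rfl
    · intro s t q u v v' c
      simp [pushFront, h3]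
    · intro u
      have := h0 (.cons a u)
      simp only [single] at this
      simp [pushFront, single, h3, this]

theorem one_le_length_of_mem_prefixes {x y : O} (w : Word G x y) :
    ∀ c ∈ w.prefixes, 1 ≤ c.2.1.length := by
  intro c hc
  cases w with
  | nil => simp [prefixes] at hc
  | cons a w =>
    simp only [prefixes, List.mem_cons, List.mem_map] at hc
    rcases hc with rfl | ⟨c, hc, rfl⟩ <;> simp [single, length]

end Word

/-! ### Letters of a DG-category -/

/-- Multilinear functions of words. -/
def IsMultilinear (k : Type w) [CommRing k] {O : Type u} {H : O → O → ℤ → Type v}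
    [∀ x y n, AddCommGroup (H x y n)] [∀ x y n, Module k (H x y n)] {N : Type*} [AddCommGroup N]
    [Module k N] {x y : O} (φ : Word (Letter H) x y → N) : Prop :=
  ∀ ⦃s t : O⦄ (l : Word (Letter H) x s) (p : ℤ) (e : k) (a b : H s t p) (r : Word (Letter H) t y),
    φ (l.append (.cons (letter p (e • a + b)) r)) =
      e • φ (l.append (.cons (letter p a) r)) + φ (l.append (.cons (letter p b) r))

namespace IsMultilinear

variable {k : Type w} [CommRing k] {O : Type u} {H : O → O → ℤ → Type v}
    [∀ x y n, AddCommGroup (H x y n)] [∀ x y n, Module k (H x y n)] {N : Type*} [AddCommGroup N]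
    [Module k N] {x y : O} {φ ψ : Word (Letter H) x y → N}

theorem tail (h : IsMultilinear k φ) {z : O} (a : Letter H x z) :
    IsMultilinear k (fun v => φ (.cons a v)) :=
  fun _ _ l => h (.cons a l)

theorem zero (h : IsMultilinear k φ) {s t : O} (l : Word (Letter H) x s) (p : ℤ)
    (r : Word (Letter H) t y) : φ (l.append (.cons (letter p (0 : H s t p)) r)) = 0 := by
  have := h l p (-1) 0 0 r
  simpa using this

/-- A multilinear function, as a linear function of one letter. -/
def toLinear (h : IsMultilinear k φ) {s t : O} (l : Word (Letter H) x s) (p : ℤ)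
    (r : Word (Letter H) t y) : H s t p →ₗ[k] N where
  toFun a := φ (l.append (.cons (letter p a) r))
  map_add' a b := by simpa using h l p 1 a b r
  map_smul' e a := by
    have := h l p e a 0 r
    rw [h.zero] at this
    simpa using this

theorem add (h : IsMultilinear k φ) (h' : IsMultilinear k ψ) :
    IsMultilinear k (fun v => φ v + ψ v) := by
  intro s t l p e a b r
  simp only [h l, h' l, smul_add]
  abel

theorem map {N' : Type*} [AddCommGroup N'] [Module k N'] (f : N →ₗ[k] N')
    (h : IsMultilinear k φ) : IsMultilinear k (fun v => f (φ v)) := by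
  intro s t l p e a b r
  simp only [h l, map_add, map_smul]

end IsMultilinear

namespace DGCat

variable {k : Type w} [CommRing k] (𝒜 : DGCat.{u, v} k)

theorem d_comp_sign {x y z : 𝒜.Ob} (p q n : ℤ) (h : p + q = n) (f : 𝒜.Hom x y p)
    (g : 𝒜.Hom y z q) :
    n.negOnePow • p.negOnePow • 𝒜.d x z n (n + 1) (𝒜.comp h f g) +
      (p + 1).negOnePow • p.negOnePow • 𝒜.comp (by omega) (𝒜.d x y p (p + 1) f) g +
      (p - 1).negOnePow • p.negOnePow • q.negOnePow •
        𝒜.comp (by omega) f (𝒜.d y z q (q + 1) g) = 0 := by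
  rw [𝒜.leibniz (p' := p + 1) (q' := q + 1) h rfl rfl rfl (by omega) (by omega),
    show n.negOnePow = p.negOnePow * q.negOnePow by rw [← h, Int.negOnePow_add], Int.negOnePow_succ, Int.negOnePow_sub]
  rcases Int.units_eq_one_or p.negOnePow with hp | hp <;>
  rcases Int.units_eq_one_or q.negOnePow with hq | hq <;>
  simp only [hp, hq, Units.neg_smul, one_smul, neg_neg, Int.negOnePow_one,
      mul_one, mul_neg] <;> abel

/-- The operations on letters of a DG-category, in the sign convention of `A_∞`-categories. -/
def letterOps : LetterOps (Letter 𝒜.Hom) where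
  D {x y} a := letter (a.1 + 1) (a.1.negOnePow • 𝒜.d x y a.1 (a.1 + 1) a.2)
  M a b := letter (a.1 + b.1) (a.1.negOnePow • 𝒜.comp rfl a.2 b.2)
  ε a := (a.1 - 1).negOnePow
  ε_D a := by simp [Int.negOnePow_sub]
  ε_M a b := by simp [Int.negOnePow_sub, Int.negOnePow_add]

theorem letterOps_D {x y : 𝒜.Ob} (p n : ℤ) (h : p + 1 = n) (f : 𝒜.Hom x y p) :
    𝒜.letterOps.D (letter p f) = letter n (p.negOnePow • 𝒜.d x y p n f) := by
  subst h
  rfl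

theorem letterOps_M {x y z : 𝒜.Ob} (p q n : ℤ) (h : p + q = n) (f : 𝒜.Hom x y p)
    (g : 𝒜.Hom y z q) :
    𝒜.letterOps.M (letter p f) (letter q g) = letter n (p.negOnePow • 𝒜.comp h f g) := by
  subst h
  rfl

theorem map_sign {N N' : Type*} [AddCommGroup N] [AddCommGroup N'] [Module k N] [Module k N']
    (f : N →ₗ[k] N') (e : ℤˣ) (x : N) : f (e • x) = e • f x :=
  LetterOps.map_units f.toAddMonoidHom e x

-- Each identity is a vanishing combination in a single slot of the word, with fixed neighbours, and
-- `φ` is linear in that slot.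
variable {𝒜} in
theorem compatible_of_isMultilinear {N : Type*} [AddCommGroup N] [Module k N] {x y : 𝒜.Ob}
    {φ : Word (Letter 𝒜.Hom) x y → N} (h : IsMultilinear k φ) : 𝒜.letterOps.Compatible φ where
  DD l a r := by
    obtain ⟨p, f⟩ := a
    rw [𝒜.letterOps_D p (p + 1) rfl, 𝒜.letterOps_D (p + 1) (p + 1 + 1) rfl, map_sign,
      𝒜.d_d, smul_zero, smul_zero, h.zero]
  DM l a b r := by
    obtain ⟨p, f⟩ := a
    obtain ⟨q, g⟩ := b
    have h0 := congrArg (h.toLinear l (p + q + 1) r) (𝒜.d_comp_sign p q (p + q) rfl f g)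
    rw [map_zero, map_add, map_add, map_sign _ (p - 1).negOnePow] at h0
    rw [← h0, 𝒜.letterOps_M p q (p + q) rfl, 𝒜.letterOps_D (p + q) _ rfl,
      𝒜.letterOps_D p _ rfl, 𝒜.letterOps_D q _ rfl, 𝒜.letterOps_M (p + 1) q (p + q + 1) (by omega),
      𝒜.letterOps_M p (q + 1) (p + q + 1) (by omega), map_sign, map_sign, map_sign]
    rw [LinearMap.smul_apply]
    rfl
  MM l a b c r := by
    obtain ⟨p, f⟩ := a
    obtain ⟨q, g⟩ := b
    obtain ⟨s, e⟩ := c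
    have h1 : (p + q).negOnePow • 𝒜.comp rfl (p.negOnePow • 𝒜.comp rfl f g) e +
        (p - 1).negOnePow • p.negOnePow • 𝒜.comp (show p + (q + s) = p + q + s by omega) f
          (q.negOnePow • 𝒜.comp rfl g e) = 0 := by
      rw [map_sign, map_sign, LinearMap.smul_apply, 𝒜.assoc rfl rfl rfl (by omega),
        Int.negOnePow_add, Int.negOnePow_sub]
      rcases Int.units_eq_one_or p.negOnePow with hp | hp <;>
      rcases Int.units_eq_one_or q.negOnePow with hq | hq <;>
      simp [hp, hq]
    have h0 := congrArg (h.toLinear l (p + q + s) r) h1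
    rw [map_zero, map_add, map_sign _ (p - 1).negOnePow] at h0
    rw [← h0, 𝒜.letterOps_M p q (p + q) rfl, 𝒜.letterOps_M q s (q + s) rfl,
      𝒜.letterOps_M (p + q) s _ rfl, 𝒜.letterOps_M p (q + s) (p + q + s) (by omega)]
    rfl

theorem op_single_eq {x y : 𝒜.Ob} (a : Letter 𝒜.Hom x y) :
    letter (rdeg (.single a) + 2) (𝒜.op (.single a) (rdeg (.single a) + 2)) = 𝒜.letterOps.D a :=
  𝒜.letter_op (.single a) _ _ (by simp only [Word.single, rdeg]; omega)

theorem op_pair_eq {x y z : 𝒜.Ob} (a : Letter 𝒜.Hom x y) (b : Letter 𝒜.Hom y z) :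
    letter (rdeg (.cons a (.single b)) + 2)
      (𝒜.op (.cons a (.single b)) (rdeg (.cons a (.single b)) + 2)) = 𝒜.letterOps.M a b := by
  rw [𝒜.letter_op _ _ (a.1 + b.1) (by simp only [Word.single, rdeg]; omega)]
  exact congrArg _ (𝒜.op_pair rfl a.2 b.2)

/-- The operations vanish on three or more letters, so only the prefixes of length one and two
contribute. -/
theorem sum_prefixes_op {N : Type*} [AddCommGroup N] [Module k N] {x z y : 𝒜.Ob}
    {φ : Word (Letter 𝒜.Hom) x y → N} (h : IsMultilinear k φ) (a : Letter 𝒜.Hom x z)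
    (w : Word (Letter 𝒜.Hom) z y) :
    ((Word.prefixes (.cons a w)).map (fun c =>
      φ (.cons (letter (rdeg c.2.1 + 2) (𝒜.op c.2.1 (rdeg c.2.1 + 2))) c.2.2))).sum =
      φ (.cons (𝒜.letterOps.D a) w) + 𝒜.letterOps.merge a φ w := by
  rw [Word.prefixes, List.map_cons, List.sum_cons, op_single_eq, List.map_map]
  congr 1
  cases w with
  | nil => rfl
  | cons b w =>
    rw [Word.prefixes, List.map_cons, List.sum_cons, List.map_map, List.sum_eq_zero, add_zero]
    · simp only [Function.comp, op_pair_eq]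
      rfl
    · intro t ht
      obtain ⟨c, hc, rfl⟩ := List.mem_map.1 ht
      obtain ⟨z', u, v⟩ := c
      cases u with
      | nil =>
        have := Word.one_le_length_of_mem_prefixes w _ hc
        simp [Word.length] at this
      | cons c u => exact h.zero (.nil _) _ _

/-- The sign of a cut is the product of the signs of the letters to its left, which is how `barD`
and `barM` accumulate signs recursively. -/
theorem sum_cuts_op {N : Type*} [AddCommGroup N] [Module k N] {x y : 𝒜.Ob}
    {φ : Word (Letter 𝒜.Hom) x y → N} (h : IsMultilinear k φ) (w : Word (Letter 𝒜.Hom) x y) :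
    (w.cuts.map (fun c => (rdeg c.left).negOnePow •
      φ (c.left.append
        (.cons (letter (rdeg c.mid + 2) (𝒜.op c.mid (rdeg c.mid + 2))) c.right)))).sum =
      𝒜.letterOps.barD φ w + 𝒜.letterOps.barM φ w := by
  induction w with
  | nil => simp [Word.cuts, LetterOps.barD, LetterOps.barM]
  | cons a w ih =>
    rw [Word.cuts, List.map_append, List.sum_append, List.map_map, List.map_map]
    have e1 := 𝒜.sum_prefixes_op h a w
    have e2 := congrArg (𝒜.letterOps.ε a • ·) (ih (φ := fun v => φ (.cons a v)) (h.tail a))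
    simp only [List.smul_sum, List.map_map, smul_add] at e2
    rw [LetterOps.barD, LetterOps.barM]
    rw [show ∀ a b c d : N, a + b + (c + d) = (a + c) + (b + d) by intros; abel, ← e1, ← e2]
    congr 2
    · refine List.map_congr_left fun c _ => ?_
      simp [rdeg, Word.append]
    · refine List.map_congr_left fun c _ => ?_
      simp only [Function.comp, rdeg, Word.append, Int.negOnePow_add, mul_smul]
      rfl

end DGCat
end DGRec

namespace DGRec

/-! ### The total algebra of a DG-category -/

/-! ### Multilinearity of the bar operations and of the lift -/

section Multilinear

variable {k : Type w} [CommRing k] (𝒜 : DGCat.{u, v} k)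
variable {T : 𝒜.Ob → 𝒜.Ob → Type v} [∀ x y, AddCommGroup (T x y)] [∀ x y, Module k (T x y)]
variable (𝒯 : TotalAlg T)

/-- Multiplication by a scalar. -/
def scalarHom {N : Type*} [AddCommGroup N] [Module k N] (e : k) : N →+ N :=
  DistribSMul.toAddMonoidHom N e

theorem IsMultilinear.merge {N : Type*} [AddCommGroup N] [Module k N] {x z y : 𝒜.Ob}
    {φ : Word (Letter 𝒜.Hom) x y → N} (h : IsMultilinear k φ) (a : Letter 𝒜.Hom x z) :
    IsMultilinear k (𝒜.letterOps.merge a φ) := by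
  intro s t l p e b b' r
  cases l with
  | nil =>
    obtain ⟨q, a⟩ := a
    have := (h.toLinear (.nil x) (q + p) r).map_add (e • q.negOnePow • 𝒜.comp rfl a b)
      (q.negOnePow • 𝒜.comp rfl a b')
    rw [map_smul, smul_comm, ← smul_add, ← map_smul, ← map_add] at this
    exact this
  | cons c l => exact h (.cons (𝒜.letterOps.M a c) l) p e b b' r

theorem IsMultilinear.barM {N : Type*} [AddCommGroup N] [Module k N] {x y : 𝒜.Ob}
    {φ : Word (Letter 𝒜.Hom) x y → N} (h : IsMultilinear k φ) :
    IsMultilinear k (𝒜.letterOps.barM φ) := by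
  intro s t l p e b b' r
  induction l with
  | nil =>
    have e1 : (fun v => φ (.cons (letter p (e • b + b')) v)) =
        fun v => scalarHom e (φ (.cons (letter p b) v)) + φ (.cons (letter p b') v) := by
      funext v
      exact h (.nil _) p e b b' v
    have e2 : 𝒜.letterOps.merge (letter p (e • b + b')) φ r =
        e • 𝒜.letterOps.merge (letter p b) φ r + 𝒜.letterOps.merge (letter p b') φ r := by
      cases r with
      | nil => simp
      | cons c r =>
        obtain ⟨q, c⟩ := c
        have := (h.toLinear (.nil _) (p + q) r).map_add (e • p.negOnePow • 𝒜.comp rfl b c)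
          (p.negOnePow • 𝒜.comp rfl b' c)
        rw [map_smul, smul_comm, ← smul_add, ← LinearMap.smul_apply e, ← map_smul,
          ← LinearMap.add_apply, ← map_add] at this
        exact this
    simp only [Word.append, LetterOps.barM]
    rw [e1, LetterOps.barM_add, LetterOps.barM_map, e2, smul_add, smul_add]
    rw [show 𝒜.letterOps.ε (letter p (e • b + b')) = 𝒜.letterOps.ε (letter p b) from rfl,
      show 𝒜.letterOps.ε (letter p b') = 𝒜.letterOps.ε (letter p b) from rfl,
      smul_comm e]
    simp only [scalarHom, DistribSMul.toAddMonoidHom_apply]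
    abel
  | cons c l ih =>
    simp only [Word.append, LetterOps.barM]
    rw [ih (h.tail c), h.merge 𝒜 c l, smul_add, smul_add, smul_comm e (𝒜.letterOps.ε c)]
    abel

theorem isMultilinear_star
    (hl : ∀ {x y z : 𝒜.Ob} (e : k) (a : T x y) (b : T y z), 𝒯.m₂ (e • a) b = e • 𝒯.m₂ a b)
    (hr : ∀ {x y z : 𝒜.Ob} (e : k) (a : T x y) (b : T y z), 𝒯.m₂ a (e • b) = e • 𝒯.m₂ a b)
    {ψ : ∀ x y : 𝒜.Ob, Word (Letter 𝒜.Hom) x y → T x y} (hψ : ∀ x y, IsMultilinear k (ψ x y))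
    {x₀ x y : 𝒜.Ob} {φ : ∀ z, Word (Letter 𝒜.Hom) x z → T x₀ z}
    (hφ : ∀ z, IsMultilinear k (φ z)) :
    IsMultilinear k (𝒯.star ψ φ : Word (Letter 𝒜.Hom) x y → T x₀ y) := by
  have hs : ∀ {x y : 𝒜.Ob} (e : k) (φ : ∀ z, Word (Letter 𝒜.Hom) x z → T x₀ z)
      (w : Word (Letter 𝒜.Hom) x y),
      𝒯.star ψ (fun z v => e • φ z v) w = e • 𝒯.star ψ φ w := by
    intro x y e φ w
    induction w with
    | nil => simp [TotalAlg.star]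
    | cons a w ih => simp only [TotalAlg.star, ih, hl, smul_add]
  intro s t l p e b b' r
  induction l with
  | nil =>
    have e1 : (fun z v => φ z (.cons (letter p (e • b + b')) v)) =
        fun z v => e • (φ z (.cons (letter p b) v)) + φ z (.cons (letter p b') v) := by
      funext z v
      exact hφ z (.nil _) p e b b' v
    have e2 := hφ _ (.nil _) p e b b' (.nil _)
    simp only [Word.append] at e2
    simp only [Word.append, TotalAlg.star, Word.single]
    rw [e1, TotalAlg.star_add_left, hs, e2, map_add, AddMonoidHom.add_apply, hl, smul_add]
    abel
  | cons c l ih =>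
    simp only [Word.append, TotalAlg.star]
    rw [ih (fun z => IsMultilinear.tail (hφ z) c), hψ _ _ l, map_add, hr, smul_add]
    abel

/-- `TotalAlg` records only additivity, so compatibility of `m₂` with scalars is supplied
separately. -/
theorem isMultilinear_liftAux
    (hl : ∀ {x y z : 𝒜.Ob} (e : k) (a : T x y) (b : T y z), 𝒯.m₂ (e • a) b = e • 𝒯.m₂ a b)
    (hr : ∀ {x y z : 𝒜.Ob} (e : k) (a : T x y) (b : T y z), 𝒯.m₂ a (e • b) = e • 𝒯.m₂ a b)
    (s : ∀ {x y : 𝒜.Ob} (n : ℤ), 𝒜.Hom x y n →ₗ[k] T x y) (h : ∀ {x y : 𝒜.Ob}, T x y →ₗ[k] T x y)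
    (n : ℕ) (x y : 𝒜.Ob) :
    IsMultilinear k (TotalAlg.liftAux 𝒜.letterOps 𝒯 (fun a => s a.1 a.2)
      (fun {_ _} => h.toAddMonoidHom) n x y) := by
  induction n generalizing x y with
  | zero => intro s t l p e b b' r; simp [TotalAlg.liftAux]
  | succ n ih =>
    set F := TotalAlg.liftAux 𝒜.letterOps 𝒯 (fun a => s a.1 a.2)
      (fun {_ _} => h.toAddMonoidHom) n with hF
    have key : ∀ {x y z t : 𝒜.Ob} (a : Letter 𝒜.Hom x y) (b : Letter 𝒜.Hom y z)
      (w : Word (Letter 𝒜.Hom) z t), TotalAlg.liftAux 𝒜.letterOps 𝒯 (fun a => s a.1 a.2)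
      (fun {_ _} => h.toAddMonoidHom) (n + 1) x t (.cons a (.cons b w)) =
      (- h) (𝒯.star F (F x) (.cons a (.cons b w)) + (- LinearMap.id (R := k))
        (𝒜.letterOps.barM (F x t) (.cons a (.cons b w)))) := by
      intro x y z t a b w
      rw [TotalAlg.liftAux, sub_eq_add_neg]
      rfl
    have hm : ∀ x y, IsMultilinear k (fun w => (- h) (𝒯.star F (F x) w +
        (- LinearMap.id (R := k)) (𝒜.letterOps.barM (F x y) w))) := fun x y =>
      IsMultilinear.map _ (IsMultilinear.add (isMultilinear_star 𝒜 𝒯 hl hr ih (ih x))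
        (IsMultilinear.map _ (IsMultilinear.barM 𝒜 (ih x y))))
    intro s' t l p e b b' r
    cases l with
    | nil =>
      cases r with
      | nil =>
        simp only [Word.append, TotalAlg.liftAux, map_add, map_smul]
      | cons c r =>
        have := hm x y (.nil _) p e b b' (.cons c r)
        simp only [Word.append] at this ⊢
        rwa [key, key, key]
    | cons c l =>
      have := hm x y (.cons c l) p e b b' r
      cases l with
      | nil =>
        simp only [Word.append] at this ⊢
        rwa [key, key, key]
      | cons c' l =>
        simp only [Word.append] at this ⊢
        rwa [key, key, key]

end Multilinear

namespace DGCat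

variable {k : Type w} [CommRing k] (𝒟 : DGCat.{u, v} k) {O : Type u} (r : O → 𝒟.Ob)

/-- The total space of a morphism complex. -/
abbrev Tot (x y : O) : Type v := DirectSum ℤ (fun n => 𝒟.Hom (r x) (r y) n)

/-- The inclusion of the morphisms of degree `n`. -/
abbrev incl {x y : O} (n : ℤ) : 𝒟.Hom (r x) (r y) n →ₗ[k] 𝒟.Tot r x y :=
  DirectSum.lof k ℤ (fun n => 𝒟.Hom (r x) (r y) n) n

/-- The operation `m₁` on total spaces. -/
def totM₁ (x y : O) : 𝒟.Tot r x y →ₗ[k] 𝒟.Tot r x y :=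
  DirectSum.toModule k ℤ _ (fun n => 𝒟.incl r (n + 1) ∘ₗ (n.negOnePow • 𝒟.d _ _ n (n + 1)))

/-- The operation `m₂` on total spaces. -/
def totM₂ (x y z : O) : 𝒟.Tot r x y →ₗ[k] 𝒟.Tot r y z →ₗ[k] 𝒟.Tot r x z :=
  DirectSum.toModule k ℤ _ (fun p => p.negOnePow • LinearMap.flip
    (DirectSum.toModule k ℤ _ (fun q => LinearMap.flip
      ((𝒟.comp rfl).compr₂ (𝒟.incl r (p + q))))))

/-- The reduced parity involution on total spaces. -/
def totτ (x y : O) : 𝒟.Tot r x y →ₗ[k] 𝒟.Tot r x y :=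
  DirectSum.toModule k ℤ _ (fun n => (n - 1).negOnePow • 𝒟.incl r n)

variable {x y z : O}

theorem totM₁_incl (p n : ℤ) (h : p + 1 = n) (f : 𝒟.Hom (r x) (r y) p) :
    𝒟.totM₁ r x y (𝒟.incl r p f) = 𝒟.incl r n (p.negOnePow • 𝒟.d _ _ p n f) := by
  subst h
  simp only [totM₁, DirectSum.toModule_lof]
  rfl

theorem totτ_incl (p : ℤ) (f : 𝒟.Hom (r x) (r y) p) :
    𝒟.totτ r x y (𝒟.incl r p f) = (p - 1).negOnePow • 𝒟.incl r p f := by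
  simp only [totτ, DirectSum.toModule_lof]
  rfl

theorem totM₂_incl (p q n : ℤ) (h : p + q = n) (f : 𝒟.Hom (r x) (r y) p)
    (g : 𝒟.Hom (r y) (r z) q) :
    𝒟.totM₂ r x y z (𝒟.incl r p f) (𝒟.incl r q g) =
      𝒟.incl r n (p.negOnePow • 𝒟.comp h f g) := by
  subst h
  simp only [totM₂, DirectSum.toModule_lof]
  rw [LinearMap.smul_apply, LinearMap.smul_apply, LinearMap.flip_apply, DirectSum.toModule_lof,
    map_sign]
  rfl

theorem tot_induction {P : 𝒟.Tot r x y → Prop} (t : 𝒟.Tot r x y) (h0 : P 0)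
    (h1 : ∀ n f, P (𝒟.incl r n f)) (h2 : ∀ t t', P t → P t' → P (t + t')) : P t :=
  DirectSum.induction_on t h0 h1 (fun t t' => h2 t t')

/-- The algebra structure on the total spaces of the morphism complexes. -/
def total : TotalAlg (fun x y => 𝒟.Tot r x y) where
  m₁ := (𝒟.totM₁ r _ _).toAddMonoidHom
  m₂ := LinearMap.toAddMonoidHom'.comp (𝒟.totM₂ r _ _ _).toAddMonoidHom
  τ := (𝒟.totτ r _ _).toAddMonoidHom
  leibniz {x y z} a b := by
    change 𝒟.totM₁ r x z (𝒟.totM₂ r x y z a b) + 𝒟.totM₂ r x y z (𝒟.totM₁ r x y a) b +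
      𝒟.totM₂ r x y z (𝒟.totτ r x y a) (𝒟.totM₁ r y z b) = 0
    induction a using tot_induction with
    | h0 => simp
    | h2 a a' h h' =>
      simp only [map_add, LinearMap.add_apply]
      linear_combination (norm := abel) h + h'
    | h1 p f =>
      induction b using tot_induction with
      | h0 => simp
      | h2 b b' h h' =>
        simp only [map_add]
        linear_combination (norm := abel) h + h'
      | h1 q g =>
        rw [𝒟.totM₂_incl r p q _ rfl, 𝒟.totM₁_incl r _ _ rfl, 𝒟.totM₁_incl r p _ rfl,
          𝒟.totM₁_incl r q _ rfl, 𝒟.totτ_incl, map_sign (𝒟.totM₂ r x y z), LinearMap.smul_apply,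
          𝒟.totM₂_incl r (p + 1) q (p + q + 1) (by omega),
          𝒟.totM₂_incl r p (q + 1) (p + q + 1) (by omega), ← map_sign (𝒟.incl r _),
          ← map_add, ← map_add, ← map_zero (𝒟.incl r (p + q + 1))]
        congr 1
        have := 𝒟.d_comp_sign p q (p + q) rfl f g
        rw [map_sign, map_sign, map_sign, LinearMap.smul_apply]
        exact this
  assoc {x y z t} a b c := by
    change 𝒟.totM₂ r x z t (𝒟.totM₂ r x y z a b) c +
      𝒟.totM₂ r x y t (𝒟.totτ r x y a) (𝒟.totM₂ r y z t b c) = 0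
    induction a using tot_induction with
    | h0 => simp
    | h2 a a' h h' =>
      simp only [map_add, LinearMap.add_apply]
      linear_combination (norm := abel) h + h'
    | h1 p f =>
      induction b using tot_induction with
      | h0 => simp
      | h2 b b' h h' =>
        simp only [map_add, LinearMap.add_apply]
        linear_combination (norm := abel) h + h'
      | h1 q g =>
        induction c using tot_induction with
        | h0 => simp
        | h2 c c' h h' =>
          simp only [map_add]
          linear_combination (norm := abel) h + h'
        | h1 s e =>
          rw [𝒟.totM₂_incl r p q _ rfl, 𝒟.totM₂_incl r q s _ rfl, 𝒟.totM₂_incl r (p + q) s _ rfl,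
            𝒟.totτ_incl, map_sign (𝒟.totM₂ r x y t), LinearMap.smul_apply,
            𝒟.totM₂_incl r p (q + s) (p + q + s) (by omega), ← map_sign (𝒟.incl r _),
            ← map_add, ← map_zero (𝒟.incl r (p + q + s))]
          congr 1
          rw [map_sign, map_sign, LinearMap.smul_apply, 𝒟.assoc rfl rfl rfl (by omega),
            Int.negOnePow_add, Int.negOnePow_sub]
          rcases Int.units_eq_one_or p.negOnePow with hp | hp <;>
          rcases Int.units_eq_one_or q.negOnePow with hq | hq <;>
          simp [hp, hq]

end DGCat
end DGRec

/-! ### Contractions of surjections of DG-categories, and the lift of the section -/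

namespace DGRec

/-- A functor of DG-categories. -/
structure DGFunctor {k : Type w} [CommRing k] (𝒞 : DGCat.{u, v} k) (𝒟 : DGCat.{u', v} k) where
  obj : 𝒞.Ob → 𝒟.Ob
  map : ∀ (x y : 𝒞.Ob) (n : ℤ), 𝒞.Hom x y n →ₗ[k] 𝒟.Hom (obj x) (obj y) n
  map_d : ∀ (x y : 𝒞.Ob) (p q : ℤ) (f : 𝒞.Hom x y p),
    map x y q (𝒞.d x y p q f) = 𝒟.d _ _ p q (map x y p f)
  map_one : ∀ x : 𝒞.Ob, map x x 0 (𝒞.one x) = 𝒟.one (obj x)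
  map_comp : ∀ {x y z : 𝒞.Ob} {p q n : ℤ} (h : p + q = n) (f : 𝒞.Hom x y p) (g : 𝒞.Hom y z q),
    map x z n (𝒞.comp h f g) = 𝒟.comp h (map x y p f) (map y z q g)

/-- A full quasi-surjection of a DG-category onto another one, with a contraction of its kernel. -/
structure Contraction {k : Type w} [CommRing k] (𝒜 𝒟 : DGCat.{u, v} k) where
  r : 𝒜.Ob → 𝒟.Ob
  p : ∀ (x y : 𝒜.Ob) (n : ℤ), 𝒟.Hom (r x) (r y) n →ₗ[k] 𝒜.Hom x y n
  p_d : ∀ (x y : 𝒜.Ob) (n m : ℤ) (f : 𝒟.Hom (r x) (r y) n),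
    p x y m (𝒟.d _ _ n m f) = 𝒜.d x y n m (p x y n f)
  p_comp : ∀ {x y z : 𝒜.Ob} {a b n : ℤ} (h : a + b = n) (f : 𝒟.Hom (r x) (r y) a)
    (g : 𝒟.Hom (r y) (r z) b), p x z n (𝒟.comp h f g) = 𝒜.comp h (p x y a f) (p y z b g)
  s : ∀ (x y : 𝒜.Ob) (n : ℤ), 𝒜.Hom x y n →ₗ[k] 𝒟.Hom (r x) (r y) n
  s_d : ∀ (x y : 𝒜.Ob) (n m : ℤ) (f : 𝒜.Hom x y n),
    s x y m (𝒜.d x y n m f) = 𝒟.d _ _ n m (s x y n f)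
  p_s : ∀ (x y : 𝒜.Ob) (n : ℤ) (f : 𝒜.Hom x y n), p x y n (s x y n f) = f
  K : ∀ (x y : 𝒜.Ob) (n m : ℤ), 𝒟.Hom (r x) (r y) n →ₗ[k] 𝒟.Hom (r x) (r y) m
  p_K : ∀ (x y : 𝒜.Ob) (n m : ℤ) (f : 𝒟.Hom (r x) (r y) n), p x y m (K x y n m f) = 0
  homotopy : ∀ (x y : 𝒜.Ob) (n : ℤ) (f : 𝒟.Hom (r x) (r y) n),
    𝒟.d _ _ (n - 1) n (K x y n (n - 1) f) + K x y (n + 1) n (𝒟.d _ _ n (n + 1) f) =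
      f - s x y n (p x y n f)

namespace DGCat

variable {k : Type w} [CommRing k] (𝒟 : DGCat.{u, v} k) {O : Type u} (r : O → 𝒟.Ob)

/-- Homogeneous elements of a total space. -/
def Homog {x y : O} (n : ℤ) (t : 𝒟.Tot r x y) : Prop := ∃ f, t = 𝒟.incl r n f

variable {𝒟 r}

namespace Homog

variable {x y z : O} {n m : ℤ}

theorem cast {t : 𝒟.Tot r x y} (h : 𝒟.Homog r n t) (e : n = m) : 𝒟.Homog r m t := e ▸ h

theorem zero : 𝒟.Homog r n (0 : 𝒟.Tot r x y) := ⟨0, by simp⟩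

theorem add {t t' : 𝒟.Tot r x y} (h : 𝒟.Homog r n t) (h' : 𝒟.Homog r n t') :
    𝒟.Homog r n (t + t') := by
  obtain ⟨f, rfl⟩ := h
  obtain ⟨f', rfl⟩ := h'
  exact ⟨f + f', by simp⟩

theorem sign {t : 𝒟.Tot r x y} (h : 𝒟.Homog r n t) (e : ℤˣ) : 𝒟.Homog r n (e • t) := by
  obtain ⟨f, rfl⟩ := h
  exact ⟨e • f, by rw [map_sign]⟩

theorem m₂ {t : 𝒟.Tot r x y} {t' : 𝒟.Tot r y z} (h : 𝒟.Homog r n t) (h' : 𝒟.Homog r m t') :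
    𝒟.Homog r (n + m) ((𝒟.total r).m₂ t t') := by
  obtain ⟨f, rfl⟩ := h
  obtain ⟨f', rfl⟩ := h'
  exact ⟨_, 𝒟.totM₂_incl r n m _ rfl f f'⟩

variable {H : O → O → ℤ → Type v}

/-- The shift `c` accounts for the letters that the recursion has already absorbed into `φ`. -/
theorem star {ψ : ∀ x y : O, Word (Letter H) x y → 𝒟.Tot r x y}
    (hψ : ∀ x y w, 𝒟.Homog r (rdeg w + 1) (ψ x y w)) {x₀ : O}
    (w : Word (Letter H) x y) (c : ℤ) (φ : ∀ z, Word (Letter H) x z → 𝒟.Tot r x₀ z)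
    (hφ : ∀ z v, 𝒟.Homog r (rdeg v + c) (φ z v)) :
    𝒟.Homog r (rdeg w + c + 1) ((𝒟.total r).star ψ φ w) := by
  induction w generalizing c with
  | nil => exact zero
  | cons a w ih =>
    refine add ?_ ?_
    · exact ((hφ _ (.single a)).m₂ (hψ _ _ w)).cast (by simp only [Word.single, rdeg]; omega)
    · exact (ih (c + (a.1 - 1)) _ (fun z v => (hφ z (.cons a v)).cast
        (by simp only [rdeg]; omega))).cast (by simp only [rdeg]; omega)

end Homog

end DGCat

namespace Contraction

variable {k : Type w} [CommRing k] {𝒜 𝒟 : DGCat.{u, v} k} (Γ : Contraction 𝒜 𝒟)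

theorem homog_barM {x y x₀ y₀ : 𝒜.Ob} (w : Word (Letter 𝒜.Hom) x y) (c : ℤ)
    (φ : Word (Letter 𝒜.Hom) x y → 𝒟.Tot Γ.r x₀ y₀)
    (hφ : ∀ v, 𝒟.Homog Γ.r (rdeg v + c) (φ v)) :
    𝒟.Homog Γ.r (rdeg w + c + 1) (𝒜.letterOps.barM φ w) := by
  induction w generalizing c with
  | nil => exact .zero
  | cons a w ih =>
    refine .add ?_ ?_
    · cases w with
      | nil => exact .zero
      | cons b w =>
        exact (hφ (.cons (𝒜.letterOps.M a b) w)).cast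
          (by simp only [DGCat.letterOps, rdeg]; omega)
    · exact (((ih (c + (a.1 - 1)) _ (fun v => (hφ (.cons a v)).cast
        (by simp only [rdeg]; omega))).sign _).cast (by simp only [rdeg]; omega))

/-- The section, as a map to the total space. -/
def totS (x y : 𝒜.Ob) (n : ℤ) : 𝒜.Hom x y n →ₗ[k] 𝒟.Tot Γ.r x y :=
  𝒟.incl Γ.r n ∘ₗ Γ.s x y n

/-- The projection on total spaces. -/
def totP (x y : 𝒜.Ob) : 𝒟.Tot Γ.r x y →ₗ[k] 𝒜.Tot id x y :=
  DirectSum.toModule k ℤ _ (fun n => 𝒜.incl id n ∘ₗ Γ.p x y n)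

/-- The contraction on total spaces. -/
def totK (x y : 𝒜.Ob) : 𝒟.Tot Γ.r x y →ₗ[k] 𝒟.Tot Γ.r x y :=
  DirectSum.toModule k ℤ _ (fun n => 𝒟.incl Γ.r (n - 1) ∘ₗ ((n - 1).negOnePow • Γ.K x y n (n - 1)))

theorem totP_incl {x y : 𝒜.Ob} (n : ℤ) (f : 𝒟.Hom (Γ.r x) (Γ.r y) n) :
    Γ.totP x y (𝒟.incl Γ.r n f) = 𝒜.incl id n (Γ.p x y n f) := by
  simp only [totP, DirectSum.toModule_lof]
  rfl

theorem totK_incl {x y : 𝒜.Ob} (n m : ℤ) (h : n - 1 = m) (f : 𝒟.Hom (Γ.r x) (Γ.r y) n) :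
    Γ.totK x y (𝒟.incl Γ.r n f) = 𝒟.incl Γ.r m (m.negOnePow • Γ.K x y n m f) := by
  subst h
  simp only [totK, DirectSum.toModule_lof]
  rfl

/-- The components of the lift, with values in the total spaces. -/
def lift (x y : 𝒜.Ob) : Word (Letter 𝒜.Hom) x y → 𝒟.Tot Γ.r x y :=
  TotalAlg.lift 𝒜.letterOps (𝒟.total Γ.r) (fun a => Γ.totS _ _ a.1 a.2)
    (fun {x y} => (Γ.totK x y).toAddMonoidHom) x y

/-- The sign in `totK` cancels the sign by which `m₁` differs from `d`, so the homotopy identity for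
`d` becomes one for `m₁`. The section term vanishes on the kernel of the projection. -/
theorem totK_homotopy {x y : 𝒜.Ob} (t : 𝒟.Tot Γ.r x y) (h : Γ.totP x y t = 0) :
    𝒟.totM₁ Γ.r x y (Γ.totK x y t) + Γ.totK x y (𝒟.totM₁ Γ.r x y t) = t := by
  have key : ∀ t, 𝒟.totM₁ Γ.r x y (Γ.totK x y t) + Γ.totK x y (𝒟.totM₁ Γ.r x y t) =
      t - DirectSum.toModule k ℤ _ (fun n => Γ.totS x y n) (Γ.totP x y t) := by
    intro t
    induction t using DGCat.tot_induction with
    | h0 => simp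
    | h2 t t' h h' =>
      simp only [map_add]
      linear_combination (norm := abel) h + h'
    | h1 n f =>
      rw [Γ.totK_incl n _ rfl, 𝒟.totM₁_incl Γ.r (n - 1) n (by omega), 𝒟.totM₁_incl Γ.r n _ rfl,
        Γ.totK_incl (n + 1) n (by omega), totP_incl, DGCat.map_sign (𝒟.d _ _ (n - 1) n),
        DGCat.map_sign (Γ.K x y (n + 1) n), smul_smul,
        smul_smul, Int.units_mul_self, Int.units_mul_self, one_smul, one_smul, ← map_add,
        Γ.homotopy, map_sub]
      congr 1
      exact (DirectSum.toModule_lof k (φ := fun n => Γ.totS x y n) n (Γ.p x y n f)).symm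
  rw [key, h, map_zero, sub_zero]

theorem totP_m₂ {x y z : 𝒜.Ob} (a : 𝒟.Tot Γ.r x y) (b : 𝒟.Tot Γ.r y z) :
    Γ.totP x z (𝒟.totM₂ Γ.r x y z a b) = 𝒜.totM₂ id x y z (Γ.totP x y a) (Γ.totP y z b) := by
  induction a using DGCat.tot_induction with
  | h0 => simp
  | h2 a a' h h' => simp only [map_add, LinearMap.add_apply, h, h']
  | h1 p f =>
    induction b using DGCat.tot_induction with
    | h0 => simp
    | h2 b b' h h' => simp only [map_add, h, h']
    | h1 q g =>
      rw [𝒟.totM₂_incl Γ.r p q _ rfl, totP_incl, totP_incl, totP_incl,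
        𝒜.totM₂_incl id p q _ rfl, DGCat.map_sign, Γ.p_comp]

/-- The star product and `barM` both yield degree `rdeg w + 2`, and the contraction lowers it by
one. The induction is on the fuel, so it covers truncated values as well. -/
theorem homog_lift {x y : 𝒜.Ob} (w : Word (Letter 𝒜.Hom) x y) :
    𝒟.Homog Γ.r (rdeg w + 1) (Γ.lift x y w) := by
  suffices H : ∀ (n : ℕ) (x y : 𝒜.Ob) (w : Word (Letter 𝒜.Hom) x y), 𝒟.Homog Γ.r (rdeg w + 1)
      (TotalAlg.liftAux 𝒜.letterOps (𝒟.total Γ.r) (fun a => Γ.totS _ _ a.1 a.2)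
        (fun {x y} => (Γ.totK x y).toAddMonoidHom) n x y w) from H _ _ _ w
  intro n
  induction n with
  | zero => intro x y w; exact .zero
  | succ n ih =>
    intro x y w
    match w with
    | .nil _ => exact .zero
    | .cons a (.nil _) =>
      exact DGCat.Homog.cast ⟨_, rfl⟩ (by simp only [rdeg]; omega)
    | .cons a (.cons b w) =>
      obtain ⟨f, hf⟩ := DGCat.Homog.star ih (.cons a (.cons b w)) 1 _ (ih x)
      obtain ⟨g, hg⟩ := Γ.homog_barM (.cons a (.cons b w)) 1 _ (ih x y)
      refine ⟨- ((rdeg (.cons a (.cons b w)) + 1).negOnePow • Γ.K x _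
        (rdeg (.cons a (.cons b w)) + 1 + 1) _ (f - g)), ?_⟩
      rw [TotalAlg.liftAux, hf, hg, map_neg, ← Γ.totK_incl _ _ (by omega), map_sub, map_sub,
        map_sub]
      rfl

/-- The sign of a word is the parity of its reduced degree, and the lift has degree one more, so the
reduced parities agree. -/
theorem τ_lift {x y : 𝒜.Ob} (w : Word (Letter 𝒜.Hom) x y) :
    𝒟.totτ Γ.r x y (Γ.lift x y w) = 𝒜.letterOps.sign w • Γ.lift x y w := by
  have h : ∀ {x y : 𝒜.Ob} (w : Word (Letter 𝒜.Hom) x y),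
      𝒜.letterOps.sign w = (rdeg w).negOnePow := by
    intro x y w
    induction w with
    | nil => rfl
    | cons a w ih =>
      rw [LetterOps.sign, rdeg, Int.negOnePow_add, ih]
      rfl
  obtain ⟨f, hf⟩ := Γ.homog_lift w
  rw [hf, DGCat.totτ_incl, h]
  simp

theorem isMultilinear_lift (x y : 𝒜.Ob) : IsMultilinear k (Γ.lift x y) := by
  intro s t l p e a b r
  have := isMultilinear_liftAux 𝒜 (𝒟.total Γ.r) (fun {x y z} e a b => by
      change 𝒟.totM₂ Γ.r x y z (e • a) b = e • 𝒟.totM₂ Γ.r x y z a b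
      simp) (fun {x y z} e a b => by
      change 𝒟.totM₂ Γ.r x y z a (e • b) = e • 𝒟.totM₂ Γ.r x y z a b
      simp) (fun {x y} => Γ.totS x y) (fun {x y} => Γ.totK x y)
    (l.append (.cons (letter p a) r)).length x y l p e a b r
  simpa only [lift, TotalAlg.lift, Word.length_append, Word.length] using this

theorem lift_rel {x y : 𝒜.Ob} (w : Word (Letter 𝒜.Hom) x y) :
    𝒟.totM₁ Γ.r x y (Γ.lift x y w) + (𝒟.total Γ.r).star Γ.lift (Γ.lift x) w =
      𝒜.letterOps.barD (Γ.lift x y) w + 𝒜.letterOps.barM (Γ.lift x y) w := by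
  refine TotalAlg.lift_rel 𝒜.letterOps (𝒟.total Γ.r) (𝒜.total id)
    (fun a => Γ.totS _ _ a.1 a.2) (fun {x y} => (Γ.totK x y).toAddMonoidHom)
    (fun {x y} => (Γ.totP x y).toAddMonoidHom) ?_ Γ.totP_m₂ ?_ ?_ Γ.totK_homotopy
    Γ.τ_lift (fun x y => DGCat.compatible_of_isMultilinear (Γ.isMultilinear_lift x y)) w
  · rintro x y ⟨p, f⟩
    change 𝒟.totM₁ Γ.r x y (𝒟.incl Γ.r p (Γ.s x y p f)) =
      𝒟.incl Γ.r (p + 1) (Γ.s x y (p + 1) (p.negOnePow • 𝒜.d x y p (p + 1) f))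
    rw [𝒟.totM₁_incl Γ.r p _ rfl, DGCat.map_sign (Γ.s x y _), Γ.s_d]
  · rintro x y z ⟨p, f⟩ ⟨q, g⟩
    change 𝒜.totM₂ id x y z (Γ.totP x y (𝒟.incl Γ.r p (Γ.s x y p f)))
      (Γ.totP y z (𝒟.incl Γ.r q (Γ.s y z q g))) =
      Γ.totP x z (𝒟.incl Γ.r (p + q) (Γ.s x z (p + q) (p.negOnePow • 𝒜.comp rfl f g)))
    rw [totP_incl, totP_incl, totP_incl, Γ.p_s, Γ.p_s, Γ.p_s, 𝒜.totM₂_incl id p q _ rfl]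
  · intro x y t
    change Γ.totP x y (Γ.totK x y t) = 0
    induction t using DGCat.tot_induction with
    | h0 => simp
    | h2 t t' h h' => rw [map_add, map_add, h, h', add_zero]
    | h1 n f => rw [Γ.totK_incl n _ rfl, totP_incl, DGCat.map_sign, Γ.p_K, smul_zero, map_zero]

end Contraction
end DGRec

/-! ### The `A_∞`-functor of a contraction, and quasi-isomorphisms in terms of cocycles -/

namespace DGRec

namespace Contraction

variable {k : Type w} [CommRing k] {𝒜 𝒟 ℬ : DGCat.{u, v} k} (Γ : Contraction 𝒜 𝒟)
  (π : DGFunctor 𝒟 ℬ)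

/-- The component of degree `n` of an element of a total space, mapped to `ℬ`. -/
def totMap (x y : 𝒜.Ob) (n : ℤ) :
    𝒟.Tot Γ.r x y →ₗ[k] ℬ.Hom (π.obj (Γ.r x)) (π.obj (Γ.r y)) n :=
  π.map (Γ.r x) (Γ.r y) n ∘ₗ DirectSum.component k ℤ (fun n => 𝒟.Hom (Γ.r x) (Γ.r y) n) n

theorem totMap_incl {x y : 𝒜.Ob} (n : ℤ) (f : 𝒟.Hom (Γ.r x) (Γ.r y) n) :
    Γ.totMap π x y n (𝒟.incl Γ.r n f) = π.map _ _ n f := by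
  simp only [totMap, LinearMap.comp_apply]
  rw [DirectSum.component.lof_self]

theorem totMap_incl_of_ne {x y : 𝒜.Ob} (n m : ℤ) (h : n ≠ m) (f : 𝒟.Hom (Γ.r x) (Γ.r y) n) :
    Γ.totMap π x y m (𝒟.incl Γ.r n f) = 0 := by
  simp only [totMap, LinearMap.comp_apply]
  rw [DirectSum.component.of, dif_neg h, map_zero]

theorem op_single_totMap {x y : 𝒜.Ob} (p n : ℤ) (t : 𝒟.Tot Γ.r x y) (ht : 𝒟.Homog Γ.r p t) :
    ℬ.op (.single (letter p (Γ.totMap π x y p t))) n =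
      Γ.totMap π x y n (𝒟.totM₁ Γ.r x y t) := by
  obtain ⟨f, rfl⟩ := ht
  rw [Word.single, ℬ.op_single, totMap_incl]
  by_cases h : p + 1 = n
  · rw [𝒟.totM₁_incl Γ.r p n h, totMap_incl, DGCat.map_sign, π.map_d]
  · rw [𝒟.totM₁_incl Γ.r p _ rfl, totMap_incl_of_ne _ _ _ _ h, ℬ.d_shape _ _ _ _ h]
    simp

theorem op_pair_totMap {x y z : 𝒜.Ob} (p q n : ℤ) (t : 𝒟.Tot Γ.r x y) (ht : 𝒟.Homog Γ.r p t)
    (t' : 𝒟.Tot Γ.r y z) (ht' : 𝒟.Homog Γ.r q t') :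
    ℬ.op (.cons (letter p (Γ.totMap π x y p t)) (.single (letter q (Γ.totMap π y z q t')))) n =
      Γ.totMap π x z n ((𝒟.total Γ.r).m₂ t t') := by
  obtain ⟨f, rfl⟩ := ht
  obtain ⟨g, rfl⟩ := ht'
  change _ = Γ.totMap π x z n (𝒟.totM₂ Γ.r x y z (𝒟.incl Γ.r p f) (𝒟.incl Γ.r q g))
  rw [Word.single, totMap_incl, totMap_incl]
  by_cases h : p + q = n
  · rw [𝒟.totM₂_incl Γ.r p q n h, totMap_incl, DGCat.map_sign, π.map_comp, ℬ.op_pair h]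
  · rw [𝒟.totM₂_incl Γ.r p q _ rfl, totMap_incl_of_ne _ _ _ _ h,
      ℬ.op_shape _ _ (by simp only [rdeg]; omega)]

/-- The image under `π` of `lift_rel`. A DG-functor commutes strictly with `m₁` and `m₂`, the only
operations of `ℬ`. -/
theorem blocks_totMap {x y : 𝒜.Ob} (w : Word (Letter 𝒜.Hom) x y) (n : ℤ) :
    (w.blocks.map (fun c => ℬ.op (mapBlocks (fun x => π.obj (Γ.r x))
      (fun {x y} (w : Word (Letter 𝒜.Hom) x y) n => Γ.totMap π x y n (Γ.lift x y w)) c) n)).sum =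
      (w.cuts.map (fun c => (rdeg c.left).negOnePow •
        Γ.totMap π x y n (Γ.lift x y (c.left.append
          (.cons (letter (rdeg c.mid + 2) (𝒜.op c.mid (rdeg c.mid + 2))) c.right))))).sum := by
  rw [𝒜.sum_cuts_op ((Γ.isMultilinear_lift x y).map (Γ.totMap π x y n)) w]
  have h1 : 𝒜.letterOps.barD (fun v => Γ.totMap π x y n (Γ.lift x y v)) w =
      Γ.totMap π x y n (𝒜.letterOps.barD (Γ.lift x y) w) :=
    LetterOps.barD_map _ (Γ.totMap π x y n).toAddMonoidHom _ w
  have h2 : 𝒜.letterOps.barM (fun v => Γ.totMap π x y n (Γ.lift x y v)) w =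
      Γ.totMap π x y n (𝒜.letterOps.barM (Γ.lift x y) w) :=
    LetterOps.barM_map _ (Γ.totMap π x y n).toAddMonoidHom _ w
  rw [h1, h2, ← map_add, ← lift_rel, map_add]
  cases w with
  | nil =>
    change (List.map _ [_]).sum = Γ.totMap π x x n (𝒟.totM₁ Γ.r x x 0) +
      Γ.totMap π x x n 0
    simp only [List.map_cons, List.map_nil, List.sum_cons, List.sum_nil, map_zero, add_zero]
    rfl
  | @cons x z y a w =>
    rw [Word.sum_blocks]
    · congr 1
      · exact Γ.op_single_totMap π _ n _ (Γ.homog_lift (.cons a w))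
      · rw [TotalAlg.star_eq_sum, map_list_sum, List.map_map]
        congr 1
        refine List.map_congr_left fun c _ => ?_
        exact Γ.op_pair_totMap π _ _ n _ (Γ.homog_lift c.2.1) _ (Γ.homog_lift c.2.2)
    · intro s t q u v v' c
      rfl
    · intro u
      have := Γ.op_pair_totMap π _ _ n _ (Γ.homog_lift u) _ (Γ.homog_lift (.nil y))
      refine this.trans ?_
      change Γ.totMap π _ _ n (𝒟.totM₂ Γ.r _ _ _ (Γ.lift _ _ u) 0) = 0
      rw [map_zero, map_zero]

theorem totMap_lift_shape {x y : 𝒜.Ob} (w : Word (Letter 𝒜.Hom) x y) (n : ℤ)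
    (h : rdeg w + 1 ≠ n) : Γ.totMap π x y n (Γ.lift x y w) = 0 := by
  obtain ⟨f, hf⟩ := Γ.homog_lift w
  rw [hf, totMap_incl_of_ne _ _ _ _ h]

theorem isMultilinear_totMap_lift (x y : 𝒜.Ob) (n : ℤ) :
    IsMultilinear k (fun w => Γ.totMap π x y n (Γ.lift x y w)) :=
  (Γ.isMultilinear_lift x y).map (Γ.totMap π x y n)

theorem totMap_lift_add {x y z t : 𝒜.Ob} (l : Word (Letter 𝒜.Hom) x y) (p : ℤ)
    (a b : 𝒜.Hom y z p) (r : Word (Letter 𝒜.Hom) z t) (n : ℤ) :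
    Γ.totMap π x t n (Γ.lift x t (l.append (.cons (letter p (a + b)) r))) =
      Γ.totMap π x t n (Γ.lift x t (l.append (.cons (letter p a) r))) +
        Γ.totMap π x t n (Γ.lift x t (l.append (.cons (letter p b) r))) :=
  ((Γ.isMultilinear_totMap_lift π x t n).toLinear l p r).map_add a b

theorem totMap_lift_smul {x y z t : 𝒜.Ob} (l : Word (Letter 𝒜.Hom) x y) (p : ℤ) (c : k)
    (a : 𝒜.Hom y z p) (r : Word (Letter 𝒜.Hom) z t) (n : ℤ) :
    Γ.totMap π x t n (Γ.lift x t (l.append (.cons (letter p (c • a)) r))) =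
      c • Γ.totMap π x t n (Γ.lift x t (l.append (.cons (letter p a) r))) :=
  ((Γ.isMultilinear_totMap_lift π x t n).toLinear l p r).map_smul c a

/-- The `A_∞`-functor obtained by lifting along a contraction and applying a DG-functor. -/
def aInfFunctor : AInfFunctor 𝒜.toAInf ℬ.toAInf where
  obj x := π.obj (Γ.r x)
  F {x y} w n := Γ.totMap π x y n (Γ.lift x y w)
  F_nil x n := (Γ.totMap π x x n).map_zero
  F_shape := Γ.totMap_lift_shape π
  F_add := Γ.totMap_lift_add π
  F_smul := Γ.totMap_lift_smul π
  rel := Γ.blocks_totMap π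

theorem aInfFunctor_F₁ (x y : 𝒜.Ob) (n : ℤ) (a : 𝒜.Hom x y n) :
    (Γ.aInfFunctor π).F₁ x y n a = π.map _ _ n (Γ.s x y n a) :=
  Γ.totMap_incl π n (Γ.s x y n a)

end Contraction

/-- A family of linear maps of morphism complexes which is a quasi-isomorphism, in terms of
cocycles and coboundaries. -/
structure IsQis {k : Type w} [CommRing k] (𝒞 : DGCat.{u, v} k) (𝒟 : DGCat.{u', v} k) (x y : 𝒞.Ob) (x' y' : 𝒟.Ob)
    (f : ∀ n, 𝒞.Hom x y n →ₗ[k] 𝒟.Hom x' y' n) (n : ℤ) : Prop where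
  inj : ∀ a, 𝒞.d x y n (n + 1) a = 0 → (∃ b, f n a = 𝒟.d x' y' (n - 1) n b) →
    ∃ b, a = 𝒞.d x y (n - 1) n b
  surj : ∀ c, 𝒟.d x' y' n (n + 1) c = 0 →
    ∃ a b, 𝒞.d x y n (n + 1) a = 0 ∧ c = f n a + 𝒟.d x' y' (n - 1) n b

theorem AInfFunctor.isQuasiIso_of_m₁ {k : Type w} [CommRing k] {𝒜 ℬ : AInfCat.{u, v} k}
    (Φ : AInfFunctor 𝒜 ℬ) (hobj : Function.Bijective Φ.obj)
    (hinj : ∀ (x y : 𝒜.Ob) (n : ℤ) (a : 𝒜.Hom x y n), 𝒜.m₁ x y n (n + 1) a = 0 →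
      (∃ b, Φ.F₁ x y n a = ℬ.m₁ _ _ (n - 1) n b) → ∃ b, a = 𝒜.m₁ x y (n - 1) n b)
    (hsurj : ∀ (x y : 𝒜.Ob) (n : ℤ) (c : ℬ.Hom (Φ.obj x) (Φ.obj y) n),
      ℬ.m₁ _ _ n (n + 1) c = 0 →
      ∃ a b, 𝒜.m₁ x y n (n + 1) a = 0 ∧ c = Φ.F₁ x y n a + ℬ.m₁ _ _ (n - 1) n b) :
    Φ.IsQuasiIso := by
  refine ⟨hobj, fun x y n => ⟨?_, ?_⟩⟩
  · rw [injective_iff_map_eq_zero]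
    intro t ht
    obtain ⟨⟨a, ha⟩, rfl⟩ := Submodule.mkQ_surjective _ t
    rw [AInfFunctor.mapH, Submodule.mkQ_apply, Submodule.mapQ_apply,
      Submodule.Quotient.mk_eq_zero] at ht
    obtain ⟨b, hb⟩ := ht
    obtain ⟨c, hc⟩ := hinj x y n a ha ⟨b, hb.symm⟩
    rw [Submodule.mkQ_apply, Submodule.Quotient.mk_eq_zero]
    exact ⟨c, hc.symm⟩
  · intro t
    obtain ⟨⟨c, hc⟩, rfl⟩ := Submodule.mkQ_surjective _ t
    obtain ⟨a, b, ha, hab⟩ := hsurj x y n c hc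
    refine ⟨Submodule.Quotient.mk ⟨a, ha⟩, ?_⟩
    rw [AInfFunctor.mapH, Submodule.mkQ_apply, Submodule.mapQ_apply, eq_comm,
      Submodule.Quotient.eq]
    exact ⟨b, (sub_eq_of_eq_add' hab).symm⟩

theorem sign_smul_eq_zero {N : Type*} [AddCommGroup N] (e : ℤˣ) (x : N) : e • x = 0 ↔ x = 0 :=
  smul_eq_zero_iff_eq e

theorem map_sign_sign {k : Type w} [CommRing k] {N N' : Type*} [AddCommGroup N] [AddCommGroup N']
    [Module k N] [Module k N'] (f : N →ₗ[k] N') (e : ℤˣ) (x : N) : e • f (e • x) = f x := by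
  rw [DGCat.map_sign, LetterOps.sign_sign]

theorem DGCat.m₁_eq_zero_iff {k : Type w} [CommRing k] (𝒞 : DGCat.{u, v} k) (x y : 𝒞.Ob) (p q : ℤ)
    (a : 𝒞.Hom x y p) : 𝒞.toAInf.m₁ x y p q a = (0 : 𝒞.Hom x y q) ↔ 𝒞.d x y p q a = 0 :=
  sign_smul_eq_zero p.negOnePow (𝒞.d x y p q a)

theorem DGCat.exists_m₁_iff {k : Type w} [CommRing k] (𝒞 : DGCat.{u, v} k) (x y : 𝒞.Ob) (p q : ℤ)
    (c : 𝒞.Hom x y q) : (∃ b, c = 𝒞.toAInf.m₁ x y p q b) ↔ ∃ b, c = 𝒞.d x y p q b := by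
  constructor
  · rintro ⟨b, hb⟩
    let b' : 𝒞.Hom x y p := b
    exact ⟨p.negOnePow • b', hb.trans (DGCat.map_sign (𝒞.d x y p q) _ _).symm⟩
  · rintro ⟨b, hb⟩
    exact ⟨(p.negOnePow • b : 𝒞.Hom x y p), hb.trans (map_sign_sign (𝒞.d x y p q) _ _).symm⟩

theorem isQuasiIso_of_isQis {k : Type w} [CommRing k] {𝒜 ℬ : DGCat.{u, v} k}
    (Φ : AInfFunctor 𝒜.toAInf ℬ.toAInf) (hobj : Function.Bijective Φ.obj)
    (h : ∀ (x y : 𝒜.Ob) (n : ℤ), IsQis 𝒜 ℬ x y (Φ.obj x) (Φ.obj y) (Φ.F₁ x y) n) :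
    Φ.IsQuasiIso := by
  refine Φ.isQuasiIso_of_m₁ hobj (fun x y n a ha hb => ?_) (fun x y n c hc => ?_)
  · exact (𝒜.exists_m₁_iff x y _ _ _).2 ((h x y n).inj a ((𝒜.m₁_eq_zero_iff x y _ _ a).1 ha)
      ((ℬ.exists_m₁_iff _ _ _ _ _).1 hb))
  · obtain ⟨a, b, ha, hab⟩ := (h x y n).surj c ((ℬ.m₁_eq_zero_iff _ _ _ _ c).1 hc)
    obtain ⟨b', hb'⟩ := (ℬ.exists_m₁_iff (Φ.obj x) (Φ.obj y) (n - 1) n _).2 ⟨b, rfl⟩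
    exact ⟨a, b', (𝒜.m₁_eq_zero_iff x y _ _ a).2 ha, hab.trans (congrArg _ hb')⟩

end DGRec

namespace DGRec

/-! ### Contractions of surjective quasi-isomorphisms over a field -/

/-- The kernel of `p` is acyclic, hence contracted over a field by some `κ`. A linear section `σ`
becomes a chain map `s` after subtracting `κ (dσ - σd)`, and `κ (1 - s p)` is the required homotopy.
-/
theorem exists_contraction_of_surjective {k : Type w} [Field k] {C D : ℤ → Type v}
    [∀ n, AddCommGroup (C n)] [∀ n, Module k (C n)] [∀ n, AddCommGroup (D n)]
    [∀ n, Module k (D n)] (dC : ∀ n m, C n →ₗ[k] C m) (dD : ∀ n m, D n →ₗ[k] D m)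
    (dC_shape : ∀ n m, n + 1 ≠ m → dC n m = 0) (dD_shape : ∀ n m, n + 1 ≠ m → dD n m = 0)
    (dC_dC : ∀ n m l a, dC m l (dC n m a) = 0) (dD_dD : ∀ n m l a, dD m l (dD n m a) = 0)
    (p : ∀ n, D n →ₗ[k] C n) (p_d : ∀ n m a, p m (dD n m a) = dC n m (p n a))
    (hp : ∀ n, Function.Surjective (p n))
    (inj : ∀ n a, dD n (n + 1) a = 0 → (∃ b, p n a = dC (n - 1) n b) →
      ∃ b, a = dD (n - 1) n b)
    (surj : ∀ n c, dC n (n + 1) c = 0 →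
      ∃ a b, dD n (n + 1) a = 0 ∧ c = p n a + dC (n - 1) n b) :
    ∃ (s : ∀ n, C n →ₗ[k] D n) (K : ∀ n m, D n →ₗ[k] D m),
      (∀ n m a, s m (dC n m a) = dD n m (s n a)) ∧ (∀ n a, p n (s n a) = a) ∧
      (∀ n m a, p m (K n m a) = 0) ∧
      ∀ n a, dD (n - 1) n (K n (n - 1) a) + K (n + 1) n (dD n (n + 1) a) = a - s n (p n a) := by
  -- A primitive `b` of `a` need not lie in the kernel of `p`, but `p b` is a cocycle. Hence it
  -- lifts up to a coboundary, and the lift is subtracted from `b`.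
  have acyclic : ∀ n a, dD n (n + 1) a = 0 → p n a = 0 →
      ∃ b, p (n - 1) b = 0 ∧ dD (n - 1) n b = a := by
    intro n a ha hpa
    obtain ⟨b, rfl⟩ := inj n a ha ⟨0, by rw [hpa, map_zero]⟩
    have hb : dC (n - 1) (n - 1 + 1) (p (n - 1) b) = 0 := by
      rw [show n - 1 + 1 = n by omega, ← p_d, hpa]
    obtain ⟨a', c, ha', hc⟩ := surj (n - 1) _ hb
    obtain ⟨c', rfl⟩ := hp _ c
    refine ⟨b - a' - dD _ _ c', ?_, ?_⟩
    · rw [map_sub, map_sub, hc, p_d]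
      abel
    · rw [show n - 1 + 1 = n by omega] at ha'
      rw [map_sub, map_sub, ha', dD_dD]
      simp
  -- A linear right inverse of `d` on the cocycles of the kernel, extended arbitrarily to the whole
  -- of `D n`.
  have hG : ∀ n m, ∃ G : D n →ₗ[k] D m, (m + 1 ≠ n → G = 0) ∧ (m + 1 = n → ∀ a,
      dD n (n + 1) a = 0 → p n a = 0 → p m (G a) = 0 ∧ dD m n (G a) = a) := by
    intro n m
    by_cases h : m + 1 = n
    · obtain rfl : m = n - 1 := by omega
      let Z : Submodule k (D n) := LinearMap.ker (dD n (n + 1)) ⊓ LinearMap.ker (p n)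
      let f : LinearMap.ker (p (n - 1)) →ₗ[k] Z :=
        ((dD (n - 1) n).domRestrict _).codRestrict Z (by
          rintro ⟨b, hb⟩
          refine ⟨dD_dD _ _ _ _, ?_⟩
          change p n (dD _ _ b) = 0
          rw [p_d, LinearMap.mem_ker.1 hb, map_zero])
      have hf : Function.Surjective f := by
        rintro ⟨a, ha, hpa⟩
        obtain ⟨b, hb, hba⟩ := acyclic n a ha hpa
        exact ⟨⟨b, hb⟩, Subtype.ext hba⟩
      obtain ⟨g, hg⟩ := f.exists_rightInverse_of_surjective (LinearMap.range_eq_top.2 hf)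
      obtain ⟨G, hG⟩ := ((LinearMap.ker (p (n - 1))).subtype ∘ₗ g).exists_extend
      refine ⟨G, fun h' => absurd h h', fun _ a ha hpa => ?_⟩
      have e : G a = g ⟨a, ha, hpa⟩ := LinearMap.congr_fun hG ⟨a, ha, hpa⟩
      rw [e]
      exact ⟨(g ⟨a, ha, hpa⟩).2, congrArg Subtype.val (LinearMap.congr_fun hg ⟨a, ha, hpa⟩)⟩
    · exact ⟨0, fun _ => rfl, fun h' => absurd h' h⟩
  choose G hG0 hG1 using hG
  have hσ := fun n => (p n).exists_rightInverse_of_surjective (LinearMap.range_eq_top.2 (hp n))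
  choose σ hσ using hσ
  have hσ' : ∀ n a, p n (σ n a) = a := fun n a => LinearMap.congr_fun (hσ n) a
  -- For `a` in the kernel of `p`, the difference `a - G (d a)` is a cocycle of that kernel, where
  -- `G` does invert `d`.
  let κ : ∀ n m, D n →ₗ[k] D m := fun n m =>
    G n m ∘ₗ (LinearMap.id - G (n + 1) n ∘ₗ dD n (n + 1))
  have κ_apply : ∀ n m a, κ n m a = G n m (a - G (n + 1) n (dD n (n + 1) a)) := fun _ _ _ => rfl
  have hκ0 : ∀ n a, p n a = 0 → p n (a - G (n + 1) n (dD n (n + 1) a)) = 0 ∧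
      dD n (n + 1) (a - G (n + 1) n (dD n (n + 1) a)) = 0 := by
    intro n a ha
    have := hG1 (n + 1) n rfl (dD n (n + 1) a) (dD_dD _ _ _ _) (by rw [p_d, ha, map_zero])
    rw [map_sub, map_sub, ha, this.1, this.2]
    simp
  have pκ : ∀ n m a, p n a = 0 → p m (κ n m a) = 0 := by
    intro n m a ha
    rw [κ_apply]
    by_cases h : m + 1 = n
    · exact (hG1 n m h _ (hκ0 n a ha).2 (hκ0 n a ha).1).1
    · rw [hG0 n m h]
      simp
  have hκ : ∀ n a, p n a = 0 →
      dD (n - 1) n (κ n (n - 1) a) + κ (n + 1) n (dD n (n + 1) a) = a := by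
    intro n a ha
    rw [κ_apply, κ_apply, (hG1 n (n - 1) (by omega) _ (hκ0 n a ha).2 (hκ0 n a ha).1).2, dD_dD]
    simp
  let s : ∀ n, C n →ₗ[k] D n := fun n =>
    σ n - κ (n + 1) n ∘ₗ (dD n (n + 1) ∘ₗ σ n - σ (n + 1) ∘ₗ dC n (n + 1))
  have s_apply : ∀ n a, s n a = σ n a -
      κ (n + 1) n (dD n (n + 1) (σ n a) - σ (n + 1) (dC n (n + 1) a)) := fun _ _ => rfl
  have hu : ∀ n a, p (n + 1) (dD n (n + 1) (σ n a) - σ (n + 1) (dC n (n + 1) a)) = 0 := by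
    intro n a
    rw [map_sub, p_d, hσ', hσ', sub_self]
  have ps : ∀ n a, p n (s n a) = a := by
    intro n a
    rw [s_apply, map_sub, hσ', pκ _ _ _ (hu n a), sub_zero]
  have sd : ∀ n m a, s m (dC n m a) = dD n m (s n a) := by
    intro n m a
    by_cases h : n + 1 = m
    · subst h
      have h1 := hκ (n + 1) _ (hu n a)
      rw [show n + 1 - 1 = n by omega] at h1
      rw [s_apply, s_apply, map_sub (dD n (n + 1)), dC_dC, map_zero, sub_zero,
        eq_sub_of_add_eq h1, map_sub (dD (n + 1) (n + 1 + 1)), dD_dD, zero_sub, map_neg]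
      abel
    · rw [dC_shape n m h, dD_shape n m h]
      simp
  have hv : ∀ n a, p n (a - s n (p n a)) = 0 := by
    intro n a
    rw [map_sub, ps, sub_self]
  refine ⟨s, fun n m => κ n m ∘ₗ (LinearMap.id - s n ∘ₗ p n), sd, ps,
    fun n m a => pκ n m _ (hv n a), fun n a => ?_⟩
  have h1 := hκ n _ (hv n a)
  rw [map_sub (dD n (n + 1)), ← sd, ← p_d] at h1
  exact h1

theorem exists_contraction {k : Type w} [Field k] (𝒜 𝒟 : DGCat.{u, v} k)
    (r : 𝒜.Ob → 𝒟.Ob) (p : ∀ (x y : 𝒜.Ob) (n : ℤ), 𝒟.Hom (r x) (r y) n →ₗ[k] 𝒜.Hom x y n)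
    (p_d : ∀ (x y : 𝒜.Ob) (n m : ℤ) (f : 𝒟.Hom (r x) (r y) n),
      p x y m (𝒟.d _ _ n m f) = 𝒜.d x y n m (p x y n f))
    (p_comp : ∀ {x y z : 𝒜.Ob} {a b n : ℤ} (h : a + b = n) (f : 𝒟.Hom (r x) (r y) a)
      (g : 𝒟.Hom (r y) (r z) b), p x z n (𝒟.comp h f g) = 𝒜.comp h (p x y a f) (p y z b g))
    (hp : ∀ x y n, Function.Surjective (p x y n))
    (hq : ∀ x y n, IsQis 𝒟 𝒜 (r x) (r y) x y (p x y) n) :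
    ∃ Γ : Contraction 𝒜 𝒟, Γ.r = r ∧
      ∀ x y n, IsQis 𝒟 𝒜 (Γ.r x) (Γ.r y) x y (Γ.p x y) n := by
  have := fun x y => exists_contraction_of_surjective (𝒜.d x y) (𝒟.d (r x) (r y))
    (𝒜.d_shape x y) (𝒟.d_shape _ _) (𝒜.d_d x y) (𝒟.d_d _ _) (p x y) (p_d x y) (hp x y)
    (fun n => (hq x y n).inj) (fun n => (hq x y n).surj)
  choose s K h1 h2 h3 h4 using this
  exact ⟨⟨r, p, p_d, p_comp, s, h1, h2, K, h3, h4⟩, rfl, hq⟩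

/-! ### Composites and sections of quasi-isomorphisms -/

namespace IsQis

universe u''

variable {k : Type w} [CommRing k] {𝒞 : DGCat.{u, v} k} {𝒟 : DGCat.{u', v} k}
  {ℰ : DGCat.{u'', v} k} {x y : 𝒞.Ob} {x' y' : 𝒟.Ob}
  {x'' y'' : ℰ.Ob} {f : ∀ n, 𝒞.Hom x y n →ₗ[k] 𝒟.Hom x' y' n}
  {g : ∀ n, 𝒟.Hom x' y' n →ₗ[k] ℰ.Hom x'' y'' n} {n : ℤ}

theorem comp (hf : IsQis 𝒞 𝒟 x y x' y' f n) (hg : IsQis 𝒟 ℰ x' y' x'' y'' g n)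
    (f_d : ∀ n m a, f m (𝒞.d x y n m a) = 𝒟.d _ _ n m (f n a))
    (g_d : ∀ n m a, g m (𝒟.d _ _ n m a) = ℰ.d _ _ n m (g n a)) :
    IsQis 𝒞 ℰ x y x'' y'' (fun n => g n ∘ₗ f n) n where
  inj a ha hb := hf.inj a ha (hg.inj _ (by rw [← f_d, ha, map_zero]) hb)
  surj c hc := by
    obtain ⟨a, b, ha, rfl⟩ := hg.surj c hc
    obtain ⟨a', b', ha', rfl⟩ := hf.surj a ha
    refine ⟨a', g _ b' + b, ha', ?_⟩
    rw [map_add, map_add, g_d, LinearMap.comp_apply]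
    abel

theorem of_section (hg : IsQis 𝒟 ℰ x' y' x'' y'' g n)
    {s : ∀ n, ℰ.Hom x'' y'' n →ₗ[k] 𝒟.Hom x' y' n}
    (s_d : ∀ n m a, s m (ℰ.d _ _ n m a) = 𝒟.d _ _ n m (s n a))
    (g_d : ∀ n m a, g m (𝒟.d _ _ n m a) = ℰ.d _ _ n m (g n a))
    (hs : ∀ n a, g n (s n a) = a) : IsQis ℰ 𝒟 x'' y'' x' y' s n where
  inj a _ hb := by
    obtain ⟨b, hb⟩ := hb
    exact ⟨g _ b, by rw [← g_d, ← hb, hs]⟩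
  surj c hc := by
    have h0 : 𝒟.d x' y' n (n + 1) (c - s n (g n c)) = 0 := by
      rw [map_sub, ← s_d, ← g_d, hc, map_zero, map_zero, sub_zero]
    obtain ⟨b, hb⟩ := hg.inj (c - s n (g n c)) h0 ⟨0, by rw [map_sub, hs, sub_self, map_zero]⟩
    exact ⟨g n c, b, by rw [← g_d, hc, map_zero], by rw [← hb]; abel⟩

end IsQis

end DGRec

namespace DGRec

/-! ### Gluing DG-categories along a bimodule -/

/-- Two DG-categories over a third one, with a closed morphism of degree `0` from each object of
the first one to an object of the second one. -/
structure GlueData {k : Type w} [CommRing k] (𝒞 𝒟 : DGCat.{u, v} k) (ℳ : DGCat.{u', v} k) where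
  P : DGFunctor 𝒞 ℳ
  P' : DGFunctor 𝒟 ℳ
  r : 𝒞.Ob → 𝒟.Ob
  α : ∀ x : 𝒞.Ob, ℳ.Hom (P.obj x) (P'.obj (r x)) 0
  α_d : ∀ x, ℳ.d _ _ 0 1 (α x) = 0

namespace GlueData

variable {k : Type w} [CommRing k] {𝒞 𝒟 : DGCat.{u, v} k} {ℳ : DGCat.{u', v} k} (G : GlueData 𝒞 𝒟 ℳ)

/-- The map `f ↦ α ∘ P(f)`, zero unless `p = q`. -/
def post (x y : 𝒞.Ob) (p q : ℤ) :
    𝒞.Hom x y p →ₗ[k] ℳ.Hom (G.P.obj x) (G.P'.obj (G.r y)) q :=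
  if h : p + 0 = q then (ℳ.comp h).flip (G.α y) ∘ₗ G.P.map x y p else 0

/-- The map `g ↦ P'(g) ∘ α`, zero unless `p = q`. -/
def pre (x y : 𝒞.Ob) (p q : ℤ) :
    𝒟.Hom (G.r x) (G.r y) p →ₗ[k] ℳ.Hom (G.P.obj x) (G.P'.obj (G.r y)) q :=
  if h : 0 + p = q then ℳ.comp h (G.α x) ∘ₗ G.P'.map (G.r x) (G.r y) p else 0

variable {x y : 𝒞.Ob} {p q : ℤ}

theorem post_apply (h : p + 0 = q) (f : 𝒞.Hom x y p) :
    G.post x y p q f = ℳ.comp h (G.P.map x y p f) (G.α y) := by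
  rw [post, dif_pos h]
  rfl

theorem pre_apply (h : 0 + p = q) (g : 𝒟.Hom (G.r x) (G.r y) p) :
    G.pre x y p q g = ℳ.comp h (G.α x) (G.P'.map _ _ p g) := by
  rw [pre, dif_pos h]
  rfl

theorem post_shape (h : p ≠ q) : G.post x y p q = 0 := by
  rw [post, dif_neg (by omega)]

theorem pre_shape (h : p ≠ q) : G.pre x y p q = 0 := by
  rw [pre, dif_neg (by omega)]

theorem post_d (p' q' : ℤ) (hp : p + 1 = p') (hq : q + 1 = q') (f : 𝒞.Hom x y p) :
    ℳ.d _ _ q q' (G.post x y p q f) = G.post x y p' q' (𝒞.d x y p p' f) := by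
  by_cases h : p = q
  · rw [G.post_apply (show p + 0 = q by omega), G.post_apply (show p' + 0 = q' by omega),
      ℳ.leibniz (p' := p') (q' := 1) _ hp (by norm_num) hq (by omega) (by omega), G.α_d, map_zero,
      G.P.map_d]
    simp
  · rw [G.post_shape h, G.post_shape (by omega)]
    simp

theorem pre_d (p' q' : ℤ) (hp : p + 1 = p') (hq : q + 1 = q')
    (g : 𝒟.Hom (G.r x) (G.r y) p) :
    ℳ.d _ _ q q' (G.pre x y p q g) = G.pre x y p' q' (𝒟.d _ _ p p' g) := by
  by_cases h : p = q
  · rw [G.pre_apply (show 0 + p = q by omega), G.pre_apply (show 0 + p' = q' by omega),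
      ℳ.leibniz (p' := 1) (q' := p') _ (by norm_num) hp hq (by omega) (by omega), G.α_d, map_zero,
      G.P'.map_d]
    simp
  · rw [G.pre_shape h, G.pre_shape (by omega)]
    simp

/-- The glued DG-category. Its morphisms are triples consisting of a morphism `f` of `𝒞`, a
morphism `g` of `𝒟` and a homotopy from `α ∘ P(f)` to `P'(g) ∘ α`. -/
def glue : DGCat.{u, v} k where
  Ob := 𝒞.Ob
  Hom x y n := 𝒞.Hom x y n × 𝒟.Hom (G.r x) (G.r y) n ×
    ℳ.Hom (G.P.obj x) (G.P'.obj (G.r y)) (n - 1)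
  d x y p q := LinearMap.prod (𝒞.d x y p q ∘ₗ LinearMap.fst _ _ _)
    (LinearMap.prod (𝒟.d _ _ p q ∘ₗ LinearMap.fst _ _ _ ∘ₗ LinearMap.snd _ _ _)
      (G.post x y p (q - 1) ∘ₗ LinearMap.fst _ _ _ -
        G.pre x y p (q - 1) ∘ₗ LinearMap.fst _ _ _ ∘ₗ LinearMap.snd _ _ _ -
        ℳ.d _ _ (p - 1) (q - 1) ∘ₗ LinearMap.snd _ _ _ ∘ₗ LinearMap.snd _ _ _))
  d_shape x y p q h := by
    rw [𝒞.d_shape _ _ p q h, 𝒟.d_shape _ _ p q h, ℳ.d_shape _ _ (p - 1) (q - 1) (by omega),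
      G.post_shape (by omega), G.pre_shape (by omega)]
    ext <;> simp
  d_d x y p q r f := by
    by_cases h : p + 1 = q
    · by_cases h' : q + 1 = r
      · refine Prod.ext (𝒞.d_d _ _ _ _ _ _) (Prod.ext (𝒟.d_d _ _ _ _ _ _) ?_)
        change G.post x y q (r - 1) (𝒞.d _ _ p q f.1) - G.pre x y q (r - 1) (𝒟.d _ _ p q f.2.1) -
          ℳ.d _ _ (q - 1) (r - 1) (G.post x y p (q - 1) f.1 - G.pre x y p (q - 1) f.2.1 -
            ℳ.d _ _ (p - 1) (q - 1) f.2.2) = 0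
        rw [map_sub, map_sub, ℳ.d_d, G.post_d q (r - 1) h (by omega),
          G.pre_d q (r - 1) h (by omega)]
        abel
      · rw [𝒞.d_shape _ _ q r h', 𝒟.d_shape _ _ q r h', ℳ.d_shape _ _ (q - 1) (r - 1) (by omega),
          G.post_shape (p := q) (by omega), G.pre_shape (p := q) (by omega)]
        ext <;> simp
    · rw [𝒞.d_shape _ _ p q h, 𝒟.d_shape _ _ p q h, ℳ.d_shape _ _ (p - 1) (q - 1) (by omega),
        G.post_shape (p := p) (by omega), G.pre_shape (p := p) (by omega)]
      ext <;> simp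
  one x := (𝒞.one x, 𝒟.one _, 0)
  comp {x y z p q n} h := LinearMap.mk₂ k
    (fun a b => (𝒞.comp h a.1 b.1, 𝒟.comp h a.2.1 b.2.1,
      ℳ.comp (show p + (q - 1) = n - 1 by omega) (G.P.map x y p a.1) b.2.2 +
        q.negOnePow • ℳ.comp (show p - 1 + q = n - 1 by omega) a.2.2 (G.P'.map _ _ q b.2.1)))
    (fun a a' b => by
      ext <;> simp
      abel)
    (fun c a b => by
      ext <;> simp [smul_comm c])
    (fun a b b' => by
      ext <;> simp
      abel)
    (fun c a b => by
      ext <;> simp [smul_comm c])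
  one_comp f := by
    refine Prod.ext (𝒞.one_comp _) (Prod.ext (𝒟.one_comp _) ?_)
    simp [G.P.map_one, ℳ.one_comp]
  comp_one f := by
    refine Prod.ext (𝒞.comp_one _) (Prod.ext (𝒟.comp_one _) ?_)
    simp [G.P'.map_one, ℳ.comp_one]
  assoc {x y z t p q r pq qr n} hpq hqr h h' f g e := by
    refine Prod.ext (𝒞.assoc _ _ _ _ _ _ _) (Prod.ext (𝒟.assoc _ _ _ _ _ _ _) ?_)
    simp only [LinearMap.mk₂_apply]
    rw [G.P.map_comp, G.P'.map_comp]
    simp only [map_add, LinearMap.add_apply, DGCat.map_sign]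
    rw [ℳ.assoc hpq (show q + (r - 1) = qr - 1 by omega) _ (by omega)]
    rw [← ℳ.assoc (show p - 1 + q = pq - 1 by omega) hqr (by omega)]
    rw [← ℳ.assoc (show p + (q - 1) = pq - 1 by omega) (show q - 1 + r = qr - 1 by omega)
      (by omega)]
    have hs : qr.negOnePow = q.negOnePow * r.negOnePow := by rw [← hqr, Int.negOnePow_add]
    rw [hs]
    rcases Int.units_eq_one_or q.negOnePow with hq | hq <;>
    rcases Int.units_eq_one_or r.negOnePow with hr | hr <;>
    simp only [hq, hr, Units.neg_smul, one_smul, LinearMap.neg_apply, mul_one, mul_neg] <;>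
    abel
  leibniz {x y z p q n p' q' n'} h hp hq hn h₁ h₂ f g := by
    refine Prod.ext (𝒞.leibniz _ hp hq hn _ _ _ _) (Prod.ext (𝒟.leibniz _ hp hq hn _ _ _ _) ?_)
    change G.post x z n (n' - 1) (𝒞.comp h f.1 g.1) - G.pre x z n (n' - 1) (𝒟.comp h f.2.1 g.2.1) -
      ℳ.d _ _ (n - 1) (n' - 1) (ℳ.comp (show p + (q - 1) = n - 1 by omega) (G.P.map x y p f.1) g.2.2
        + q.negOnePow • ℳ.comp (show p - 1 + q = n - 1 by omega) f.2.2 (G.P'.map _ _ q g.2.1)) =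
      (ℳ.comp (show p + (q' - 1) = n' - 1 by omega) (G.P.map x y p f.1)
        (G.post y z q (q' - 1) g.1 - G.pre y z q (q' - 1) g.2.1 -
          ℳ.d _ _ (q - 1) (q' - 1) g.2.2) +
        q'.negOnePow • ℳ.comp (show p - 1 + q' = n' - 1 by omega) f.2.2
          (G.P'.map _ _ q' (𝒟.d _ _ q q' g.2.1))) +
      q.negOnePow • (ℳ.comp (show p' + (q - 1) = n' - 1 by omega)
        (G.P.map x y p' (𝒞.d _ _ p p' f.1)) g.2.2 +
        q.negOnePow • ℳ.comp (show p' - 1 + q = n' - 1 by omega)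
          (G.post x y p (p' - 1) f.1 - G.pre x y p (p' - 1) f.2.1 -
            ℳ.d _ _ (p - 1) (p' - 1) f.2.2) (G.P'.map _ _ q g.2.1))
    rw [G.post_apply (show n + 0 = n' - 1 by omega), G.post_apply (show q + 0 = q' - 1 by omega),
      G.post_apply (show p + 0 = p' - 1 by omega), G.pre_apply (show 0 + n = n' - 1 by omega),
      G.pre_apply (show 0 + q = q' - 1 by omega), G.pre_apply (show 0 + p = p' - 1 by omega),
      G.P.map_comp, G.P'.map_comp, map_add, DGCat.map_sign,
      ℳ.leibniz (p := p) (p' := p') (q' := q' - 1) _ hp (by omega) (by omega) (by omega) (by omega),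
      ℳ.leibniz (p := p - 1) (q := q) (p' := p' - 1) (q' := q') _ (by omega) hq (by omega) (by omega)
        (by omega), G.P.map_d, G.P'.map_d]
    simp only [map_sub, LinearMap.sub_apply]
    have hs : q'.negOnePow = -q.negOnePow := by rw [← hq, Int.negOnePow_succ]
    rw [ℳ.assoc h (show q + 0 = q' - 1 by omega) (show n + 0 = n' - 1 by omega)
        (show p + (q' - 1) = n' - 1 by omega),
      ← ℳ.assoc (show 0 + p = p' - 1 by omega) h (show p' - 1 + q = n' - 1 by omega) (show 0 + n = n' - 1 by omega),
      ℳ.assoc (show p + 0 = p' - 1 by omega) (show 0 + q = q' - 1 by omega) _ (by omega),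
      hs, Int.negOnePow_sub, Int.negOnePow_one]
    rcases Int.units_eq_one_or q.negOnePow with hq | hq <;>
    simp only [hq, Units.neg_smul, one_smul, mul_neg, mul_one, neg_neg] <;>
    abel

/-- The morphisms of degree `n` of the glued DG-category. -/
abbrev GHom (x y : 𝒞.Ob) (n : ℤ) : Type v :=
  𝒞.Hom x y n × 𝒟.Hom (G.r x) (G.r y) n × ℳ.Hom (G.P.obj x) (G.P'.obj (G.r y)) (n - 1)

/-- The first component of a morphism of the glued DG-category. -/
def fstMap (x y : 𝒞.Ob) (n : ℤ) : G.GHom x y n →ₗ[k] 𝒞.Hom x y n := LinearMap.fst _ _ _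

/-- The second component of a morphism of the glued DG-category. -/
def sndMap (x y : 𝒞.Ob) (n : ℤ) : G.GHom x y n →ₗ[k] 𝒟.Hom (G.r x) (G.r y) n :=
  LinearMap.fst _ _ _ ∘ₗ LinearMap.snd _ _ _

/-- The projection of the glued DG-category to the first factor. -/
def fst : DGFunctor G.glue 𝒞 where
  obj x := x
  map x y n := G.fstMap x y n
  map_d _ _ _ _ _ := rfl
  map_one _ := rfl
  map_comp _ _ _ := rfl

/-- The projection of the glued DG-category to the second factor. -/
def snd : DGFunctor G.glue 𝒟 where
  obj := G.r
  map x y n := G.sndMap x y n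
  map_d _ _ _ _ _ := rfl
  map_one _ := rfl
  map_comp _ _ _ := rfl

/-- The closed morphisms of the glued DG-category. -/
def Closed {x y : 𝒞.Ob} {n : ℤ} (a : G.GHom x y n) : Prop :=
  𝒞.d _ _ n (n + 1) a.1 = 0 ∧ 𝒟.d _ _ n (n + 1) a.2.1 = 0 ∧
    ℳ.d _ _ (n - 1) n a.2.2 = G.post x y n n a.1 - G.pre x y n n a.2.1

/-- The exact morphisms of the glued DG-category. -/
def Exact {x y : 𝒞.Ob} {n : ℤ} (a : G.GHom x y n) : Prop :=
  ∃ f g h, a.1 = 𝒞.d _ _ (n - 1) n f ∧ a.2.1 = 𝒟.d _ _ (n - 1) n g ∧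
    a.2.2 = G.post x y (n - 1) (n - 1) f - G.pre x y (n - 1) (n - 1) g -
      ℳ.d _ _ (n - 1 - 1) (n - 1) h

theorem glue_d_eq_zero_iff {x y : G.glue.Ob} {n : ℤ} (a : G.glue.Hom x y n) :
    G.glue.d x y n (n + 1) a = 0 ↔ G.Closed (x := x) (y := y) a := by
  have h : ∀ m, m = n → ((0 : ℳ.Hom (G.P.obj x) (G.P'.obj (G.r y)) m) =
      G.post x y n m a.1 - G.pre x y n m a.2.1 - ℳ.d _ _ (n - 1) m a.2.2 ↔
      ℳ.d _ _ (n - 1) n a.2.2 = G.post x y n n a.1 - G.pre x y n n a.2.1) := by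
    rintro _ rfl
    rw [eq_comm, sub_eq_zero, eq_comm]
  refine Prod.ext_iff.trans (and_congr_right fun _ => Prod.ext_iff.trans
    (and_congr_right fun _ => eq_comm.trans (h (n + 1 - 1) (by omega))))

theorem glue_exists_d_iff {x y : G.glue.Ob} {n : ℤ} (a : G.glue.Hom x y n) :
    (∃ b, a = G.glue.d x y (n - 1) n b) ↔ G.Exact (x := x) (y := y) a := by
  constructor
  · rintro ⟨b, rfl⟩
    exact ⟨b.1, b.2.1, b.2.2, rfl, rfl, rfl⟩
  · rintro ⟨f, g, h, h1, h2, h3⟩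
    exact ⟨(f, g, h), Prod.ext h1 (Prod.ext h2 h3)⟩

/-- The map `f ↦ α ∘ P(f)` is a quasi-isomorphism in degree `n`. -/
abbrev PostQis (x y : 𝒞.Ob) (n : ℤ) : Prop :=
  IsQis 𝒞 ℳ x y (G.P.obj x) (G.P'.obj (G.r y)) (fun n => G.post x y n n) n

/-- The map `g ↦ P'(g) ∘ α` is a quasi-isomorphism in degree `n`. -/
abbrev PreQis (x y : 𝒞.Ob) (n : ℤ) : Prop :=
  IsQis 𝒟 ℳ (G.r x) (G.r y) (G.P.obj x) (G.P'.obj (G.r y)) (fun n => G.pre x y n n) n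

/-- As in the long exact sequence of a cone: `PreQis` in degree `n` makes the second component
exact, leaving an error cocycle of degree `n - 1` in the homotopy component. Surjectivity in degree
`n - 1` absorbs it, so one degree is lost. -/
theorem fst_inj {n : ℤ} (h : G.PreQis x y n) (h' : G.PreQis x y (n - 1)) (a : G.GHom x y n)
    (ha : G.Closed a) (hb : ∃ b, a.1 = 𝒞.d x y (n - 1) n b) :
    G.Exact a := by
  obtain ⟨h1, h2, h3⟩ := ha
  obtain ⟨f, hf⟩ := hb
  obtain ⟨g, hg⟩ := h.inj a.2.1 h2 ⟨G.post x y (n - 1) (n - 1) f - a.2.2, by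
    rw [map_sub, h3, hf, G.post_d n n (by omega) (by omega)]
    abel⟩
  obtain ⟨g', e, hg', he⟩ := h'.surj (G.post x y (n - 1) (n - 1) f - G.pre x y (n - 1) (n - 1) g -
      a.2.2) (by
    rw [show n - 1 + 1 = n by omega, map_sub, map_sub, h3, hf, hg,
      G.post_d n n (by omega) (by omega), G.pre_d n n (by omega) (by omega)]
    abel)
  rw [show n - 1 + 1 = n by omega] at hg'
  refine ⟨f, g + g', e, hf, by rw [map_add, hg', add_zero, hg], ?_⟩
  rw [map_add]
  linear_combination (norm := abel) -he

theorem snd_inj {n : ℤ} (h : G.PostQis x y n) (h' : G.PostQis x y (n - 1))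
    (a : G.GHom x y n) (ha : G.Closed a)
    (hb : ∃ b, a.2.1 = 𝒟.d _ _ (n - 1) n b) : G.Exact a := by
  obtain ⟨h1, h2, h3⟩ := ha
  obtain ⟨g, hg⟩ := hb
  obtain ⟨f, hf⟩ := h.inj a.1 h1 ⟨G.pre x y (n - 1) (n - 1) g + a.2.2, by
    rw [map_add, h3, hg, G.pre_d n n (by omega) (by omega)]
    abel⟩
  obtain ⟨f', e, hf', he⟩ := h'.surj (G.pre x y (n - 1) (n - 1) g + a.2.2 -
      G.post x y (n - 1) (n - 1) f) (by
    rw [show n - 1 + 1 = n by omega, map_sub, map_add, h3, hf, hg,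
      G.post_d n n (by omega) (by omega), G.pre_d n n (by omega) (by omega)]
    abel)
  rw [show n - 1 + 1 = n by omega] at hf'
  refine ⟨f + f', g, -e, by rw [map_add, hf', add_zero, hf], hg, ?_⟩
  rw [map_add, map_neg]
  linear_combination (norm := abel) he

/-- The coboundary in the surjectivity of `pre` serves as the homotopy component, so the cocycle
itself lifts, not only its class. -/
theorem fst_surj {n : ℤ} (h : G.PreQis x y n) (f : 𝒞.Hom x y n) (hf : 𝒞.d x y n (n + 1) f = 0) :
    ∃ a : G.GHom x y n, G.Closed a ∧ a.1 = f := by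
  obtain ⟨g, e, hg, he⟩ := h.surj (G.post x y n n f) (by
    rw [G.post_d (n + 1) (n + 1) rfl rfl, hf, map_zero])
  refine ⟨(f, g, e), ⟨hf, hg, ?_⟩, rfl⟩
  linear_combination (norm := abel) -he

theorem snd_surj {n : ℤ} (h : G.PostQis x y n) (g : 𝒟.Hom (G.r x) (G.r y) n)
    (hg : 𝒟.d _ _ n (n + 1) g = 0) :
    ∃ a : G.GHom x y n, G.Closed a ∧ a.2.1 = g := by
  obtain ⟨f, e, hf, he⟩ := h.surj (G.pre x y n n g) (by
    rw [G.pre_d (n + 1) (n + 1) rfl rfl, hg, map_zero])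
  refine ⟨(f, g, -e), ⟨hf, hg, ?_⟩, rfl⟩
  rw [map_neg]
  linear_combination (norm := abel) he

/-- Makes the kernels of the two projections on cohomology coincide, so that one complement in
degree `1` serves both. -/
theorem exact_iff_exact {n : ℤ} (h : G.PreQis x y n) (h' : G.PostQis x y n)
    (a : G.GHom x y n) (ha : G.Closed a) :
    (∃ b, a.1 = 𝒞.d x y (n - 1) n b) ↔ ∃ b, a.2.1 = 𝒟.d _ _ (n - 1) n b := by
  obtain ⟨h1, h2, h3⟩ := ha
  constructor
  · rintro ⟨f, hf⟩
    refine h.inj a.2.1 h2 ⟨G.post x y (n - 1) (n - 1) f - a.2.2, ?_⟩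
    rw [map_sub, h3, hf, G.post_d n n (by omega) (by omega)]
    abel
  · rintro ⟨g, hg⟩
    refine h'.inj a.1 h1 ⟨G.pre x y (n - 1) (n - 1) g + a.2.2, ?_⟩
    rw [map_add, h3, hg, G.pre_d n n (by omega) (by omega)]
    abel

end GlueData
end DGRec

namespace DGRec

/-! ### Truncations of DG-categories with connective cohomology -/

namespace DGCat

variable {k : Type w} [CommRing k]

/-- A DG-subcategory with the same objects. -/
def sub (𝒞 : DGCat.{u, v} k) (S : ∀ (x y : 𝒞.Ob) (n : ℤ), Submodule k (𝒞.Hom x y n))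
    (hd : ∀ x y p q, ∀ f ∈ S x y p, 𝒞.d x y p q f ∈ S x y q) (hone : ∀ x, 𝒞.one x ∈ S x x 0)
    (hcomp : ∀ {x y z p q n} (h : p + q = n), ∀ f ∈ S x y p, ∀ g ∈ S y z q,
      𝒞.comp h f g ∈ S x z n) : DGCat.{u, v} k where
  Ob := 𝒞.Ob
  Hom x y n := S x y n
  d x y p q := (𝒞.d x y p q).restrict (hd x y p q)
  d_shape x y p q h := by
    ext f
    simp [𝒞.d_shape x y p q h]
  d_d x y p q r f := Subtype.ext (𝒞.d_d _ _ _ _ _ _)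
  one x := ⟨𝒞.one x, hone x⟩
  comp {x y z p q n} h := LinearMap.mk₂ k
    (fun a b => ⟨𝒞.comp h a.1 b.1, hcomp h _ a.2 _ b.2⟩)
    (fun a a' b => by ext; simp) (fun c a b => by ext; simp)
    (fun a b b' => by ext; simp) (fun c a b => by ext; simp)
  one_comp f := Subtype.ext (𝒞.one_comp _)
  comp_one f := Subtype.ext (𝒞.comp_one _)
  assoc _ _ _ _ f g e := Subtype.ext (𝒞.assoc _ _ _ _ _ _ _)
  leibniz {x y z p q n p' q' n'} h hp hq hn h₁ h₂ f g :=
    Subtype.ext (by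
      have := 𝒞.leibniz h hp hq hn h₁ h₂ f.1 g.1
      rcases Int.units_eq_one_or q.negOnePow with hs | hs <;> rw [hs] at this ⊢ <;>
      simpa using this)

variable (𝒞 : DGCat.{u, v} k)

/-- The identities of a DG-category. -/
inductive IsOne : ∀ (x y : 𝒞.Ob) (n : ℤ), 𝒞.Hom x y n → Prop
  | one (x : 𝒞.Ob) : IsOne x x 0 (𝒞.one x)

/-- The multiples of identities. -/
def units (x y : 𝒞.Ob) (n : ℤ) : Submodule k (𝒞.Hom x y n) := Submodule.span k {f | 𝒞.IsOne x y n f}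

theorem d_one (x : 𝒞.Ob) : 𝒞.d x x 0 1 (𝒞.one x) = 0 := by
  have h := 𝒞.leibniz (zero_add 0) (p' := 1) (q' := 1) (n' := 1) (by norm_num) (by norm_num)
    (by norm_num) (by norm_num) (by norm_num) (𝒞.one x) (𝒞.one x)
  rw [𝒞.one_comp, 𝒞.one_comp] at h
  have h' := 𝒞.comp_one (𝒞.d x x 0 1 (𝒞.one x))
  simp only [Int.negOnePow_zero, one_smul] at h
  rw [h', left_eq_add] at h
  exact h

theorem d_of_mem_units {x y : 𝒞.Ob} {p q : ℤ} {f : 𝒞.Hom x y p} (hf : f ∈ 𝒞.units x y p) :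
    𝒞.d x y p q f = 0 := by
  induction hf using Submodule.span_induction with
  | mem f hf =>
    obtain ⟨x⟩ := hf
    by_cases h : q = 1
    · rw [h, d_one]
    · rw [𝒞.d_shape _ _ _ _ (by omega), LinearMap.zero_apply]
  | zero => exact map_zero _
  | add f g _ _ hf hg => rw [map_add, hf, hg, add_zero]
  | smul c f _ hf => rw [map_smul, hf, smul_zero]

theorem one_comp_mem {x y : 𝒞.Ob} {q n : ℤ} (h : 0 + q = n)
    (T : ∀ (x y : 𝒞.Ob) (n : ℤ), Submodule k (𝒞.Hom x y n)) {g : 𝒞.Hom x y q}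
    (hg : g ∈ T x y q) : 𝒞.comp h (𝒞.one x) g ∈ T x y n := by
  obtain rfl : q = n := by omega
  rwa [𝒞.one_comp]

theorem comp_one_mem {x y : 𝒞.Ob} {p n : ℤ} (h : p + 0 = n)
    (T : ∀ (x y : 𝒞.Ob) (n : ℤ), Submodule k (𝒞.Hom x y n)) {f : 𝒞.Hom x y p}
    (hf : f ∈ T x y p) : 𝒞.comp h f (𝒞.one y) ∈ T x y n := by
  obtain rfl : p = n := by omega
  rwa [𝒞.comp_one]

theorem units_comp {x y z : 𝒞.Ob} {p q n : ℤ} (h : p + q = n) {f : 𝒞.Hom x y p}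
    (hf : f ∈ 𝒞.units x y p) (T : ∀ (x y : 𝒞.Ob) (n : ℤ), Submodule k (𝒞.Hom x y n))
    {g : 𝒞.Hom y z q} (hg : g ∈ T y z q) : 𝒞.comp h f g ∈ T x z n := by
  induction hf using Submodule.span_induction with
  | mem f hf =>
    obtain ⟨x⟩ := hf
    exact 𝒞.one_comp_mem h T hg
  | zero => simp
  | add f f' _ _ hf hf' => rw [map_add]; exact add_mem hf hf'
  | smul c f _ hf => rw [map_smul]; exact Submodule.smul_mem _ _ hf

theorem comp_units {x y z : 𝒞.Ob} {p q n : ℤ} (h : p + q = n) {g : 𝒞.Hom y z q}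
    (hg : g ∈ 𝒞.units y z q) (T : ∀ (x y : 𝒞.Ob) (n : ℤ), Submodule k (𝒞.Hom x y n))
    {f : 𝒞.Hom x y p} (hf : f ∈ T x y p) : 𝒞.comp h f g ∈ T x z n := by
  induction hg using Submodule.span_induction with
  | mem g hg =>
    obtain ⟨z⟩ := hg
    exact 𝒞.comp_one_mem h T hf
  | zero => simp
  | add g g' _ _ hg hg' => rw [map_add]; exact add_mem hg hg'
  | smul c g _ hg => rw [map_smul]; exact Submodule.smul_mem _ _ hg

variable (V : ∀ (x y : 𝒞.Ob) (n : ℤ), Submodule k (𝒞.Hom x y n))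

/-- The morphisms in the truncation of a DG-category. -/
def truncHom (x y : 𝒞.Ob) (n : ℤ) : Submodule k (𝒞.Hom x y n) :=
  if n ≤ 0 then 𝒞.units x y n else if n = 1 then V x y n else ⊤

variable {x y : 𝒞.Ob} {n : ℤ}

theorem truncHom_of_nonpos (h : n ≤ 0) : 𝒞.truncHom V x y n = 𝒞.units x y n := if_pos h

theorem truncHom_of_two_le (h : 2 ≤ n) : 𝒞.truncHom V x y n = ⊤ := by
  rw [truncHom, if_neg (by omega), if_neg (by omega)]

/-- The DG-subcategory of multiples of identities in degree `0`, a subspace in degree `1`, and all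
morphisms of degree at least `2`. -/
def trunc : DGCat.{u, v} k :=
  𝒞.sub (𝒞.truncHom V)
    (fun x y p q f hf => by
      by_cases hq : 2 ≤ q
      · rw [truncHom_of_two_le _ _ hq]
        trivial
      -- A differential landing in degree at most `1` starts in degree at most `0`, from a multiple
      -- of an identity, and is zero.
      · by_cases hp : p + 1 = q
        · rw [truncHom_of_nonpos _ _ (by omega)] at hf
          rw [𝒞.d_of_mem_units hf]
          exact zero_mem _
        · rw [𝒞.d_shape _ _ _ _ hp]
          exact zero_mem _)
    (fun x => Submodule.subset_span (.one x))
    (fun {x y z p q n} h f hf g hg => by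
      by_cases hp : p ≤ 0
      · exact 𝒞.units_comp h (by rwa [truncHom_of_nonpos _ _ hp] at hf) _ hg
      · by_cases hq : q ≤ 0
        · exact 𝒞.comp_units h (by rwa [truncHom_of_nonpos _ _ hq] at hg) _ hf
        -- Both factors have degree at least `1`, so the composite lies in degree at least `2`,
        -- where nothing is discarded.
        · rw [truncHom_of_two_le _ _ (by omega)]
          trivial)

/-- The inclusion of the morphisms of the truncation. -/
def truncSubtype (x y : 𝒞.Ob) (n : ℤ) : 𝒞.truncHom V x y n →ₗ[k] 𝒞.Hom x y n :=
  (𝒞.truncHom V x y n).subtype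

/-- The inclusion of the truncation. -/
def truncIncl : DGFunctor (𝒞.trunc V) 𝒞 where
  obj x := x
  map x y n := 𝒞.truncSubtype V x y n
  map_d _ _ _ _ _ := rfl
  map_one _ := rfl
  map_comp _ _ _ := rfl

/-- The cohomology vanishes in negative degrees, and is spanned by the identities in degree `0`. -/
structure IsConnective : Prop where
  neg : ∀ (x y : 𝒞.Ob) (n : ℤ), n < 0 → ∀ a, 𝒞.d x y n (n + 1) a = 0 → ∃ b, a = 𝒞.d x y (n - 1) n b
  zero_of_ne : ∀ x y : 𝒞.Ob, x ≠ y → ∀ a, 𝒞.d x y 0 (0 + 1) a = 0 → ∃ b, a = 𝒞.d x y (0 - 1) 0 b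
  zero_self : ∀ (x : 𝒞.Ob) (a), 𝒞.d x x 0 (0 + 1) a = 0 →
    ∃ (c : k) (b : _), a = c • 𝒞.one x + 𝒞.d x x (0 - 1) 0 b
  one_not_exact : ∀ (x : 𝒞.Ob) (c : k), (∃ b, c • 𝒞.one x = 𝒞.d x x (0 - 1) 0 b) → c = 0

theorem units_self (x : 𝒞.Ob) {f : 𝒞.Hom x x 0} (hf : f ∈ 𝒞.units x x 0) :
    ∃ c : k, f = c • 𝒞.one x := by
  have : {f | 𝒞.IsOne x x 0 f} = {𝒞.one x} := by
    ext f
    exact ⟨fun h => by cases h; rfl, fun h => by rw [Set.mem_singleton_iff.1 h]; exact .one x⟩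
  rw [units, this, Submodule.mem_span_singleton] at hf
  obtain ⟨c, rfl⟩ := hf
  exact ⟨c, rfl⟩

theorem units_eq_bot (h : x ≠ y ∨ n ≠ 0) : 𝒞.units x y n = ⊥ := by
  rw [units, Submodule.span_eq_bot]
  intro f hf
  obtain ⟨x⟩ := hf
  simp at h

end DGCat

/-- The composite of functors of DG-categories. -/
def DGFunctor.comp {k : Type w} [CommRing k] {𝒞 𝒟 ℰ : DGCat.{u, v} k} (F : DGFunctor 𝒞 𝒟)
    (G : DGFunctor 𝒟 ℰ) : DGFunctor 𝒞 ℰ where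
  obj x := G.obj (F.obj x)
  map x y n := G.map _ _ n ∘ₗ F.map x y n
  map_d x y p q f := by simp [F.map_d, G.map_d]
  map_one x := by simp [F.map_one, G.map_one]
  map_comp h f g := by simp [F.map_comp, G.map_comp]

/-- In degree `0` the identities represent the cohomology of `𝒞`. In degree `1` there are no nonzero
coboundaries left, and the closed morphisms in `V`, a complement of the kernel `N`, represent the
classes bijectively. As `N` consists of closed morphisms, `V` has the same differentials as all of
degree `1`, so the cohomology in degree `2` is unchanged. -/
theorem trunc_isQis {k : Type w} [CommRing k] {𝒢 𝒞 : DGCat.{u, v} k} (F : DGFunctor 𝒢 𝒞)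
    (hF : Function.Injective F.obj) (h𝒞 : 𝒞.IsConnective)
    (hinj : ∀ x y n, 2 ≤ n → ∀ a, 𝒢.d x y n (n + 1) a = 0 →
      (∃ b, F.map x y n a = 𝒞.d _ _ (n - 1) n b) → ∃ b, a = 𝒢.d x y (n - 1) n b)
    (hsurj : ∀ x y n, 1 ≤ n → ∀ c, 𝒞.d _ _ n (n + 1) c = 0 →
      ∃ a, 𝒢.d x y n (n + 1) a = 0 ∧ F.map x y n a = c)
    (V : ∀ (x y : 𝒢.Ob) (n : ℤ), Submodule k (𝒢.Hom x y n))
    (N : ∀ x y : 𝒢.Ob, Submodule k (𝒢.Hom x y 1))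
    (hN : ∀ x y a, a ∈ N x y ↔ 𝒢.d x y 1 (1 + 1) a = 0 ∧ ∃ b, F.map x y 1 a = 𝒞.d _ _ (1 - 1) 1 b)
    (hV : ∀ x y, IsCompl (N x y) (V x y 1)) (x y : 𝒢.Ob) (n : ℤ) :
    IsQis (𝒢.trunc V) 𝒞 x y (((𝒢.truncIncl V).comp F).obj x) (((𝒢.truncIncl V).comp F).obj y)
      (((𝒢.truncIncl V).comp F).map x y) n where
  inj := by
    rintro ⟨a, ha⟩ hda ⟨b, hb⟩
    replace hda : 𝒢.d x y n (n + 1) a = 0 := congrArg Subtype.val hda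
    replace hb : F.map x y n a = 𝒞.d _ _ (n - 1) n b := hb
    suffices h : ∃ c ∈ 𝒢.truncHom V x y (n - 1), a = 𝒢.d x y (n - 1) n c by
      obtain ⟨c, hc, hac⟩ := h
      exact ⟨⟨c, hc⟩, Subtype.ext hac⟩
    rcases lt_trichotomy n 1 with hn | rfl | hn
    · refine ⟨0, zero_mem _, ?_⟩
      rw [𝒢.truncHom_of_nonpos V (by omega)] at ha
      rw [map_zero]
      by_cases h : x ≠ y ∨ n ≠ 0
      · rw [𝒢.units_eq_bot h] at ha
        exact ha
      · obtain ⟨rfl, rfl⟩ : x = y ∧ n = 0 := by simpa using h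
        obtain ⟨c, rfl⟩ := 𝒢.units_self x ha
        rw [map_smul, F.map_one] at hb
        rw [h𝒞.one_not_exact _ c ⟨b, hb⟩, zero_smul]
    · refine ⟨0, zero_mem _, ?_⟩
      rw [map_zero]
      exact (Submodule.disjoint_def.1 (hV x y).disjoint) a ((hN x y a).2 ⟨hda, b, hb⟩) ha
    · obtain ⟨c, rfl⟩ := hinj x y n (by omega) a hda ⟨b, hb⟩
      by_cases h2 : n = 2
      · subst h2
        -- A primitive in degree `1` must be moved into `V`; its component in `N` is closed and can
        -- be dropped.
        obtain ⟨c₁, hc₁, c₂, hc₂, rfl⟩ := Submodule.mem_sup.1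
          (((hV x y).sup_eq_top ▸ Submodule.mem_top : c ∈ N x y ⊔ V x y 1))
        refine ⟨c₂, hc₂, ?_⟩
        have := ((hN x y c₁).1 hc₁).1
        exact (map_add _ _ _).trans (by rw [show 𝒢.d x y (2 - 1) 2 c₁ = 0 from this, zero_add])
      · exact ⟨c, by rw [𝒢.truncHom_of_two_le V (by omega)]; trivial, rfl⟩
  surj := by
    intro c hc
    suffices h : ∃ a ∈ 𝒢.truncHom V x y n, 𝒢.d x y n (n + 1) a = 0 ∧
        ∃ b, c = F.map x y n a + 𝒞.d _ _ (n - 1) n b by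
      obtain ⟨a, ha, hda, b, hb⟩ := h
      exact ⟨⟨a, ha⟩, b, Subtype.ext hda, hb⟩
    rcases lt_trichotomy n 1 with hn | rfl | hn
    · rw [𝒢.truncHom_of_nonpos V (by omega)]
      by_cases h : x = y ∧ n = 0
      · obtain ⟨rfl, rfl⟩ := h
        obtain ⟨e, b, rfl⟩ := h𝒞.zero_self _ c hc
        refine ⟨e • 𝒢.one x, Submodule.smul_mem _ _ (Submodule.subset_span (.one x)), ?_, b, ?_⟩
        · exact 𝒢.d_of_mem_units (Submodule.smul_mem _ _ (Submodule.subset_span (.one x)))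
        · rw [map_smul, F.map_one]
          rfl
      · refine ⟨0, zero_mem _, map_zero _, ?_⟩
        suffices h' : ∃ b, c = 𝒞.d (F.obj x) (F.obj y) (n - 1) n b by
          obtain ⟨b, hb⟩ := h'
          exact ⟨b, by rw [map_zero]; exact hb.trans (zero_add _).symm⟩
        by_cases h0 : n = 0
        · subst h0
          exact h𝒞.zero_of_ne _ _ (fun e => h ⟨hF e, rfl⟩) c hc
        · exact h𝒞.neg _ _ n (by omega) c hc
    · obtain ⟨a, ha, rfl⟩ := hsurj x y 1 le_rfl c hc
      obtain ⟨a₁, ha₁, a₂, ha₂, rfl⟩ := Submodule.mem_sup.1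
        (((hV x y).sup_eq_top ▸ Submodule.mem_top : a ∈ N x y ⊔ V x y 1))
      obtain ⟨h1, b, hb⟩ := (hN x y a₁).1 ha₁
      rw [map_add, h1, zero_add] at ha
      exact ⟨a₂, ha₂, ha, b, by rw [map_add, hb]; exact add_comm _ _⟩
    · obtain ⟨a, ha, rfl⟩ := hsurj x y n (by omega) c hc
      exact ⟨a, by rw [𝒢.truncHom_of_two_le V (by omega)]; trivial, ha, 0, by
        rw [map_zero]; exact (add_zero _).symm⟩

end DGRec

/-! ### From agreement in positive degrees to an `A_∞`-quasi-isomorphism -/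

namespace DGRec

/-- The identity functor of a DG-category. -/
def DGFunctor.id {k : Type w} [CommRing k] (𝒞 : DGCat.{u, v} k) : DGFunctor 𝒞 𝒞 where
  obj x := x
  map _ _ _ := LinearMap.id
  map_d _ _ _ _ _ := rfl
  map_one _ := rfl
  map_comp _ _ _ := rfl

theorem exists_aInfFunctor_of_roof {k : Type w} [Field k] {𝒞 𝒟 : DGCat.{u, v} k}
    {ℳ : DGCat.{u', v} k} (G : GlueData 𝒞 𝒟 ℳ) (hr : Function.Bijective G.r) (h𝒞 : 𝒞.IsConnective)
    (h𝒟 : 𝒟.IsConnective) (hpost : ∀ x y n, 1 ≤ n → G.PostQis x y n)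
    (hpre : ∀ x y n, 1 ≤ n → G.PreQis x y n) :
    ∃ Φ : AInfFunctor 𝒞.toAInf 𝒟.toAInf, Φ.IsQuasiIso := by
  -- Closed morphisms with exact first component. In degree `1` this is the same as exact second
  -- component, so both truncation statements use the same `V`.
  let N : ∀ (x y : G.glue.Ob) (n : ℤ), Submodule k (G.glue.Hom x y n) := fun x y n =>
    LinearMap.ker (G.glue.d x y n (n + 1)) ⊓
      (LinearMap.range (𝒞.d (G.fst.obj x) (G.fst.obj y) (n - 1) n)).comap (G.fst.map x y n)
  choose V hV using fun x y n => Submodule.exists_isCompl (N x y n)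
  have hN : ∀ x y a, a ∈ N x y 1 ↔ G.glue.d x y 1 (1 + 1) a = 0 ∧
      ∃ b, G.fst.map x y 1 a = 𝒞.d _ _ (1 - 1) 1 b :=
    fun x y a => and_congr_right fun _ => exists_congr fun _ => eq_comm
  have hN' : ∀ x y a, a ∈ N x y 1 ↔ G.glue.d x y 1 (1 + 1) a = 0 ∧
      ∃ b, G.snd.map x y 1 a = 𝒟.d _ _ (1 - 1) 1 b := fun x y a => (hN x y a).trans
    (and_congr_right fun h => G.exact_iff_exact (hpre x y 1 le_rfl) (hpost x y 1 le_rfl) a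
      ((G.glue_d_eq_zero_iff a).1 h))
  let 𝒯 := G.glue.trunc V
  let ρ : DGFunctor 𝒯 𝒞 := (G.glue.truncIncl V).comp G.fst
  let ρ' : DGFunctor 𝒯 𝒟 := (G.glue.truncIncl V).comp G.snd
  have hρ : ∀ x y n, IsQis 𝒯 𝒞 x y (ρ.obj x) (ρ.obj y) (ρ.map x y) n :=
    trunc_isQis G.fst Function.injective_id h𝒞
      (fun x y n hn a ha hb => (G.glue_exists_d_iff a).2 (G.fst_inj (hpre x y n (by omega))
        (hpre x y (n - 1) (by omega)) a ((G.glue_d_eq_zero_iff a).1 ha) hb))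
      (fun x y n hn c hc => by
        obtain ⟨a, ha, hac⟩ := G.fst_surj (hpre x y n hn) c hc
        exact ⟨a, (G.glue_d_eq_zero_iff a).2 ha, hac⟩) V (fun x y => N x y 1) hN
      (fun x y => hV x y 1)
  have hρ' : ∀ x y n, IsQis 𝒯 𝒟 x y (ρ'.obj x) (ρ'.obj y) (ρ'.map x y) n :=
    trunc_isQis G.snd hr.1 h𝒟
      (fun x y n hn a ha hb => (G.glue_exists_d_iff a).2 (G.snd_inj (hpost x y n (by omega))
        (hpost x y (n - 1) (by omega)) a ((G.glue_d_eq_zero_iff a).1 ha) hb))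
      (fun x y n hn c hc => by
        obtain ⟨a, ha, hac⟩ := G.snd_surj (hpost x y n hn) c hc
        exact ⟨a, (G.glue_d_eq_zero_iff a).2 ha, hac⟩) V (fun x y => N x y 1) hN'
      (fun x y => hV x y 1)
  -- A path construction on `ρ`, whose own morphism maps need not be surjective. The triples `(c, 0,
  -- 0)` show that the projection of `L.glue` to `𝒞` is surjective in each degree, and it is a
  -- quasi-isomorphism because `ρ` is one in every degree.
  let L : GlueData 𝒞 𝒯 𝒞 :=
    { P := .id 𝒞
      P' := ρ
      r := fun x => x
      α := fun x => 𝒞.one x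
      α_d := fun x => 𝒞.d_one x }
  have hLpost : ∀ x y n, L.PostQis x y n := fun x y n => by
    have e : ∀ n a, L.post x y n n a = a := fun n a =>
      (L.post_apply (add_zero n) a).trans (𝒞.comp_one a)
    exact ⟨fun a _ ⟨b, hb⟩ => ⟨b, (e n a).symm.trans hb⟩,
      fun c hc => ⟨c, 0, hc, by
        rw [map_zero, add_zero]
        exact (e n c).symm⟩⟩
  have hLpre : ∀ x y n, L.PreQis x y n := fun x y n => by
    have e : ∀ n a, L.pre x y n n a = ρ.map x y n a := fun n a =>
      (L.pre_apply (zero_add n) a).trans (𝒞.one_comp _)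
    refine ⟨fun a ha ⟨b, hb⟩ => (hρ x y n).inj a ha ⟨b, (e n a).symm.trans hb⟩, fun c hc => ?_⟩
    obtain ⟨a, b, ha, hab⟩ := (hρ x y n).surj c hc
    exact ⟨a, b, ha, hab.trans (congrArg (· + 𝒞.d x y (n - 1) n b) (e n a).symm)⟩
  obtain ⟨Γ, hΓ, hq⟩ := exists_contraction 𝒞 L.glue (fun x => x) (fun x y n => L.fstMap x y n)
    (fun _ _ _ _ _ => rfl) (fun _ _ _ => rfl) (fun x y n c => ⟨(c, 0, 0), rfl⟩)
    (fun x y n => ⟨fun a ha hb => (L.glue_exists_d_iff a).2 (L.fst_inj (hLpre x y n)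
        (hLpre x y (n - 1)) a ((L.glue_d_eq_zero_iff a).1 ha) hb), fun c hc => by
        obtain ⟨a, ha, hac⟩ := L.fst_surj (hLpre x y n) c hc
        exact ⟨a, 0, (L.glue_d_eq_zero_iff a).2 ha, by rw [map_zero, add_zero]; exact hac.symm⟩⟩)
  have hsnd : ∀ x y n, IsQis L.glue 𝒯 x y (L.snd.obj x) (L.snd.obj y) (L.snd.map x y) n :=
    fun x y n => ⟨fun a ha hb => (L.glue_exists_d_iff a).2 (L.snd_inj (hLpost x y n)
        (hLpost x y (n - 1)) a ((L.glue_d_eq_zero_iff a).1 ha) hb), fun c hc => by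
        obtain ⟨a, ha, hac⟩ := L.snd_surj (hLpost x y n) c hc
        exact ⟨a, 0, (L.glue_d_eq_zero_iff a).2 ha, by rw [map_zero, add_zero]; exact hac.symm⟩⟩
  refine ⟨Γ.aInfFunctor (L.snd.comp ρ'), isQuasiIso_of_isQis _ ?_ fun x y n => ?_⟩
  · have e : (Γ.aInfFunctor (L.snd.comp ρ')).obj = G.r := by
      change (fun x => G.r (Γ.r x)) = _
      rw [hΓ]
    rw [e]
    exact hr
  -- The linear component is the section `s`, followed by the projection to `𝒯` and by `ρ'`, each of
  -- them a quasi-isomorphism.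
  · have h := (((hq x y n).of_section (Γ.s_d x y) (Γ.p_d x y) (Γ.p_s x y)).comp
      (hsnd _ _ n) (Γ.s_d x y) (L.snd.map_d _ _)).comp (hρ' _ _ n)
      (fun n m a => by rw [LinearMap.comp_apply, Γ.s_d, L.snd.map_d]; rfl) (ρ'.map_d _ _)
    exact ⟨fun a ha hb => h.inj a ha (by
        obtain ⟨b, hb⟩ := hb
        exact ⟨b, (Γ.aInfFunctor_F₁ (L.snd.comp ρ') x y n a).symm.trans hb⟩), fun c hc => by
        obtain ⟨a, b, ha, hab⟩ := h.surj c hc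
        exact ⟨a, b, ha, hab.trans (congrArg (· + 𝒟.d _ _ (n - 1) n b)
          (Γ.aInfFunctor_F₁ (L.snd.comp ρ') x y n a).symm)⟩⟩

end DGRec

namespace DGRec

/-! ### Cochains from a complex of projectives to an augmented complex -/

section Augmented

open CochainComplex HomComplex Limits

variable {C : Type u} [Category.{v} C] [Abelian C]

/-- A complex `⋯ → Y⁻¹ → Y⁰ → 0` with an augmentation `Y⁰ → S` inducing an isomorphism
`H⁰(Y) ≅ S`, and exact in degrees `a < m < 0`. -/
structure IsAugmented (Y : CochainComplex C ℤ) {S : C} (ε : Y.X 0 ⟶ S) (a : ℤ) : Prop where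
  epi : Epi ε
  isZero : ∀ m, 0 < m → IsZero (Y.X m)
  zero : Y.d (-1) 0 ≫ ε = 0
  exact₀ : (ShortComplex.mk _ _ zero).Exact
  exact : ∀ m, a < m → m < 0 → Y.ExactAt m

theorem exists_comp_d_eq {Y : CochainComplex C ℤ} {l m m' : ℤ} (hl : l + 1 = m) (hm : m + 1 = m')
    (hY : Y.ExactAt m) {X : C} [Projective X] (f : X ⟶ Y.X m) (hf : f ≫ Y.d m m' = 0) :
    ∃ g : X ⟶ Y.X l, g ≫ Y.d l m = f := by
  have := (HomologicalComplex.exactAt_iff' Y l m m' (by simp; omega) (by simp; omega)).1 hY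
  exact ⟨this.liftFromProjective f hf, this.liftFromProjective_comp f hf⟩

variable {P Y : CochainComplex C ℤ} [∀ p, Projective (P.X p)] {k : ℤ}

/-- Downward induction on the source degree. Once the components above `p₀` vanish, the cocycle
condition says that the one at `p₀` is killed by the differential of `Y`. Exactness and projectivity
lift it through the previous differential, and the lift, as a one-component cochain, removes it. -/
theorem exists_sub_δ_v_eq_zero (z : Cochain P Y k) (hz : δ k (k + 1) z = 0) (M : ℤ)
    (hM : ∀ p q h, M ≤ p → z.v p q h = 0) (j : ℕ)
    (hY : ∀ p, M - j ≤ p → p < M → Y.ExactAt (p + k)) :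
    ∃ h : Cochain P Y (k - 1), (∀ p q hp, M ≤ p → h.v p q hp = 0) ∧
      ∀ p q hp, M - j ≤ p → (z - δ (k - 1) k h).v p q hp = 0 := by
  induction j with
  | zero => exact ⟨0, by simp, fun p q hp h => by simp [hM p q hp (by simpa using h)]⟩
  | succ j ih =>
    obtain ⟨h, h1, h2⟩ := ih fun p hp => hY p (by push_cast; omega)
    set z' := z - δ (k - 1) k h with hz'
    have hδ : δ k (k + 1) z' = 0 := by rw [hz', δ_sub, hz, δ_δ, sub_zero]
    set p₀ := M - (j + 1 : ℕ) with hp₀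
    have e := Cochain.congr_v hδ p₀ (p₀ + k + 1) (by omega)
    rw [δ_v k (k + 1) rfl z' p₀ (p₀ + k + 1) (by omega) (p₀ + k) (p₀ + 1) (by omega) rfl,
      h2 (p₀ + 1) _ _ (by omega), comp_zero, smul_zero, add_zero, Cochain.zero_v] at e
    obtain ⟨g, hg⟩ := exists_comp_d_eq (l := p₀ + (k - 1)) (by omega) rfl
      (hY p₀ le_rfl (by omega)) _ e
    refine ⟨h + Cochain.single g (k - 1), fun p q hp hp' => ?_, fun p q hp hp' => ?_⟩
    · rw [Cochain.add_v, h1 p q hp hp', Cochain.single_v_eq_zero _ _ _ _ _ (by omega), add_zero]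
    · rw [δ_add, ← sub_sub, ← hz', Cochain.sub_v,
        Cochain.δ_single g (k - 1) k (by omega) (p₀ - 1) (p₀ + k) (by omega) (by omega), hg,
        Cochain.add_v, Cochain.units_smul_v,
        Cochain.single_v_eq_zero (P.d (p₀ - 1) p₀ ≫ g) _ _ _ _ (by omega), smul_zero, add_zero]
      by_cases hpp : p = p₀
      · subst hpp
        obtain rfl : p₀ + k = q := hp
        rw [Cochain.single_v, sub_self]
      · rw [Cochain.single_v_eq_zero _ _ _ _ _ hpp, h2 p q hp (by omega), sub_zero]

variable {S : C} {ε : Y.X 0 ⟶ S} {a : ℤ}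

namespace IsAugmented

theorem v_eq_zero (hY : IsAugmented Y ε a) {P : CochainComplex C ℤ} (z : Cochain P Y k) (p q : ℤ)
    (h : p + k = q) (hp : -k < p) : z.v p q h = 0 :=
  (hY.isZero q (by omega)).eq_of_tgt _ _

/-- The component into `Y⁰` is removed using exactness at the augmentation, and those below it by
`exists_sub_δ_v_eq_zero`. The vanishing of `h` in source degrees above `-k` lets `exists_cocycle`
correct a cochain without touching its component into `Y⁰`. -/
theorem exists_sub_δ (hY : IsAugmented Y ε a) (z : Cochain P Y k) (hz : δ k (k + 1) z = 0)
    (hε : z.v (-k) 0 (by omega) ≫ ε = 0) :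
    ∃ h : Cochain P Y (k - 1), (∀ p q hp, -k < p → h.v p q hp = 0) ∧
      ∀ p q hp, a < q → (z - δ (k - 1) k h).v p q hp = 0 := by
  obtain ⟨g, hg⟩ : ∃ g : P.X (-k) ⟶ Y.X (-1), g ≫ Y.d (-1) 0 = z.v (-k) 0 (by omega) :=
    ⟨hY.exact₀.liftFromProjective _ hε, hY.exact₀.liftFromProjective_comp _ hε⟩
  have hδ : ∀ p q h, (δ (k - 1) k (Cochain.single g (k - 1))).v p q h =
      (Cochain.single (g ≫ Y.d (-1) 0) k).v p q h +
        k.negOnePow • (Cochain.single (P.d (-k - 1) (-k) ≫ g) k).v p q h := fun p q h => by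
    rw [Cochain.δ_single g (k - 1) k (by omega) (-k - 1) 0 (by omega) (by omega), Cochain.add_v,
      Cochain.units_smul_v]
  obtain ⟨h, h1, h2⟩ := exists_sub_δ_v_eq_zero (z - δ (k - 1) k (Cochain.single g (k - 1)))
    (by rw [δ_sub, hz, δ_δ, sub_zero]) (-k) (fun p q h hp => by
      rw [Cochain.sub_v, hδ, Cochain.single_v_eq_zero (P.d (-k - 1) (-k) ≫ g) _ _ _ _ (by omega),
        smul_zero, add_zero, hg]
      by_cases hp' : p = -k
      · subst hp'
        obtain rfl : 0 = q := by omega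
        rw [Cochain.single_v, sub_self]
      · rw [Cochain.single_v_eq_zero _ _ _ _ _ hp', hY.v_eq_zero z p q h (by omega), sub_zero])
    -- For `a < 0`, the number of degrees strictly between `a` and `0`.
    (-a - 1).toNat (fun p hp hp' => hY.exact _ (by omega) (by omega))
  refine ⟨Cochain.single g (k - 1) + h, fun p q hp hp' => ?_, fun p q hp hq => ?_⟩
  · rw [Cochain.add_v, h1 p q hp hp'.le, Cochain.single_v_eq_zero _ _ _ _ _ (by omega), add_zero]
  · rw [δ_add, ← sub_sub]
    by_cases hp' : -k < p
    · exact hY.v_eq_zero _ _ _ _ hp'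
    · exact h2 p q hp (by omega)

variable {c : ℤ}

/-- `P` starts in degree `c`, so a cochain of degree `k` only reaches degrees `≥ c + k > a`, where
`exists_sub_δ` leaves nothing. -/
theorem exists_δ_eq_of_comp_eq_zero (hY : IsAugmented Y ε a) (hP : ∀ m < c, IsZero (P.X m))
    (hac : a < c + k) (l : ℤ) (hl : l + 1 = k) (z : Cochain P Y k) (hz : δ k (k + 1) z = 0)
    (hε : z.v (-k) 0 (by omega) ≫ ε = 0) :
    ∃ h : Cochain P Y l, (∀ p q hp, -k < p → h.v p q hp = 0) ∧ δ l k h = z := by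
  obtain rfl : l = k - 1 := by omega
  obtain ⟨h, h1, h2⟩ := hY.exists_sub_δ z hz hε
  refine ⟨h, h1, (sub_eq_zero.1 ?_).symm⟩
  ext p q hpq
  by_cases hp : p < c
  · exact (hP p hp).eq_of_src _ _
  · exact h2 p q hpq (by omega)

/-- Exactness of a cocycle is detected in `Hom(P, S)`: a primitive `g` there lifts to `Y⁰` by
projectivity, and subtracting the coboundary of the lift leaves a cocycle with zero augmentation. -/
theorem exists_δ_eq (hY : IsAugmented Y ε a) (hP : ∀ m < c, IsZero (P.X m))
    (hac : a < c + k) (z : Cochain P Y k) (hz : δ k (k + 1) z = 0) (g : P.X (-(k - 1)) ⟶ S)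
    (hε : z.v (-k) 0 (by omega) ≫ ε = P.d (-k) (-(k - 1)) ≫ g) :
    ∃ h : Cochain P Y (k - 1), δ (k - 1) k h = z := by
  have := hY.epi
  set g' := Projective.factorThru g ε with hg'
  -- The sign cancels the one in front of `P.d ≫ g'` in the coboundary of a one-component cochain.
  set h₀ : Cochain P Y (k - 1) := k.negOnePow • Cochain.single g' (k - 1) with hh₀
  have e : (δ (k - 1) k h₀).v (-k) 0 (by omega) = P.d (-k) (-(k - 1)) ≫ g' := by
    rw [hh₀, δ_units_smul, Cochain.δ_single g' (k - 1) k (by omega) (-k) 1 (by omega) (by omega),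
      smul_add, smul_smul, Int.units_mul_self, one_smul, Cochain.add_v, Cochain.units_smul_v,
      Cochain.single_v_eq_zero _ _ _ _ _ (by omega), Cochain.single_v, smul_zero, zero_add]
  obtain ⟨h, -, h2⟩ := hY.exists_δ_eq_of_comp_eq_zero hP hac (k - 1) (by omega)
    (z - δ (k - 1) k h₀)
    (by rw [δ_sub, hz, δ_δ, sub_zero]) (by
      rw [Cochain.sub_v, Preadditive.sub_comp, e, hε, Category.assoc, hg',
        Projective.factorThru_comp, sub_self])
  exact ⟨h + h₀, by rw [δ_add, h2, sub_add_cancel]⟩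

/-- The one-component lift of `g` is in general not closed, but its coboundary is a cocycle of
degree `k + 1` with zero augmentation. It is therefore the coboundary of some `h` with no component
in source degree `-k`, which may be subtracted. -/
theorem exists_cocycle (hY : IsAugmented Y ε a) (hP : ∀ m < c, IsZero (P.X m))
    (hac : a < c + k + 1) (g : P.X (-k) ⟶ S) (hg : P.d (-(k + 1)) (-k) ≫ g = 0) :
    ∃ f : Cochain P Y k, δ k (k + 1) f = 0 ∧ f.v (-k) 0 (by omega) ≫ ε = g := by
  have := hY.epi
  set g' := Projective.factorThru g ε with hg'
  set f₀ : Cochain P Y k := Cochain.single g' k with hf₀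
  have e : (δ k (k + 1) f₀).v (-(k + 1)) 0 (by omega) =
      (k + 1).negOnePow • (P.d (-(k + 1)) (-k) ≫ g') := by
    rw [hf₀, Cochain.δ_single g' k (k + 1) rfl (-(k + 1)) 1 (by omega) (by omega),
      Cochain.add_v, Cochain.units_smul_v,
      Cochain.single_v_eq_zero _ _ _ _ _ (by omega), Cochain.single_v, zero_add]
  obtain ⟨h, h1, h2⟩ := hY.exists_δ_eq_of_comp_eq_zero hP (k := k + 1) (by omega) k rfl
    (δ k (k + 1) f₀) (δ_δ _ _ _ _) (by
      rw [e, Linear.units_smul_comp, Category.assoc, hg', Projective.factorThru_comp, hg,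
        smul_zero])
  refine ⟨f₀ - h, by rw [δ_sub, h2, sub_self], ?_⟩
  rw [Cochain.sub_v, h1 _ _ _ (by omega), sub_zero, hf₀, Cochain.single_v, hg',
    Projective.factorThru_comp]

end IsAugmented

end Augmented

end DGRec

namespace DGRec

/-! ### Composition with homotopy equivalences -/

namespace DGCat

variable {k : Type w} [CommRing k] {ℳ : DGCat.{u, v} k} {x y z : ℳ.Ob}

/-- A closed morphism of degree `0` which is invertible up to homotopy. -/
def IsHomotopyEquiv (α : ℳ.Hom x y 0) : Prop :=
  ℳ.d x y 0 1 α = 0 ∧ ∃ β : ℳ.Hom y x 0, ℳ.d y x 0 1 β = 0 ∧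
    (∃ h, ℳ.comp (zero_add 0) α β = ℳ.one x + ℳ.d x x (-1) 0 h) ∧
    ∃ h, ℳ.comp (zero_add 0) β α = ℳ.one y + ℳ.d y y (-1) 0 h

theorem comp_d_of_closed {n : ℤ} {f : ℳ.Hom x y n} (hf : ℳ.d x y n (n + 1) f = 0)
    (h : ℳ.Hom y z (-1)) :
    ℳ.comp (add_zero n) f (ℳ.d y z (-1) 0 h) = ℳ.d x z (n - 1) n (ℳ.comp (by omega) f h) := by
  rw [ℳ.leibniz (n := n - 1) (p' := n + 1) (q' := 0) (by omega) rfl (by norm_num) (by omega)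
    (by omega) (by omega), hf]
  simp

theorem d_comp_of_closed {n : ℤ} {f : ℳ.Hom y z n} (hf : ℳ.d y z n (n + 1) f = 0)
    (h : ℳ.Hom x y (-1)) : ℳ.comp (zero_add n) (ℳ.d x y (-1) 0 h) f =
      ℳ.d x z (n - 1) n (n.negOnePow • ℳ.comp (by omega) h f) := by
  rw [DGCat.map_sign, ℳ.leibniz (n := n - 1) (p' := 0) (q' := n + 1) (by omega) (by norm_num) rfl
    (by omega) (by omega) (by omega), hf, map_zero, zero_add, smul_smul, Int.units_mul_self,
    one_smul]

theorem d_comp_closed {n m : ℤ} (hm : n + 1 = m) {α : ℳ.Hom y z 0} (hα : ℳ.d y z 0 1 α = 0)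
    (f : ℳ.Hom x y n) : ℳ.d x z n m (ℳ.comp (add_zero n) f α) =
      ℳ.comp (add_zero m) (ℳ.d x y n m f) α := by
  rw [ℳ.leibniz (p' := m) (q' := 1) _ hm (by norm_num) hm (by omega) (by omega), hα]
  simp

theorem d_closed_comp {n m : ℤ} (hm : n + 1 = m) {α : ℳ.Hom x y 0} (hα : ℳ.d x y 0 1 α = 0)
    (f : ℳ.Hom y z n) : ℳ.d x z n m (ℳ.comp (zero_add n) α f) =
      ℳ.comp (zero_add m) α (ℳ.d y z n m f) := by
  rw [ℳ.leibniz (p' := 1) (q' := m) _ (by norm_num) hm hm (by omega) (by omega), hα]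
  simp

/-- Composition with `β` is the inverse on cohomology: a closed morphism composed with a coboundary
is again a coboundary. -/
theorem IsHomotopyEquiv.isQis_comp_right {α : ℳ.Hom y z 0} (hα : IsHomotopyEquiv α) (n : ℤ) :
    IsQis ℳ ℳ x y x z (fun n => (ℳ.comp (add_zero n)).flip α) n := by
  obtain ⟨dα, β, dβ, ⟨h, hh⟩, h', hh'⟩ := hα
  constructor
  · intro a ha hb
    obtain ⟨b, hb⟩ := hb
    have e := ℳ.comp_one a
    rw [eq_sub_of_add_eq hh.symm, map_sub, comp_d_of_closed ha,
      ← ℳ.assoc (add_zero n) (zero_add 0) (add_zero n) (add_zero n)] at e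
    refine ⟨ℳ.comp (add_zero _) b β - ℳ.comp (by omega) a h, ?_⟩
    rw [map_sub, d_comp_closed (by omega) dβ, ← hb]
    exact e.symm
  · intro c hc
    have e := ℳ.comp_one c
    rw [eq_sub_of_add_eq hh'.symm, map_sub, comp_d_of_closed hc,
      ← ℳ.assoc (add_zero n) (zero_add 0) (add_zero n) (add_zero n)] at e
    refine ⟨ℳ.comp (add_zero n) c β, -ℳ.comp (by omega) c h', ?_, ?_⟩
    · rw [d_comp_closed rfl dβ, hc]
      simp
    · rw [map_neg, ← sub_eq_add_neg]
      exact e.symm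

theorem IsHomotopyEquiv.isQis_comp_left {α : ℳ.Hom x y 0} (hα : IsHomotopyEquiv α) (n : ℤ) :
    IsQis ℳ ℳ y z x z (fun n => ℳ.comp (zero_add n) α) n := by
  obtain ⟨dα, β, dβ, ⟨h, hh⟩, h', hh'⟩ := hα
  constructor
  · intro a ha hb
    obtain ⟨b, hb⟩ := hb
    have e := ℳ.one_comp a
    rw [eq_sub_of_add_eq hh'.symm, map_sub, LinearMap.sub_apply, d_comp_of_closed ha,
      ℳ.assoc (zero_add 0) (zero_add n) (zero_add n) (zero_add n)] at e
    refine ⟨ℳ.comp (zero_add _) β b - n.negOnePow • ℳ.comp (by omega) h' a, ?_⟩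
    rw [map_sub, d_closed_comp (by omega) dβ, ← hb]
    exact e.symm
  · intro c hc
    have e := ℳ.one_comp c
    rw [eq_sub_of_add_eq hh.symm, map_sub, LinearMap.sub_apply, d_comp_of_closed hc,
      ℳ.assoc (zero_add 0) (zero_add n) (zero_add n) (zero_add n)] at e
    refine ⟨ℳ.comp (zero_add n) β c, -(n.negOnePow • ℳ.comp (by omega) h c), ?_, ?_⟩
    · rw [d_closed_comp rfl dβ, hc]
      simp
    · rw [map_neg, ← sub_eq_add_neg]
      exact e.symm

end DGCat

/-! ### Gluing along homotopy equivalences -/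

namespace GlueData

variable {k : Type w} [CommRing k] {𝒞 𝒟 : DGCat.{u, v} k} {ℳ : DGCat.{u', v} k}
  (G : GlueData 𝒞 𝒟 ℳ) {x y : 𝒞.Ob} {n : ℤ}

theorem postQis (hP : IsQis 𝒞 ℳ x y (G.P.obj x) (G.P.obj y) (G.P.map x y) n)
    (hα : DGCat.IsHomotopyEquiv (G.α y)) : G.PostQis x y n := by
  have e : (fun n => G.post x y n n) =
      fun n => (ℳ.comp (add_zero n)).flip (G.α y) ∘ₗ G.P.map x y n := by
    funext n
    ext f
    exact G.post_apply _ f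
  rw [PostQis, e]
  refine hP.comp (hα.isQis_comp_right n) (G.P.map_d x y) fun n m f => ?_
  by_cases h : n + 1 = m
  · exact (DGCat.d_comp_closed h (G.α_d y) f).symm
  · rw [ℳ.d_shape _ _ _ _ h, ℳ.d_shape _ _ _ _ h]
    simp

theorem preQis (hP : IsQis 𝒟 ℳ (G.r x) (G.r y) (G.P'.obj (G.r x)) (G.P'.obj (G.r y))
      (G.P'.map (G.r x) (G.r y)) n)
    (hα : DGCat.IsHomotopyEquiv (G.α x)) : G.PreQis x y n := by
  have e : (fun n => G.pre x y n n) =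
      fun n => ℳ.comp (zero_add n) (G.α x) ∘ₗ G.P'.map (G.r x) (G.r y) n := by
    funext n
    ext f
    exact G.pre_apply _ f
  rw [PreQis, e]
  refine hP.comp (hα.isQis_comp_left n) (G.P'.map_d _ _) fun n m f => ?_
  by_cases h : n + 1 = m
  · exact (DGCat.d_closed_comp h (G.α_d x) f).symm
  · rw [ℳ.d_shape _ _ _ _ h, ℳ.d_shape _ _ _ _ h]
    simp

end GlueData

end DGRec

namespace DGRec

/-! ### Families of augmented complexes of projectives -/

section Families

open CochainComplex HomComplex Limits

variable {k : Type w} [Field k] {R : Type u} [Ring R] [Algebra k R]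
  {R' : Type u'} [Ring R'] [Algebra k R']

/-- The map on cochains induced by a linear functor between categories of modules. -/
def mapCochain (k : Type w) [Field k] {R : Type u} [Ring R] [Algebra k R]
    {R' : Type u'} [Ring R'] [Algebra k R'] (F : ModuleCat.{v} R ⥤ ModuleCat.{v} R') [F.Additive]
    [F.Linear k] (K L : CochainComplex (ModuleCat.{v} R) ℤ) (n : ℤ) :
    Cochain K L n →ₗ[k] Cochain ((F.mapHomologicalComplex _).obj K)
      ((F.mapHomologicalComplex _).obj L) n where
  toFun z := Cochain.map z F
  map_add' z z' := Cochain.map_add z z' F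
  map_smul' c z := by
    ext p q hpq : 1
    exact F.map_smul c (z.v p q hpq)

/-- The DG-functor induced by a linear functor between categories of modules. -/
def mapDGFunctor (k : Type w) [Field k] {R : Type u} [Ring R] [Algebra k R]
    {R' : Type u'} [Ring R'] [Algebra k R'] (F : ModuleCat.{v} R ⥤ ModuleCat.{v} R') [F.Additive]
    [F.Linear k] {ι : Type*} (Q : ι → CochainComplex (ModuleCat.{v} R) ℤ) :
    DGFunctor (homDGCat (k := k) Q)
      (homDGCat (k := k) (fun K : CochainComplex (ModuleCat.{v} R') ℤ => K)) where
  obj i := (F.mapHomologicalComplex _).obj (Q i)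
  map i j n := mapCochain k F (Q i) (Q j) n
  map_d i j p q f := (δ_map (K := Q i) (L := Q j) (n := p) (m := q) f F).symm
  map_one i := (Cochain.map_ofHom (Q i) (Q i) (𝟙 (Q i)) F).trans
    (congrArg Cochain.ofHom (CategoryTheory.Functor.map_id _ _))
  map_comp {i j l _ _ _} h f g :=
    Cochain.map_comp (F := Q i) (G := Q j) (K := Q l) (Φ := F) f g h

namespace IsAugmented

variable {C : Type*} [Category* C] [Abelian C] {P Y : CochainComplex C ℤ} {S T : C}
  {ε : P.X 0 ⟶ S} {η : Y.X 0 ⟶ T} {a b : ℤ}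

/-- Because `d ≫ η = 0`, composing the component into `Y⁰` with `η` carries coboundaries to
coboundaries of `Hom(P, T)`, up to sign. -/
theorem δ_v_comp (hY : IsAugmented Y η b) (n : ℤ) (z : Cochain P Y (n - 1)) :
    (δ (n - 1) n z).v (-n) 0 (by omega) ≫ η =
      n.negOnePow • (P.d (-n) (-(n - 1)) ≫ z.v (-(n - 1)) 0 (by omega) ≫ η) := by
  rw [δ_v (n - 1) n (by omega) z (-n) 0 (by omega) (-1) (-(n - 1)) (by omega) (by omega),
    Preadditive.add_comp, Category.assoc, hY.zero, comp_zero, zero_add, Linear.units_smul_comp,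
    Category.assoc]

theorem d_comp_v_comp (hY : IsAugmented Y η b) (n : ℤ) (z : Cochain P Y n)
    (hz : δ n (n + 1) z = 0) : P.d (-(n + 1)) (-n) ≫ z.v (-n) 0 (by omega) ≫ η = 0 := by
  have e := Cochain.congr_v hz (-(n + 1)) 0 (by omega)
  rw [δ_v n (n + 1) rfl z (-(n + 1)) 0 (by omega) (-1) (-n) (by omega) (by omega),
    Cochain.zero_v] at e
  have e' := congr($e ≫ η)
  rwa [Preadditive.add_comp, Category.assoc, hY.zero, comp_zero, zero_add, zero_comp,
    Linear.units_smul_comp, smul_eq_zero_iff_eq, Category.assoc] at e'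

theorem exists_comp_eq (hP : IsAugmented P ε a) (hY : IsAugmented Y η b)
    (f : Cochain P Y 0) (hf : δ 0 1 f = 0) :
    ∃ φ : S ⟶ T, f.v 0 0 (add_zero 0) ≫ η = ε ≫ φ := by
  have := hP.epi
  have h0 := hY.d_comp_v_comp 0 f hf
  exact ⟨hP.exact₀.desc _ h0, (hP.exact₀.g_desc _ h0).symm⟩

end IsAugmented

/-- A cocycle is determined up to coboundary by its composite with the augmentation. In negative
degrees that composite starts from a zero module; in degree `0` it is induced by a map `S i ⟶ S j`.
-/
theorem homDGCat_isConnective {ι : Type*} {Q : ι → CochainComplex (ModuleCat.{v} R) ℤ}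
    {S : ι → ModuleCat.{v} R} (ε : ∀ i, (Q i).X 0 ⟶ S i) (hQ : ∀ i a, IsAugmented (Q i) (ε i) a)
    [∀ i p, Projective ((Q i).X p)] (c : ℤ) (hc : ∀ i, ∀ m < c, IsZero ((Q i).X m))
    (hS : ∀ i (f : S i ⟶ S i), ∃ e : k, f = e • 𝟙 (S i))
    (hne : ∀ i j, i ≠ j → ∀ f : S i ⟶ S j, f = 0)
    (hnz : ∀ i (e : k), e • 𝟙 (S i) = 0 → e = 0) : (homDGCat (k := k) Q).IsConnective where
  neg := fun (i j : ι) n hn (a : Cochain (Q i) (Q j) n) (ha : δ n (n + 1) a = 0) => by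
    -- The resolution is exact in all negative degrees, so any bound below `c + n` may be chosen.
    obtain ⟨h, hh⟩ := (hQ j (c + n - 1)).exists_δ_eq (hc i) (by omega) a ha 0
      (((hQ i 0).isZero _ (by omega)).eq_of_src _ _)
    exact ⟨h, hh.symm⟩
  zero_of_ne := fun (i j : ι) hij (a : Cochain (Q i) (Q j) 0) (ha : δ 0 (0 + 1) a = 0) => by
    obtain ⟨φ, hφ⟩ := (hQ i 0).exists_comp_eq (hQ j 0) a ha
    rw [hne i j hij φ, comp_zero] at hφ
    obtain ⟨h, hh⟩ := (hQ j (c + 0 - 1)).exists_δ_eq (hc i) (by omega) a ha 0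
      (hφ.trans comp_zero.symm)
    exact ⟨h, hh.symm⟩
  zero_self := fun (i : ι) (a : Cochain (Q i) (Q i) 0) (ha : δ 0 (0 + 1) a = 0) => by
    obtain ⟨φ, hφ⟩ := (hQ i 0).exists_comp_eq (hQ i 0) a ha
    obtain ⟨e, rfl⟩ := hS i φ
    have hc' : δ 0 (0 + 1) (a - e • Cochain.ofHom (𝟙 (Q i))) = 0 := by
      rw [δ_sub, δ_smul, δ_ofHom, smul_zero, sub_zero]
      exact ha
    obtain ⟨h, hh⟩ := (hQ i (c + 0 - 1)).exists_δ_eq (hc i) (by omega)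
      (a - e • Cochain.ofHom (𝟙 (Q i))) hc' 0 (by
        have : (a - e • Cochain.ofHom (𝟙 (Q i))).v 0 0 (add_zero 0) ≫ ε i = 0 := by
          rw [Cochain.sub_v, Preadditive.sub_comp, hφ, Cochain.smul_v, Cochain.ofHom_v]
          simp
        exact this.trans comp_zero.symm)
    have e' : a = e • Cochain.ofHom (𝟙 (Q i)) + δ (0 - 1) 0 h := sub_eq_iff_eq_add'.1 hh.symm
    exact ⟨e, h, e'⟩
  one_not_exact := fun (i : ι) e => by
    rintro ⟨b, hb⟩
    have := (hQ i 0).epi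
    have e1 := Cochain.congr_v (show e • Cochain.ofHom (𝟙 (Q i)) = δ (0 - 1) 0 b from hb) 0 0
      (add_zero 0)
    rw [δ_v (0 - 1) 0 (by omega) b 0 0 (by omega) (-1) 1 (by omega) (by omega),
      ((hQ i 0).isZero 1 (by omega)).eq_of_src (b.v 1 0 _) 0, comp_zero, smul_zero, add_zero,
      Cochain.smul_v, Cochain.ofHom_v] at e1
    have e2 : e • ε i = 0 := by
      have := congr($e1 ≫ ε i)
      simpa [(hQ i 0).zero] using this
    refine hnz i e ?_
    rw [← cancel_epi (ε i), comp_zero, ← e2]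
    simp

/-- Exactness is detected in `Hom(P, S)`, which `F` does not change. A primitive there of the image
therefore comes from one over `R`, in every degree. -/
theorem exists_δ_eq_of_map_eq (F : ModuleCat.{v} R ⥤ ModuleCat.{v} R') [F.Additive]
    {P Y : CochainComplex (ModuleCat.{v} R) ℤ} {S : ModuleCat.{v} R} (ε : Y.X 0 ⟶ S)
    (hQ : ∀ a, IsAugmented Y ε a) [∀ p, Projective (P.X p)] (c : ℤ)
    (hc : ∀ m < c, IsZero (P.X m))
    (hFQ : IsAugmented ((F.mapHomologicalComplex _).obj Y) (F.map ε) c)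
    (hF : ∀ m, Function.Bijective (F.map : (P.X m ⟶ S) → _)) (n : ℤ) (a : Cochain P Y n)
    (ha : δ n (n + 1) a = 0) (b : Cochain ((F.mapHomologicalComplex _).obj P)
      ((F.mapHomologicalComplex _).obj Y) (n - 1)) (hb : Cochain.map a F = δ (n - 1) n b) :
    ∃ h : Cochain P Y (n - 1), δ (n - 1) n h = a := by
  have e := hFQ.δ_v_comp n b
  rw [← hb] at e
  obtain ⟨g, hg⟩ := (hF (-(n - 1))).2 (n.negOnePow • (b.v (-(n - 1)) 0 (by omega) ≫ F.map ε))
  refine (hQ (c + n - 1)).exists_δ_eq hc (by omega) a ha g ((hF (-n)).1 ?_)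
  refine (F.map_comp _ _).trans (e.trans ?_)
  exact ((F.map_comp _ _).trans ((congrArg (F.map _ ≫ ·) hg).trans
    (Linear.comp_units_smul _ _ _))).symm

/-- The class in `Hom(F P, F S)` comes from `Hom(P, S)`, where it lifts to a cocycle `f`. For `z`
and the image of `f` to be cohomologous, `F Y` must be exact in the degrees reached: these are at
least `c + n`, which exceeds `c` because `1 ≤ n`. -/
theorem exists_map_add_δ (F : ModuleCat.{v} R ⥤ ModuleCat.{v} R') [F.Additive]
    {P Y : CochainComplex (ModuleCat.{v} R) ℤ} {S : ModuleCat.{v} R} (ε : Y.X 0 ⟶ S)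
    (hQ : ∀ a, IsAugmented Y ε a) [∀ p, Projective (P.X p)] [∀ p, Projective (F.obj (P.X p))]
    (c : ℤ) (hc : ∀ m < c, IsZero (P.X m))
    (hFQ : IsAugmented ((F.mapHomologicalComplex _).obj Y) (F.map ε) c)
    (hF : ∀ m, Function.Bijective (F.map : (P.X m ⟶ S) → _)) (n : ℤ) (hn : 1 ≤ n)
    (z : Cochain ((F.mapHomologicalComplex _).obj P) ((F.mapHomologicalComplex _).obj Y) n)
    (hz : δ n (n + 1) z = 0) :
    ∃ (f : Cochain P Y n) (h : Cochain ((F.mapHomologicalComplex _).obj P)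
      ((F.mapHomologicalComplex _).obj Y) (n - 1)), δ n (n + 1) f = 0 ∧
      z = Cochain.map f F + δ (n - 1) n h := by
  have : ∀ p, Projective (((F.mapHomologicalComplex (ComplexShape.up ℤ)).obj P).X p) :=
    fun p => inferInstanceAs (Projective (F.obj (P.X p)))
  obtain ⟨g, hg⟩ := (hF (-n)).2 (z.v (-n) 0 (by omega) ≫ F.map ε)
  obtain ⟨f, hf, hf'⟩ := (hQ (c + n)).exists_cocycle hc (by omega) g ((hF (-(n + 1))).1 (by
    rw [F.map_comp, F.map_zero, hg]
    exact hFQ.d_comp_v_comp n z hz))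
  have e : (Cochain.map f F).v (-n) 0 (by omega) ≫ F.map ε = z.v (-n) 0 (by omega) ≫ F.map ε :=
    ((F.map_comp _ _).symm.trans (congrArg F.map hf')).trans hg
  obtain ⟨h, hh⟩ := hFQ.exists_δ_eq (c := c) (fun m hm => F.map_isZero (hc m hm)) (by omega)
    (z - Cochain.map f F) (by
      rw [δ_sub, δ_map, hf, Cochain.map_zero, sub_zero]
      exact hz) 0 (by
      rw [comp_zero, Cochain.sub_v]
      exact (Preadditive.sub_comp _ _ _).trans (sub_eq_zero.2 e.symm))
  exact ⟨f, h, hf, sub_eq_iff_eq_add'.1 hh.symm⟩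

theorem mapDGFunctor_isQis (F : ModuleCat.{v} R ⥤ ModuleCat.{v} R') [F.Additive] [F.Linear k]
    {ι : Type*} {Q : ι → CochainComplex (ModuleCat.{v} R) ℤ} {i j : ι}
    {S : ModuleCat.{v} R} (ε : (Q j).X 0 ⟶ S) (hQ : ∀ a, IsAugmented (Q j) ε a)
    [∀ p, Projective ((Q i).X p)] [∀ p, Projective (F.obj ((Q i).X p))] (c : ℤ)
    (hc : ∀ m < c, IsZero ((Q i).X m))
    (hFQ : IsAugmented ((F.mapHomologicalComplex _).obj (Q j)) (F.map ε) c)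
    (hF : ∀ m, Function.Bijective (F.map : ((Q i).X m ⟶ S) → _)) (n : ℤ) (hn : 1 ≤ n) :
    IsQis (homDGCat (k := k) Q) _ i j _ _ ((mapDGFunctor k F Q).map i j) n := by
  exact ⟨fun a ha ⟨b, hb⟩ => (exists_δ_eq_of_map_eq (P := Q i) F ε hQ c hc hFQ hF n a ha b hb).imp
    fun _ => Eq.symm, fun z hz => exists_map_add_δ (P := Q i) F ε hQ c hc hFQ hF n hn z hz⟩

end Families

end DGRec

namespace DGRec

/-! ### Quasi-isomorphisms of complexes of modules -/

section QuasiIsos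

open CochainComplex HomComplex Limits

variable {R : Type u} [Ring R]

theorem shortComplex_quasiIso_iff {S T : ShortComplex (ModuleCat.{v} R)} (φ : S ⟶ T) :
    ShortComplex.QuasiIso φ ↔
      (∀ x : S.X₂, S.g x = 0 → (∃ w, T.f w = φ.τ₂ x) → ∃ y, S.f y = x) ∧
      ∀ y : T.X₂, T.g y = 0 → ∃ x, S.g x = 0 ∧ ∃ w, y = φ.τ₂ x + T.f w := by
  have hg : ∀ x, T.g (φ.τ₂ x) = φ.τ₃ (S.g x) := fun x => ConcreteCategory.congr_hom φ.comm₂₃ x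
  have hf : ∀ x, T.f (φ.τ₁ x) = φ.τ₂ (S.f x) := fun x => ConcreteCategory.congr_hom φ.comm₁₂ x
  let K : LinearMap.ker S.g.hom →ₗ[R] LinearMap.ker T.g.hom := φ.τ₂.hom.restrict (fun x hx => by
    have := hg x
    rw [show S.g x = 0 from hx, map_zero] at this
    exact this)
  let H : (LinearMap.ker S.g.hom ⧸ LinearMap.range S.moduleCatToCycles) →ₗ[R]
      LinearMap.ker T.g.hom ⧸ LinearMap.range T.moduleCatToCycles :=
    Submodule.mapQ _ _ K (by
      rintro _ ⟨x, rfl⟩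
      exact ⟨φ.τ₁ x, Subtype.ext (hf x)⟩)
  let γ : ShortComplex.LeftHomologyMapData φ S.moduleCatLeftHomologyData
      T.moduleCatLeftHomologyData :=
    { φK := ModuleCat.ofHom K
      φH := ModuleCat.ofHom H
      commi := rfl
      commf' := by
        ext x
        exact Subtype.ext (hf x).symm
      commπ := rfl }
  rw [γ.quasiIso_iff, ConcreteCategory.isIso_iff_bijective]
  refine and_congr ?_ ?_
  · refine (injective_iff_map_eq_zero H).trans ⟨fun h x hx hw => ?_, fun h x hx => ?_⟩
    · obtain ⟨w, hw⟩ := hw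
      have := h (Submodule.Quotient.mk ⟨x, hx⟩)
        ((Submodule.Quotient.mk_eq_zero _).2 ⟨w, Subtype.ext hw⟩)
      obtain ⟨y, hy⟩ := (Submodule.Quotient.mk_eq_zero _).1 this
      exact ⟨y, congrArg Subtype.val hy⟩
    · obtain ⟨⟨x, hx'⟩, rfl⟩ := Submodule.mkQ_surjective _ x
      obtain ⟨w, hw⟩ := (Submodule.Quotient.mk_eq_zero _).1 hx
      obtain ⟨y, hy⟩ := h x hx' ⟨w, congrArg Subtype.val hw⟩
      exact (Submodule.Quotient.mk_eq_zero _).2 ⟨y, Subtype.ext hy⟩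
  · refine ⟨fun h y hy => ?_, fun h y => ?_⟩
    · obtain ⟨x, hx⟩ := h (Submodule.Quotient.mk ⟨y, hy⟩)
      obtain ⟨⟨x, hx'⟩, rfl⟩ := Submodule.mkQ_surjective _ x
      obtain ⟨w, hw⟩ := (Submodule.Quotient.eq _).1 hx
      refine ⟨x, hx', -w, ?_⟩
      have : T.f w = φ.τ₂ x - y := congrArg Subtype.val hw
      rw [map_neg, this]
      abel
    · obtain ⟨⟨y, hy⟩, rfl⟩ := Submodule.mkQ_surjective _ y
      obtain ⟨x, hx, w, rfl⟩ := h y hy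
      refine ⟨Submodule.Quotient.mk ⟨x, hx⟩, (Submodule.Quotient.eq _).2 ⟨-w, Subtype.ext ?_⟩⟩
      change T.f (-w) = φ.τ₂ x - (φ.τ₂ x + T.f w)
      rw [map_neg]
      abel

theorem quasiIsoAt_iff_exists {K L : CochainComplex (ModuleCat.{v} R) ℤ} (f : K ⟶ L) {l m m' : ℤ}
    (hl : l + 1 = m) (hm : m + 1 = m') :
    QuasiIsoAt f m ↔
      (∀ x : K.X m, K.d m m' x = 0 → (∃ w, L.d l m w = f.f m x) → ∃ y, K.d l m y = x) ∧
      ∀ y : L.X m, L.d m m' y = 0 → ∃ x, K.d m m' x = 0 ∧ ∃ w, y = f.f m x + L.d l m w := by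
  rw [quasiIsoAt_iff' f l m m' (by simp; omega) (by simp; omega), shortComplex_quasiIso_iff]
  rfl

theorem exactAt_iff_exists {K : CochainComplex (ModuleCat.{v} R) ℤ} {l m m' : ℤ}
    (hl : l + 1 = m) (hm : m + 1 = m') :
    K.ExactAt m ↔ ∀ x : K.X m, K.d m m' x = 0 → ∃ y, K.d l m y = x := by
  rw [HomologicalComplex.exactAt_iff' K l m m' (by simp; omega) (by simp; omega),
    ShortComplex.moduleCat_exact_iff]
  rfl

/-- Bounded above complexes of projectives are K-projective, so quasi-isomorphisms between them are
invertible up to homotopy. -/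
theorem exists_isHomotopyEquiv {k : Type w} [Field k] [Algebra k R]
    {U W : CochainComplex (ModuleCat.{v} R) ℤ} (hU : ∀ m, 0 < m → IsZero (U.X m))
    (hW : ∀ m, 0 < m → IsZero (W.X m)) [∀ m, Projective (U.X m)] [∀ m, Projective (W.X m)]
    (α : U ⟶ W) (hα : QuasiIso α) :
    DGCat.IsHomotopyEquiv (ℳ := homDGCat (k := k) fun K : CochainComplex (ModuleCat.{v} R) ℤ => K)
      (x := U) (y := W) (Cochain.ofHom α) := by
  have : U.IsStrictlyLE 0 := (isStrictlyLE_iff _ _).2 hU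
  have : W.IsStrictlyLE 0 := (isStrictlyLE_iff _ _).2 hW
  have := isKProjective_of_projective U 0
  have := isKProjective_of_projective W 0
  obtain ⟨e, rfl⟩ := (IsKProjective.quasiIso_iff α).1 hα
  refine ⟨δ_ofHom _, Cochain.ofHom e.inv, δ_ofHom _,
    ⟨Cochain.ofHomotopy e.homotopyHomInvId, ?_⟩, ⟨Cochain.ofHomotopy e.homotopyInvHomId, ?_⟩⟩
  · change Cochain.comp (Cochain.ofHom e.hom) (Cochain.ofHom e.inv) (zero_add 0) =
      Cochain.ofHom (𝟙 U) + δ (-1) 0 (Cochain.ofHomotopy e.homotopyHomInvId)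
    rw [δ_ofHomotopy, Cochain.ofHom_comp]
    abel
  · change Cochain.comp (Cochain.ofHom e.inv) (Cochain.ofHom e.hom) (zero_add 0) =
      Cochain.ofHom (𝟙 W) + δ (-1) 0 (Cochain.ofHomotopy e.homotopyInvHomId)
    rw [δ_ofHomotopy, Cochain.ofHom_comp]
    abel

end QuasiIsos

end DGRec

namespace DGRec

/-! ### Complexes of projectives with cohomology in two degrees -/

section Periodic

open CochainComplex HomComplex Limits

variable {R : Type u} [Ring R]

/-- A complex of projectives in degrees `c, …, 0`, with `H⁰ ≅ S`, with simple cohomology in degree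
`c`, and exact in between. -/
structure IsPeriodic (Y : CochainComplex (ModuleCat.{v} R) ℤ) {S : ModuleCat.{v} R}
    (ε : Y.X 0 ⟶ S) (c : ℤ) : Prop where
  aug : IsAugmented Y ε c
  projective : ∀ m, Projective (Y.X m)
  isZero : ∀ m < c, IsZero (Y.X m)
  simple : IsSimpleModule R (LinearMap.ker (Y.d c (c + 1)).hom)

theorem eq_zero_of_isZero {M : ModuleCat.{v} R} (hM : IsZero M) (x : M) : x = 0 :=
  (ModuleCat.subsingleton_of_isZero hM).elim x 0

theorem IsAugmented.exists_d_eq {Y : CochainComplex (ModuleCat.{v} R) ℤ} {S : ModuleCat.{v} R}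
    {ε : Y.X 0 ⟶ S} {a : ℤ} (hY : IsAugmented Y ε a) (x : Y.X 0) (hx : ε x = 0) :
    ∃ y, Y.d (-1) 0 y = x :=
  (ShortComplex.moduleCat_exact_iff _).1 hY.exact₀ x hx

namespace IsPeriodic

variable {U W : CochainComplex (ModuleCat.{v} R) ℤ} {S : ModuleCat.{v} R} {ε : U.X 0 ⟶ S}
  {η : W.X 0 ⟶ S} {c : ℤ}

/-- In degree `0` the augmentations identify both cohomologies with `S`. In degree `c` a nonzero map
of simple modules is bijective. For `c = 0` there is no separate lowest cohomology, hence the form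
of the last hypothesis. -/
theorem quasiIso (hU : IsPeriodic U ε c) (hW : IsPeriodic W η c) (α : U ⟶ W)
    (hα : α.f 0 ≫ η = ε)
    (h : c < 0 → ∃ x, U.d c (c + 1) x = 0 ∧ α.f c x ≠ 0) : QuasiIso α := by
  have hα' : ∀ x, η (α.f 0 x) = ε x := fun x => ConcreteCategory.congr_hom hα x
  have comm : ∀ i j x, α.f j (U.d i j x) = W.d i j (α.f i x) := fun i j x =>
    (ConcreteCategory.congr_hom (α.comm i j) x).symm
  refine ⟨fun m => (quasiIsoAt_iff_exists α (l := m - 1) (by omega) rfl).2 ?_⟩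
  rcases lt_trichotomy m 0 with hm | rfl | hm
  · rcases lt_trichotomy m c with hc | rfl | hc
    · exact ⟨fun x _ _ => ⟨0, by rw [map_zero, eq_zero_of_isZero (hU.isZero m hc) x]⟩,
        fun y _ => ⟨0, map_zero _, 0, by
          rw [map_zero, map_zero, eq_zero_of_isZero (hW.isZero m hc) y, add_zero]⟩⟩
    · have := hU.simple
      have := hW.simple
      obtain ⟨x₀, hx₀, hx₀'⟩ := h hm
      let φ : LinearMap.ker (U.d m (m + 1)).hom →ₗ[R] LinearMap.ker (W.d m (m + 1)).hom :=
        (α.f m).hom.restrict (fun x hx => by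
          have := comm m (m + 1) x
          rw [show U.d m (m + 1) x = 0 from hx, map_zero] at this
          exact this.symm)
      have hφ : Function.Bijective φ := φ.bijective_or_eq_zero.resolve_right fun h0 =>
        hx₀' (congrArg Subtype.val (LinearMap.congr_fun h0 ⟨x₀, hx₀⟩))
      constructor
      · rintro x hx ⟨w, hw⟩
        rw [eq_zero_of_isZero (hW.isZero (m - 1) (by omega)) w, map_zero] at hw
        have := hφ.1 (a₁ := ⟨x, hx⟩) (a₂ := 0) (by rw [map_zero]; exact Subtype.ext hw.symm)
        exact ⟨0, by rw [map_zero]; exact (congrArg Subtype.val this).symm⟩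
      · intro y hy
        obtain ⟨⟨x, hx⟩, hxy⟩ := hφ.2 ⟨y, hy⟩
        exact ⟨x, hx, 0, by rw [map_zero, add_zero]; exact (congrArg Subtype.val hxy).symm⟩
    · refine ⟨fun x hx _ => (exactAt_iff_exists (by omega) rfl).1 (hU.aug.exact m hc hm) x hx,
        fun y hy => ?_⟩
      obtain ⟨w, hw⟩ := (exactAt_iff_exists (l := m - 1) (by omega) rfl).1
        (hW.aug.exact m hc hm) y hy
      exact ⟨0, map_zero _, w, by rw [map_zero, zero_add, hw]⟩
  · refine ⟨fun x _ ⟨w, hw⟩ => hU.aug.exists_d_eq x ?_, fun y _ => ?_⟩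
    · have := ConcreteCategory.congr_hom hW.aug.zero w
      rw [← hα' x, ← hw]
      exact this
    · have := hU.aug.epi
      obtain ⟨x, hx⟩ := (ModuleCat.epi_iff_surjective ε).1 inferInstance (η y)
      obtain ⟨w, hw⟩ := hW.aug.exists_d_eq (y - α.f 0 x) (by rw [map_sub, hα', hx, sub_self])
      exact ⟨x, eq_zero_of_isZero (hU.aug.isZero _ (by omega)) _, w,
        (sub_eq_iff_eq_add'.1 hw.symm)⟩
  · exact ⟨fun x _ _ => ⟨0, by rw [map_zero, eq_zero_of_isZero (hU.aug.isZero m hm) x]⟩,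
      fun y _ => ⟨0, map_zero _, 0, by
        rw [map_zero, map_zero, eq_zero_of_isZero (hW.aug.isZero m hm) y, add_zero]⟩⟩

/-- The comparison theorem for resolutions: `U` starts in degree `c`, so exactness of `W` above `c`
suffices. -/
theorem exists_hom (hU : IsPeriodic U ε c) (hW : IsPeriodic W η c) :
    ∃ α : U ⟶ W, α.f 0 ≫ η = ε := by
  have := hU.projective
  obtain ⟨f, hf, hf'⟩ := hW.aug.exists_cocycle (k := 0) hU.isZero (by omega) ε hU.aug.zero
  exact ⟨Cocycle.homOf (Cocycle.mk f 1 (by omega) hf), hf'⟩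

/-- Corrects a morphism by an isomorphism of the lowest cohomology modules. -/
theorem exists_hom_of_comp_eq_zero (hU : IsPeriodic U ε c) (hc : c < 0)
    (e : LinearMap.ker (U.d c (c + 1)).hom ≃ₗ[R] LinearMap.ker (W.d c (c + 1)).hom)
    (α : U ⟶ W) (hα : α.f 0 ≫ η = ε) (β : W ⟶ U) (hβ : β.f 0 ≫ ε = η)
    (h0 : ∀ x, U.d c (c + 1) x = 0 → α.f c x = 0) :
    ∃ α' : U ⟶ W, α'.f 0 ≫ η = ε ∧ ∃ x, U.d c (c + 1) x = 0 ∧ α'.f c x ≠ 0 := by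
  have := hU.projective
  -- This endomorphism has zero augmentation, so it is homotopic to a chain map `z` that vanishes in
  -- all degrees above `c`.
  set θ : Cochain U U 0 := Cochain.ofHom (α ≫ β - 𝟙 U) with hθ
  obtain ⟨h, -, h2⟩ := hU.aug.exists_sub_δ θ (δ_ofHom _) (by
    change (α ≫ β - 𝟙 U).f 0 ≫ ε = 0
    rw [HomologicalComplex.sub_f_apply, Preadditive.sub_comp, HomologicalComplex.comp_f,
      Category.assoc, hβ, hα, HomologicalComplex.id_f, Category.id_comp, sub_self])
  set z := θ - δ (0 - 1) 0 h with hz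
  have hδ : δ 0 1 z = 0 := by rw [hz, δ_sub, hθ, δ_ofHom, δ_δ, sub_zero]
  have hzd : z.v c c (add_zero c) ≫ U.d c (c + 1) = 0 := by
    have := Cochain.congr_v hδ c (c + 1) rfl
    rw [δ_v 0 1 (by omega) z c (c + 1) rfl c (c + 1) (by omega) rfl, h2 (c + 1) (c + 1) _ (by omega),
      comp_zero, smul_zero, add_zero, Cochain.zero_v] at this
    exact this
  -- On the kernel in degree `c` the homotopy contributes nothing: its component into degree `c - 1`
  -- is zero, and `d x = 0`. As `α` vanishes there, `z` is `-1`, so the kernel is a direct summand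
  -- of `U.X c`.
  have hzx : ∀ x, U.d c (c + 1) x = 0 → z.v c c (add_zero c) x = -x := by
    intro x hx
    have e1 : (δ (0 - 1) 0 h).v c c (add_zero c) x = 0 := by
      rw [δ_v (0 - 1) 0 (by omega) h c c (add_zero c) (c - 1) (c + 1) (by omega) (by omega),
        (hU.isZero (c - 1) (by omega)).eq_of_tgt (h.v c (c - 1) _) 0, zero_comp, zero_add,
        Int.negOnePow_zero, one_smul, ConcreteCategory.comp_apply, hx, map_zero]
    have e2 : θ.v c c (add_zero c) x = β.f c (α.f c x) - x := by
      rw [hθ, Cochain.ofHom_v]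
      rfl
    have e3 : z.v c c (add_zero c) x =
        θ.v c c (add_zero c) x - (δ (0 - 1) 0 h).v c c (add_zero c) x := rfl
    rw [e3, e1, e2, h0 x hx, map_zero, zero_sub, sub_zero]
  -- Extends `-e` from the kernel to `U.X c`. Its values are cocycles and nothing precedes degree
  -- `c`, so `α + γ` is again a chain map.
  let γ : U.X c ⟶ W.X c := ModuleCat.ofHom ((LinearMap.ker (W.d c (c + 1)).hom).subtype ∘ₗ
    e.toLinearMap ∘ₗ (z.v c c (add_zero c)).hom.codRestrict (LinearMap.ker (U.d c (c + 1)).hom)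
      (fun x => ConcreteCategory.congr_hom hzd x))
  have hγd : γ ≫ W.d c (c + 1) = 0 := by
    ext x
    exact (e _).2
  have hγδ : δ 0 1 (Cochain.ofHom α + Cochain.single γ 0) = 0 := by
    rw [δ_add, δ_ofHom, Cochain.δ_single γ 0 1 (by omega) (c - 1) (c + 1) (by omega) rfl, hγd,
      (hU.isZero (c - 1) (by omega)).eq_of_src (U.d (c - 1) c ≫ γ) 0]
    simp
  refine ⟨Cocycle.homOf (Cocycle.mk (Cochain.ofHom α + Cochain.single γ 0) 1 (by omega) hγδ),
    ?_, ?_⟩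
  · change (Cochain.ofHom α + Cochain.single γ 0).v 0 0 (add_zero 0) ≫ η = ε
    rw [Cochain.add_v, Cochain.single_v_eq_zero _ _ _ _ _ hc.ne', add_zero, Cochain.ofHom_v, hα]
  · have := hU.simple
    have := IsSimpleModule.nontrivial R (LinearMap.ker (U.d c (c + 1)).hom)
    obtain ⟨⟨x, hx⟩, hx0⟩ := exists_ne (0 : LinearMap.ker (U.d c (c + 1)).hom)
    refine ⟨x, hx, fun h => hx0 ?_⟩
    have h3 : α.f c x + γ x = 0 := by
      have : (Cochain.ofHom α + Cochain.single γ 0).v c c (add_zero c) x = 0 := h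
      rw [Cochain.add_v, Cochain.single_v, Cochain.ofHom_v] at this
      exact this
    rw [h0 x hx, zero_add] at h3
    have h4 := (map_eq_zero_iff e e.injective).1 (Subtype.ext h3)
    have h5 : z.v c c (add_zero c) x = 0 := congrArg Subtype.val h4
    rw [hzx x hx, neg_eq_zero] at h5
    exact Subtype.ext h5

theorem exists_isHomotopyEquiv {k : Type w} [Field k] [Algebra k R] (hU : IsPeriodic U ε c)
    (hW : IsPeriodic W η c)
    (e : LinearMap.ker (U.d c (c + 1)).hom ≃ₗ[R] LinearMap.ker (W.d c (c + 1)).hom) :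
    ∃ α : (homDGCat (k := k) fun K : CochainComplex (ModuleCat.{v} R) ℤ => K).Hom U W 0,
      DGCat.IsHomotopyEquiv α := by
  have := hU.projective
  have := hW.projective
  obtain ⟨α, hα⟩ := hU.exists_hom hW
  obtain ⟨β, hβ⟩ := hW.exists_hom hU
  by_cases h1 : c < 0 → ∃ x, U.d c (c + 1) x = 0 ∧ α.f c x ≠ 0
  · exact ⟨_, DGRec.exists_isHomotopyEquiv hU.aug.isZero hW.aug.isZero α
      (hU.quasiIso hW α hα h1)⟩
  · push Not at h1
    obtain ⟨hc, h1⟩ := h1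
    obtain ⟨α', hα', h⟩ := hU.exists_hom_of_comp_eq_zero hc e α hα β hβ h1
    exact ⟨_, DGRec.exists_isHomotopyEquiv hU.aug.isZero hW.aug.isZero α'
      (hU.quasiIso hW α' hα' fun _ => h)⟩

end IsPeriodic

end Periodic

end DGRec

namespace DGRec

/-! ### Extension of scalars along a quotient map -/

section Extension
open MulOpposite Limits

variable {A : Type u} [Ring A] {I : TwoSidedIdeal A} {Λ : Type u'} [Ring Λ]

/-- Extension of scalars along `A → A/I ≅ Λ`. -/
noncomputable def extendAlong (φ : Λ ≃+* I.ringCon.Quotient) :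
    ModuleCat.{v} Aᵐᵒᵖ ⥤ ModuleCat.{v} Λᵐᵒᵖ :=
  extendScalars I ⋙ ModuleCat.restrictScalars (RingHom.op φ.toRingHom)

namespace extendAlong

variable (φ : Λ ≃+* I.ringCon.Quotient)

instance : (extendAlong.{u, u', v} φ).Additive :=
  inferInstanceAs (extendScalars I ⋙ ModuleCat.restrictScalars (RingHom.op φ.toRingHom)).Additive

/-- The projection `M → M/M·I`. -/
def proj (M : ModuleCat.{v} Aᵐᵒᵖ) (x : M) : (extendAlong φ).obj M := Ext.mk I M x

variable {φ} {M N : ModuleCat.{v} Aᵐᵒᵖ}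

theorem proj_surjective : Function.Surjective (proj φ M) := (mulIdeal I M).mkQ_surjective

theorem proj_add (x y : M) : proj φ M (x + y) = proj φ M x + proj φ M y := map_add (Ext.mk I M) x y

theorem proj_sub (x y : M) : proj φ M (x - y) = proj φ M x - proj φ M y := map_sub (Ext.mk I M) x y

theorem proj_zero : proj φ M 0 = 0 := map_zero (Ext.mk I M)

theorem proj_smul (a : A) (x : M) :
    proj φ M (op a • x) = op (φ.symm (I.ringCon.mk' a)) • proj φ M x := by
  change Ext.mk I M (op a • x) = op (φ (φ.symm (I.ringCon.mk' a))) • Ext.mk I M x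
  rw [φ.apply_symm_apply, map_smul]
  rfl

theorem map_proj (f : M ⟶ N) (x : M) : (extendAlong φ).map f (proj φ M x) = proj φ N (f x) := rfl

theorem proj_eq_zero_iff {x : M} : proj φ M x = 0 ↔ x ∈ mulIdeal I M :=
  Submodule.Quotient.mk_eq_zero (mulIdeal I M)

instance {k : Type w} [Field k] [Algebra k A] [Algebra k Λ] (ψ : Λ ≃ₐ[k] I.ringCon.Quotient) :
    (extendAlong.{u, u', v} (I := I) (Λ := Λ) ψ.toRingEquiv).Linear k where
  map_smul {M N} f c := by
    ext x
    obtain ⟨x, rfl⟩ := proj_surjective x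
    have h : (ψ.symm (I.ringCon.mk' (algebraMap k A c))) = algebraMap k Λ c := ψ.symm.commutes c
    exact (proj_smul (φ := ψ.toRingEquiv) (algebraMap k A c) (f x)).trans
      (congrArg (fun l => op l • _) h)

/-- The elements acting as zero on `M` form a two-sided ideal, and it contains `e`. -/
theorem mulIdeal_span_eq_bot {e : A} (h : ∀ x : M, op e • x = 0) :
    mulIdeal (idemIdeal e) M = ⊥ := by
  rw [mulIdeal, Submodule.span_eq_bot]
  rintro _ ⟨a, ha, x, rfl⟩
  induction ha using TwoSidedIdeal.span_induction generalizing x with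
  | mem a ha => rw [Set.mem_singleton_iff.1 ha, h]
  | zero => simp
  | add a b _ _ ha hb => rw [MulOpposite.op_add, add_smul, ha, hb, add_zero]
  | neg a _ ha => rw [MulOpposite.op_neg, neg_smul, ha, neg_zero]
  | left_absorb a b _ hb => rw [op_mul, mul_smul, hb]
  | right_absorb a b _ hb => rw [op_mul, mul_smul, hb, smul_zero]

theorem proj_bijective (hM : mulIdeal I M = ⊥) : Function.Bijective (proj φ M) := by
  refine ⟨fun x y h => ?_, proj_surjective⟩
  have : x - y ∈ mulIdeal I M := proj_eq_zero_iff (φ := φ).1 (by rw [proj_sub, h, sub_self])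
  rwa [hM, Submodule.mem_bot, sub_eq_zero] at this

/-- Since `N·I = 0`, a map `M → N` factors uniquely through `M/M·I`. -/
theorem map_bijective (hN : mulIdeal I N = ⊥) :
    Function.Bijective ((extendAlong φ).map : (M ⟶ N) → _) := by
  have hp := proj_bijective (φ := φ) hN
  constructor
  · intro f g h
    ext x
    exact hp.1 (ConcreteCategory.congr_hom h (proj φ M x))
  · intro g
    choose f hf using fun x => hp.2 (g (proj φ M x))
    refine ⟨ModuleCat.ofHom
      { toFun := f
        map_add' := fun x y => hp.1 (by rw [hf, proj_add, proj_add, hf, hf, map_add])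
        map_smul' := fun a x => hp.1 (by
          have := proj_smul (φ := φ) (unop a) (f x)
          have := proj_smul (φ := φ) (unop a) x
          simp_all) }, ?_⟩
    ext x
    obtain ⟨x, rfl⟩ := proj_surjective x
    exact hf x

/-- The projection is bijective and semilinear over a surjective ring homomorphism, so submodules
correspond. -/
theorem isSimpleModule_obj (hM : mulIdeal I M = ⊥) [hs : IsSimpleModule Aᵐᵒᵖ M] :
    IsSimpleModule Λᵐᵒᵖ ((extendAlong φ).obj M) := by
  let σ : Aᵐᵒᵖ →+* Λᵐᵒᵖ := RingHom.op (φ.symm.toRingHom.comp I.ringCon.mk')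
  have : RingHomSurjective σ := ⟨fun l => by
    obtain ⟨a, ha⟩ := I.ringCon.mk'_surjective (φ (unop l))
    refine ⟨op a, unop_injective ?_⟩
    change φ.symm (I.ringCon.mk' a) = unop l
    rw [ha, φ.symm_apply_apply]⟩
  let l : M →ₛₗ[σ] (extendAlong φ).obj M :=
    { toFun := proj φ M
      map_add' := proj_add
      map_smul' := fun a x => proj_smul (unop a) x }
  exact (LinearMap.isSimpleModule_iff_of_bijective l (proj_bijective hM)).1 hs

/-- Extension of scalars is left adjoint to restriction, which preserves epimorphisms; the remaining
factor is an equivalence. -/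
instance [Projective M] : Projective ((extendAlong φ).obj M) := by
  have h₁ : Projective ((extendScalars I).obj M) := by
    have : (ModuleCat.restrictScalars.{v} (RingHom.op I.ringCon.mk')).PreservesEpimorphisms :=
      ⟨fun f hf => (ModuleCat.epi_iff_surjective _).2 ((ModuleCat.epi_iff_surjective f).1 hf)⟩
    exact (extendRestrictAdj I).map_projective M inferInstance
  have : (ModuleCat.restrictScalars.{v} (RingHom.op φ.toRingHom)).IsEquivalence :=
    ModuleCat.restrictScalars_isEquivalence_of_ringEquiv (RingEquiv.op φ)
  exact ((ModuleCat.restrictScalars (RingHom.op φ.toRingHom)).asEquivalence.map_projective_iff _).2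
    h₁

theorem nonempty_iso_of_map (hM : mulIdeal I M = ⊥) (hN : mulIdeal I N = ⊥)
    (e : (extendAlong φ).obj M ≅ (extendAlong φ).obj N) : Nonempty (M ≅ N) := by
  obtain ⟨f, hf⟩ := (map_bijective (φ := φ) (M := M) hN).2 e.hom
  obtain ⟨g, hg⟩ := (map_bijective (φ := φ) (M := N) hM).2 e.inv
  refine ⟨⟨f, g, (map_bijective (φ := φ) hM).1 ?_, (map_bijective (φ := φ) hN).1 ?_⟩⟩ <;>
    simp [hf, hg]

end extendAlong

/-- The homology in a degree `m` with zero incoming differential is the kernel of the outgoing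
differential. -/
theorem nonempty_homology_equiv_ker {R : Type u} [Ring R] (K : CochainComplex (ModuleCat.{v} R) ℤ)
    {l m m' : ℤ} (hl : l + 1 = m) (hm : m + 1 = m') (h : IsZero (K.X l)) :
    Nonempty (K.homology m ≃ₗ[R] LinearMap.ker (K.d m m').hom) := by
  have h0 : LinearMap.range (K.sc' l m m').moduleCatToCycles = ⊥ := by
    rw [eq_bot_iff]
    rintro _ ⟨x, rfl⟩
    rw [eq_zero_of_isZero (M := (K.sc' l m m').X₁) h x, map_zero]
    exact zero_mem _
  exact ⟨(ShortComplex.homologyMapIso (K.isoSc' l m m' (by simp; omega) (by simp; omega)) ≪≫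
    (K.sc' l m m').moduleCatHomologyIso).toLinearEquiv.trans (Submodule.quotEquivOfEqBot _ h0)⟩

end Extension
end DGRec

namespace DGRec

/-! ### Periodic resolutions -/

section Resolutions

open Limits

theorem isAugmented_of_quasiIso {R : Type u} [Ring R] {Y : CochainComplex (ModuleCat.{v} R) ℤ}
    {S : ModuleCat.{v} R} (f : Y ⟶ (HomologicalComplex.single _ (ComplexShape.up ℤ) 0).obj S)
    [QuasiIso f] (hY : ∀ m, 0 < m → IsZero (Y.X m)) (a : ℤ) :
    IsAugmented Y (f.f 0 ≫ (HomologicalComplex.singleObjXSelf (ComplexShape.up ℤ) 0 S).hom) a := by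
  let L := (HomologicalComplex.single (ModuleCat.{v} R) (ComplexShape.up ℤ) 0).obj S
  let s := HomologicalComplex.singleObjXSelf (ComplexShape.up ℤ) 0 S
  have hL : ∀ m, m ≠ 0 → IsZero (L.X m) := fun m hm =>
    HomologicalComplex.isZero_single_obj_X _ _ _ _ hm
  have hq : ∀ m, QuasiIsoAt f m := fun m => inferInstance
  have zero : Y.d (-1) 0 ≫ f.f 0 = 0 := by
    rw [← f.comm, (hL (-1) (by omega)).eq_of_src (L.d (-1) 0) 0, comp_zero]
  refine ⟨(ModuleCat.epi_iff_surjective _).2 fun y => ?_, hY, ?_, ?_, fun m _ hm => ?_⟩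
  · obtain ⟨x, -, w, hw⟩ := ((quasiIsoAt_iff_exists f (neg_add_cancel 1) rfl).1 (hq 0)).2 (s.inv y)
      (eq_zero_of_isZero (hL 1 one_ne_zero) _)
    rw [eq_zero_of_isZero (hL (-1) (by omega)) w, map_zero, add_zero] at hw
    exact ⟨x, (congrArg s.hom hw.symm).trans (ConcreteCategory.congr_hom s.inv_hom_id y)⟩
  · rw [reassoc_of% zero, zero_comp]
  · refine (ShortComplex.moduleCat_exact_iff _).2 fun (x : Y.X 0) hx => ?_
    refine ((quasiIsoAt_iff_exists f (neg_add_cancel 1) rfl).1 (hq 0)).1 x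
      (eq_zero_of_isZero (hY 1 one_pos) _) ⟨0, ?_⟩
    have : s.inv (s.hom (f.f 0 x)) = f.f 0 x := ConcreteCategory.congr_hom s.hom_inv_id (f.f 0 x)
    rw [map_zero, ← this]
    exact ((congrArg s.inv hx).trans (map_zero s.inv.hom)).symm
  · refine (exactAt_iff_exists (l := m - 1) (by omega) rfl).2 fun x hx =>
      ((quasiIsoAt_iff_exists f (by omega) rfl).1 (hq m)).1 x hx
        ⟨0, eq_zero_of_isZero (hL m hm.ne) _ |>.trans (eq_zero_of_isZero (hL m hm.ne) _).symm⟩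

namespace IsAugmented

variable {R : Type u} [Ring R] {Y : CochainComplex (ModuleCat.{v} R) ℤ} {S T : ModuleCat.{v} R}
  {ε : Y.X 0 ⟶ S} {a : ℤ}

theorem comp_iso (h : IsAugmented Y ε a) (i : S ≅ T) : IsAugmented Y (ε ≫ i.hom) a := by
  have := h.epi
  refine ⟨inferInstance, h.isZero, by rw [reassoc_of% h.zero, zero_comp], ?_, h.exact⟩
  refine (ShortComplex.moduleCat_exact_iff _).2 fun (x : Y.X 0) hx => h.exists_d_eq x ?_
  have : i.inv (i.hom (ε x)) = ε x := ConcreteCategory.congr_hom i.hom_inv_id (ε x)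
  rw [← this]
  exact (congrArg i.inv hx).trans (map_zero i.inv.hom)

end IsAugmented

theorem IsPeriodic.comp_iso {R : Type u} [Ring R] {Y : CochainComplex (ModuleCat.{v} R) ℤ}
    {S T : ModuleCat.{v} R} {ε : Y.X 0 ⟶ S} {c : ℤ} (h : IsPeriodic Y ε c) (i : S ≅ T) :
    IsPeriodic Y (ε ≫ i.hom) c :=
  ⟨h.aug.comp_iso i, h.projective, h.isZero, h.simple⟩

namespace PeriodicSetup

variable {A : Type u} [Ring A] [Algebra ℂ A] {e : A} {n t : ℕ} {S : Fin t → ModuleCat.{u} Aᵐᵒᵖ}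
  {Q : Fin t → CochainComplex (ModuleCat.{u} Aᵐᵒᵖ) ℤ} (h : PeriodicSetup e n S Q)
  {Λ : Type u} [Ring Λ] [Algebra ℂ Λ] (φ : Λ ≃ₐ[ℂ] Con e)

include h

theorem mulIdeal_eq_bot (j : Fin t) : mulIdeal (idemIdeal e) (S j) = ⊥ :=
  extendAlong.mulIdeal_span_eq_bot (h.annihilated j)

theorem isZero_of_lt (j : Fin t) (m : ℤ) (hm : m < 1 - n) : IsZero ((Q j).X m) :=
  h.bounded j m (by omega)

theorem projective_X (j : Fin t) (m : ℤ) : Projective ((Q j).X m) := by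
  have := h.projective j m
  exact ((Q j).X m).projective_of_categoryTheory_projective

theorem exists_isAugmented :
    ∃ ε : ∀ j, (Q j).X 0 ⟶ S j, ∀ j a, IsAugmented (Q j) (ε j) a := by
  choose f hf using h.resolution
  exact ⟨_, fun j a => isAugmented_of_quasiIso (f j) (fun m hm => h.bounded j m (by omega)) a⟩

theorem exists_ker_equiv (j : Fin t) :
    Nonempty (LinearMap.ker ((((extendAlong φ.toRingEquiv).mapHomologicalComplex _).obj (Q j)).d
      (1 - n) (1 - n + 1)).hom ≃ₗ[Λᵐᵒᵖ] (extendAlong φ.toRingEquiv).obj (S j)) := by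
  obtain ⟨i⟩ := h.cohomology j _ (Or.inr rfl)
  obtain ⟨i'⟩ := nonempty_homology_equiv_ker
    (((extendScalars (idemIdeal e)).mapHomologicalComplex _).obj (Q j))
    (sub_add_cancel (1 - (n : ℤ)) 1) rfl
    ((extendScalars (idemIdeal e)).map_isZero (h.isZero_of_lt j _ (by omega)))
  let l := i'.symm.trans i.toLinearEquiv
  -- The underlying additive map is unchanged: `Λ` acts through `φ` on both sides.
  exact ⟨{ l with map_smul' := fun a x => l.map_smul (RingHom.op φ.toRingEquiv.toRingHom a) x }⟩

theorem isPeriodic (ε : ∀ j, (Q j).X 0 ⟶ S j) (hε : ∀ j a, IsAugmented (Q j) (ε j) a)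
    (j : Fin t) :
    IsPeriodic (((extendAlong φ.toRingEquiv).mapHomologicalComplex _).obj (Q j))
      ((extendAlong φ.toRingEquiv).map (ε j)) (1 - n) := by
  have hp := h.projective_X j
  have hI := h.mulIdeal_eq_bot j
  refine ⟨⟨?_, fun m hm => ?_, ?_, ?_, fun m hm hm' => ?_⟩, fun m => ?_, fun m hm => ?_, ?_⟩
  · have := (hε j 0).epi
    refine (ModuleCat.epi_iff_surjective _).2 fun y => ?_
    obtain ⟨y, rfl⟩ := extendAlong.proj_surjective y
    obtain ⟨x, rfl⟩ := (ModuleCat.epi_iff_surjective (ε j)).1 inferInstance y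
    exact ⟨_, extendAlong.map_proj (ε j) x⟩
  · exact (extendAlong φ.toRingEquiv).map_isZero ((hε j 0).isZero m hm)
  · exact ((extendAlong φ.toRingEquiv).map_comp _ _).symm.trans
      ((congrArg _ (hε j 0).zero).trans ((extendAlong φ.toRingEquiv).map_zero _ _))
  · refine (ShortComplex.moduleCat_exact_iff _).2 fun x hx => ?_
    obtain ⟨x, rfl⟩ := extendAlong.proj_surjective (φ := φ.toRingEquiv) (M := (Q j).X 0) x
    -- Vanishing modulo the ideal already means vanishing, because `S j` maps bijectively to its
    -- extension of scalars.
    have hx' : ε j x = 0 := (extendAlong.proj_bijective (φ := φ.toRingEquiv) hI).1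
      (hx.trans extendAlong.proj_zero.symm)
    obtain ⟨y, rfl⟩ := (hε j 0).exists_d_eq x hx'
    exact ⟨_, extendAlong.map_proj ((Q j).d (-1) 0) y⟩
  · have := (exactAt_iff_exists (sub_add_cancel m 1) rfl).1
      ((HomologicalComplex.exactAt_iff_isZero_homology _ _).2 (h.acyclic j m (by omega)))
    exact (exactAt_iff_exists (sub_add_cancel m 1) rfl).2 this
  · exact inferInstanceAs (Projective ((extendAlong φ.toRingEquiv).obj ((Q j).X m)))
  · exact (extendAlong φ.toRingEquiv).map_isZero (h.isZero_of_lt j m hm)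
  · obtain ⟨l⟩ := h.exists_ker_equiv φ j
    have := h.simple j
    have := extendAlong.isSimpleModule_obj (φ := φ.toRingEquiv) hI
    exact IsSimpleModule.congr l

theorem bijective_of_iso {T : Fin t → ModuleCat.{u} Λᵐᵒᵖ} (τ : Fin t → Fin t)
    (hτ : ∀ j, Nonempty ((extendAlong φ.toRingEquiv).obj (S j) ≅ T (τ j))) :
    Function.Bijective τ := by
  refine Finite.injective_iff_bijective.1 fun i j hij => h.distinct i j ?_
  obtain ⟨a⟩ := hτ i
  obtain ⟨b⟩ := hτ j
  exact extendAlong.nonempty_iso_of_map (h.mulIdeal_eq_bot i) (h.mulIdeal_eq_bot j)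
    (a ≪≫ eqToIso (congrArg T hij) ≪≫ b.symm)

open ModuleCat in
-- Schur's lemma: endomorphisms of a finite dimensional simple module over `ℂ` are scalars, and maps
-- between non-isomorphic simple modules are zero.
theorem isConnective (ε : ∀ j, (Q j).X 0 ⟶ S j) (hε : ∀ j a, IsAugmented (Q j) (ε j) a) :
    (homDGCat (k := ℂ) Q).IsConnective := by
  have := h.projective_X
  have := h.simple
  refine homDGCat_isConnective ε hε (1 - n) (fun i m hm => h.isZero_of_lt i m hm)
    (fun i f => ?_) (fun i j hij f => ?_) fun i c hc => ?_
  · have : Module.Finite ℂ (S i) := h.finiteDimensional i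
    obtain ⟨c, hc⟩ := (IsSimpleModule.algebraMap_end_bijective_of_isAlgClosed
      (A := Aᵐᵒᵖ) (V := S i) ℂ).2 f.hom
    exact ⟨c, by ext x; exact (LinearMap.congr_fun hc x).symm⟩
  · refine ModuleCat.hom_ext (f.hom.bijective_or_eq_zero.resolve_left fun hf => hij ?_)
    exact h.distinct i j ⟨(LinearEquiv.ofBijective f.hom hf).toModuleIso⟩
  · have := IsSimpleModule.nontrivial Aᵐᵒᵖ (S i)
    obtain ⟨x, hx⟩ := exists_ne (0 : S i)
    have : c • x = 0 := ConcreteCategory.congr_hom hc x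
    exact (smul_eq_zero.1 this).resolve_right hx

end PeriodicSetup

end Resolutions

end DGRec

/-! ### Comparison of the two families over the common quotient algebra -/

theorem corollary7 {A B : Type u} [Ring A] [Algebra ℂ A] [Ring B] [Algebra ℂ B]
    (eA : A) (eB : B) (t n : ℕ) (hn : 1 ≤ n)
    (SA : Fin t → ModuleCat.{u} Aᵐᵒᵖ) (QA : Fin t → CochainComplex (ModuleCat.{u} Aᵐᵒᵖ) ℤ)
    (SB : Fin t → ModuleCat.{u} Bᵐᵒᵖ) (QB : Fin t → CochainComplex (ModuleCat.{u} Bᵐᵒᵖ) ℤ)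
    (hA : DGRec.PeriodicSetup eA n SA QA) (hB : DGRec.PeriodicSetup eB n SB QB)
    (hcon : Nonempty (DGRec.Con eA ≃ₐ[ℂ] DGRec.Con eB))
    (htA : DGRec.HasExactlySimples (DGRec.Con eA) t)
    (htB : DGRec.HasExactlySimples (DGRec.Con eB) t) :
    ∃ Φ : DGRec.AInfFunctor (DGRec.homDGCat (k := ℂ) QA).toAInf
        (DGRec.homDGCat (k := ℂ) QB).toAInf,
      Φ.IsQuasiIso := by
  open DGRec in
  obtain ⟨φ⟩ := hcon
  obtain ⟨T, -, -, hT⟩ := htA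
  obtain ⟨ε, hε⟩ := hA.exists_isAugmented
  obtain ⟨η, hη⟩ := hB.exists_isAugmented
  -- `Con eA` itself serves as `Λ`: the identification is trivial on the side of `A` and given by
  -- `φ` on the side of `B`.
  let FA := extendAlong.{u, u, u} (AlgEquiv.refl (R := ℂ) (A₁ := Con eA)).toRingEquiv
  let FB := extendAlong.{u, u, u} φ.toRingEquiv
  have hpA := hA.isPeriodic AlgEquiv.refl ε hε
  have hpB := hB.isPeriodic φ η hη
  have hA' := hA.simple
  have hB' := hB.simple
  have hQA := hA.projective_X
  have hQB := hB.projective_X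
  choose τA hτA using fun j => hT (FA.obj (SA j))
    (extendAlong.isSimpleModule_obj (hA.mulIdeal_eq_bot j))
  choose τB hτB using fun j => hT (FB.obj (SB j))
    (extendAlong.isSimpleModule_obj (hB.mulIdeal_eq_bot j))
  have bA := hA.bijective_of_iso AlgEquiv.refl τA hτA
  have bB := hB.bijective_of_iso φ τB hτB
  -- Both families of `t` simple modules exhaust the list `T`, so `r` pairs the indices that yield
  -- the same simple `Λ`-module.
  let r := (Equiv.ofBijective τA bA).trans (Equiv.ofBijective τB bB).symm
  have hr : ∀ j, τB (r j) = τA j := fun j =>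
    (Equiv.ofBijective τB bB).apply_symm_apply (τA j)
  have hi : ∀ j, Nonempty (FA.obj (SA j) ≅ FB.obj (SB (r j))) := fun j =>
    ⟨(hτA j).some ≪≫ eqToIso (congrArg T (hr j).symm) ≪≫ (hτB (r j)).some.symm⟩
  have hα : ∀ j, ∃ α, DGCat.IsHomotopyEquiv (ℳ := homDGCat (k := ℂ) fun K => K)
      (x := (FA.mapHomologicalComplex (ComplexShape.up ℤ)).obj (QA j))
      (y := (FB.mapHomologicalComplex (ComplexShape.up ℤ)).obj (QB (r j))) α := fun j =>
    ((hpA j).comp_iso (hi j).some).exists_isHomotopyEquiv (hpB (r j))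
      -- The lowest cohomology modules are copies of the paired simple modules, hence isomorphic.
      ((((hA.exists_ker_equiv AlgEquiv.refl j).some).trans (hi j).some.toLinearEquiv).trans
        (hB.exists_ker_equiv φ (r j)).some.symm)
  choose α hα using hα
  let G : GlueData (homDGCat (k := ℂ) QA) (homDGCat (k := ℂ) QB) (homDGCat (k := ℂ) fun K => K) :=
    { P := mapDGFunctor ℂ FA QA
      P' := mapDGFunctor ℂ FB QB
      r := r
      α := α
      α_d := fun x => (hα x).1 }
  refine exists_aInfFunctor_of_roof G r.bijective (hA.isConnective ε hε) (hB.isConnective η hη)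
    (fun (x y : Fin t) m hm => G.postQis ?_ (hα y)) (fun (x y : Fin t) m hm => G.preQis ?_ (hα x))
  · exact mapDGFunctor_isQis FA (i := x) (ε y) (hε y) (1 - n) (hA.isZero_of_lt x) (hpA y).aug
      (fun m => extendAlong.map_bijective (hA.mulIdeal_eq_bot y)) m hm
  · exact mapDGFunctor_isQis FB (i := r x) (η (r y)) (hη (r y)) (1 - n) (hB.isZero_of_lt (r x))
      (hpB (r y)).aug (fun m => extendAlong.map_bijective (hB.mulIdeal_eq_bot (r y))) m hm
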